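/- \textbf{Theorem (Partial five-dimensional Lorentzian Goldberg--Sachs theorem).} Let $(M,g)$ be a smooth five-dimensional Lorentzian manifold of signature $(-,+,+,+,+)$, with Levi-Civita connection $\nabla$, Weyl tensor $C_{abcd}$, Rho (Schouten) tensor $P_{ab}$ and Cotton--York tensor $A_{abc}=\nabla_b P_{ca}-\nabla_c P_{ba}$, all extended complex-multilinearly to $\mathbb{C}\otimes TM$. Let $(N,K)$ be an almost optical structure on $M$: $N\subset\mathbb{C}\otimes TM$ is a smooth complex subbundle of rank $2$ which is totally null, i.e. $N\subset N^\perp$, the intersection $N\cap\overline{N}$ has complex dimension $1$ at every point, and $K\subset TM$ is the real null line bundle with $N\cap\overline{N}=\mathbb{C}\otimes K$. Suppose that the Weyl tensor is generically algebraically special relative to $N$, that is: (i) $C(X,Y,Z,\cdot)=0$ for all $X,Y\in\Gamma(N^\perp)$ and $Z\in\Gamma(N)$; (ii) (no further degeneracy) on a dense subset of $M$ one has $\Psi_2\neq\Psi_2^0$ and $\Psi_2\neq-\Psi_2^0$. Here $\Psi_2=C(k,\bar m,\ell,m)\in\mathbb{C}$ and $\Psi_2^0=C(k,u,\ell,u)\in\mathbb{R}$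 for a null frame $(k,\ell,m,\bar m,u)$ with $k,\ell,u$ real, whose only non-zero scalar products are $g(k,\ell)=g(m,\bar m)=g(u,u)=1$, and which is adapted to $(N,K)$ in the sense that $K=\mathrm{span}\{k\}$ and $N=\mathrm{span}\{k,\bar m\}$; given (i), these numbers do not depend on the choice of adapted frame. Suppose also that the Cotton--York tensor satisfies $A(Z,X,Y)=0$ for all $X,Y\in\Gamma(N^\perp)$ and $Z\in\Gamma(N)$. Then $(N,K)$ is integrable, i.e. it is an optical structure: both $N$ and $N^\perp$ are integrable in the sense of Frobenius, $[\Gamma(N),\Gamma(N)]\subset\Gamma(N)$ and $[\Gamma(N^\perp),\Gamma(N^\perp)]\subset\Gamma(N^\perp)$. -/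

import Mathlib

open scoped Manifold ContDiff TensorProduct

noncomputable section

namespace GoldbergSachs

/-- The model space of five-dimensional manifolds. -/
abbrev E5 : Type := EuclideanSpace ℝ (Fin 5)

/-! ### Complexified vector spaces -/

section Complexification

variable {V : Type*} [AddCommGroup V] [Module ℝ V]

/-- The complex vector `u + i v` in the complexification of `V`. -/
def cvec (u v : V) : ℂ ⊗[ℝ] V := (1 : ℂ) ⊗ₜ[ℝ] u + Complex.I ⊗ₜ[ℝ] v

/-- Complex conjugation on the complexification of `V`. -/
def conjC : ℂ ⊗[ℝ] V →ₗ[ℝ] ℂ ⊗[ℝ] V :=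
  LinearMap.rTensor V Complex.conjAe.toLinearMap

theorem conjC_smul (c : ℂ) (z : ℂ ⊗[ℝ] V) :
    conjC (c • z) = (starRingEnd ℂ c) • conjC z := by
  induction z using TensorProduct.induction_on with
  | zero => simp
  | tmul a v => simp [conjC, TensorProduct.smul_tmul']
  | add a b ha hb => rw [smul_add, map_add, ha, hb, map_add, smul_add]

theorem conjC_conjC (z : ℂ ⊗[ℝ] V) : conjC (conjC z) = z := by
  induction z using TensorProduct.induction_on with
  | zero => simp
  | tmul a v => simp [conjC]
  | add a b ha hb => rw [map_add, map_add, ha, hb]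

/-- The complex conjugate of a complex subspace of the complexification of `V`.  As conjugation is
an involution, its elements are the `z` with `conjC z` in the given subspace. -/
def conjSubmodule (N : Submodule ℂ (ℂ ⊗[ℝ] V)) : Submodule ℂ (ℂ ⊗[ℝ] V) where
  carrier := {z | conjC z ∈ N}
  add_mem' := by
    intro a b ha hb
    simpa using N.add_mem ha hb
  zero_mem' := by simp
  smul_mem' := by
    intro c z hz
    simpa [conjC_smul] using N.smul_mem _ hz

end Complexification

/-! ### Coordinate expressions of the curvature tensors

Here `G y` is the matrix `g_{ij}` of a metric in local coordinates `y`. -/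

section Coordinates

/-- The partial derivative in the `i`-th coordinate direction. -/
def pd (i : Fin 5) (f : E5 → ℝ) (y : E5) : ℝ :=
  fderiv ℝ f y (EuclideanSpace.single i 1)

variable (G : E5 → Matrix (Fin 5) (Fin 5) ℝ)

/-- Christoffel symbols `Γ^k_{ij}` of the Levi-Civita connection. -/
def christoffel (k i j : Fin 5) (y : E5) : ℝ :=
  (1 / 2) * ∑ l, (G y)⁻¹ k l *
    (pd i (fun z => G z j l) y + pd j (fun z => G z i l) y - pd l (fun z => G z i j) y)

/-- The Riemann tensor `R_{abc}^d`, with `R_{abc}^d V^c = (∇_a ∇_b - ∇_b ∇_a) V^d`. -/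
def riemannUp (a b c d : Fin 5) (y : E5) : ℝ :=
  pd a (christoffel G d b c) y - pd b (christoffel G d a c) y
    + ∑ m, (christoffel G d a m y * christoffel G m b c y
      - christoffel G d b m y * christoffel G m a c y)

/-- The Riemann tensor `R_{abcd} = R_{abc}^e g_{ed}`. -/
def riemann (a b c d : Fin 5) (y : E5) : ℝ :=
  ∑ e, riemannUp G a b c e y * G y e d

/-- The Ricci tensor `R_{bc} = R_{abc}^a`. -/
def ricci (b c : Fin 5) (y : E5) : ℝ := ∑ a, riemannUp G a b c a y

/-- The scalar curvature. -/
def scalarCurv (y : E5) : ℝ := ∑ a, ∑ b, (G y)⁻¹ a b * ricci G a b y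

/-- The Rho (Schouten) tensor in dimension five. -/
def rho (a b : Fin 5) (y : E5) : ℝ :=
  (1 / 3) * (ricci G a b y - (1 / 8) * scalarCurv G y * G y a b)

/-- The Weyl tensor, `R_{abcd} = C_{abcd} - 4 g_{[a|[c} P_{d]|b]}`. -/
def weyl (a b c d : Fin 5) (y : E5) : ℝ :=
  riemann G a b c d y
    + (G y a c * rho G b d y - G y b c * rho G a d y
      - G y a d * rho G b c y + G y b d * rho G a c y)

/-- The covariant derivative `∇_c P_{ab}` of the Rho tensor. -/
def covRho (c a b : Fin 5) (y : E5) : ℝ :=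
  pd c (rho G a b) y
    - ∑ m, (christoffel G m c a y * rho G m b y + christoffel G m c b y * rho G a m y)

/-- The Cotton-York tensor `A_{abc} = ∇_b P_{ca} - ∇_c P_{ba}`. -/
def cottonYork (a b c : Fin 5) (y : E5) : ℝ := covRho G b c a y - covRho G c b a y

end Coordinates

/-! ### Lorentzian five-manifolds -/

variable {M : Type*} [TopologicalSpace M] [ChartedSpace E5 M]

/-- The complexified tangent space. -/
abbrev CTangent (x : M) : Type := ℂ ⊗[ℝ] TangentSpace 𝓘(ℝ, E5) x

variable (M) in
/-- A smooth Lorentzian metric, of signature `(-,+,+,+,+)`, on a five-dimensional manifold. -/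
structure LorentzianMetric [IsManifold 𝓘(ℝ, E5) ∞ M] where
  inner (x : M) : TangentSpace 𝓘(ℝ, E5) x →L[ℝ] TangentSpace 𝓘(ℝ, E5) x →L[ℝ] ℝ
  symm (x : M) (v w : TangentSpace 𝓘(ℝ, E5) x) : inner x v w = inner x w v
  signature (x : M) : ∃ b : Module.Basis (Fin 5) ℝ (TangentSpace 𝓘(ℝ, E5) x),
    ∀ i j, inner x (b i) (b j) = if i = j then (if i = 0 then -1 else 1) else 0
  contMDiff : ContMDiff 𝓘(ℝ, E5) (𝓘(ℝ, E5).prod 𝓘(ℝ, E5 →L[ℝ] E5 →L[ℝ] ℝ)) ∞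
    (fun x => Bundle.TotalSpace.mk' (E5 →L[ℝ] E5 →L[ℝ] ℝ) x (inner x))

/-- Smoothness of a real vector field on a set. -/
def SmoothFieldOn (X : ∀ x : M, TangentSpace 𝓘(ℝ, E5) x) (U : Set M)
    [IsManifold 𝓘(ℝ, E5) ∞ M] : Prop :=
  ContMDiffOn 𝓘(ℝ, E5) (𝓘(ℝ, E5).prod 𝓘(ℝ, E5)) ∞
    (fun x => Bundle.TotalSpace.mk' E5 x (X x)) U

/-- `D` is a smooth complex subbundle of rank `r` of the complexified tangent bundle: its fibres
have dimension `r` and it is locally spanned by `r` smooth complex vector fields `X i + i Y i`. -/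
def IsSmoothSubbundle [IsManifold 𝓘(ℝ, E5) ∞ M] (r : ℕ)
    (D : ∀ x : M, Submodule ℂ (CTangent x)) : Prop :=
  (∀ x, Module.finrank ℂ (D x) = r) ∧
  ∀ x, ∃ U : Set M, IsOpen U ∧ x ∈ U ∧
    ∃ X Y : Fin r → ∀ x : M, TangentSpace 𝓘(ℝ, E5) x,
      (∀ i, SmoothFieldOn (X i) U) ∧ (∀ i, SmoothFieldOn (Y i) U) ∧
      ∀ y ∈ U, D y = Submodule.span ℂ (Set.range fun i => cvec (X i y) (Y i y))

/-- Integrability in the sense of Frobenius, `[Γ(D), Γ(D)] ⊆ Γ(D)`, of a complex distribution `D`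
(for sections over arbitrary open sets).  Sections are written `X + i Y` with `X`, `Y` real vector
fields, and the Lie bracket is extended complex-bilinearly. -/
def IsInvolutive [IsManifold 𝓘(ℝ, E5) ∞ M] (D : ∀ x : M, Submodule ℂ (CTangent x)) : Prop :=
  ∀ U : Set M, IsOpen U → ∀ X Y X' Y' : ∀ x : M, TangentSpace 𝓘(ℝ, E5) x,
    SmoothFieldOn X U → SmoothFieldOn Y U → SmoothFieldOn X' U → SmoothFieldOn Y' U →
    (∀ x ∈ U, cvec (X x) (Y x) ∈ D x) → (∀ x ∈ U, cvec (X' x) (Y' x) ∈ D x) →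
    ∀ x ∈ U,
      cvec
        (VectorField.mlieBracket 𝓘(ℝ, E5) X X' x - VectorField.mlieBracket 𝓘(ℝ, E5) Y Y' x)
        (VectorField.mlieBracket 𝓘(ℝ, E5) X Y' x + VectorField.mlieBracket 𝓘(ℝ, E5) Y X' x)
        ∈ D x

variable [IsManifold 𝓘(ℝ, E5) ∞ M]

/-- The complex-bilinear extension of the metric to the complexified tangent space. -/
def LorentzianMetric.complexForm (g : LorentzianMetric M) (x : M) :
    LinearMap.BilinForm ℂ (CTangent x) :=
  LinearMap.BilinForm.baseChange ℂ (g.inner x).toBilinForm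

/-- The orthogonal complement of a complex distribution. -/
def LorentzianMetric.perp (g : LorentzianMetric M) (D : ∀ x : M, Submodule ℂ (CTangent x))
    (x : M) : Submodule ℂ (CTangent x) :=
  (g.complexForm x).orthogonal (D x)

/-- An almost optical structure `(N, K)` on a five-dimensional Lorentzian manifold: a totally null
complex subbundle `N` of rank two of the complexified tangent bundle, of real index one, together
with the real line bundle `K` whose complexification is the intersection of `N` and its
conjugate. -/
structure AlmostOpticalStructure (g : LorentzianMetric M) where
  N : ∀ x : M, Submodule ℂ (CTangent x)
  K : ∀ x : M, Submodule ℝ (TangentSpace 𝓘(ℝ, E5) x)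
  subbundle : IsSmoothSubbundle 2 N
  totallyNull (x : M) : N x ≤ g.perp N x
  realIndex (x : M) : Module.finrank ℂ (N x ⊓ conjSubmodule (N x) : Submodule ℂ (CTangent x)) = 1
  complexification_K (x : M) : N x ⊓ conjSubmodule (N x) = (K x).baseChange ℂ

/-! ### Curvature tensors of a Lorentzian metric, in charts -/

/-- The `i`-th coordinate vector field of the chart `e`, at the point with coordinates `y`. -/
def coordVec (e : OpenPartialHomeomorph M E5) (y : E5) (i : Fin 5) :
    TangentSpace 𝓘(ℝ, E5) (e.symm y) :=
  mfderiv 𝓘(ℝ, E5) 𝓘(ℝ, E5) e.symm y (EuclideanSpace.single i (1 : ℝ) : E5)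

/-- The components of the metric in the chart `e`. -/
def LorentzianMetric.coordMatrix (g : LorentzianMetric M) (e : OpenPartialHomeomorph M E5)
    (y : E5) : Matrix (Fin 5) (Fin 5) ℝ :=
  Matrix.of fun i j => g.inner (e.symm y) (coordVec e y i) (coordVec e y j)

/-- The `i`-th component, in the chart `e`, of a real tangent vector at `x`. -/
def component (e : OpenPartialHomeomorph M E5) (x : M) (i : Fin 5) :
    TangentSpace 𝓘(ℝ, E5) x →ₗ[ℝ] ℝ :=
  ((EuclideanSpace.proj i : E5 →L[ℝ] ℝ).comp
    (mfderiv 𝓘(ℝ, E5) 𝓘(ℝ, E5) e x : TangentSpace 𝓘(ℝ, E5) x →L[ℝ] E5)).toLinearMap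

/-- The `i`-th component, in the chart `e`, of a complex tangent vector at `x`. -/
def componentC (e : OpenPartialHomeomorph M E5) (x : M) (i : Fin 5) (Z : CTangent x) : ℂ :=
  TensorProduct.AlgebraTensorModule.rid ℝ ℂ ℂ ((component e x i).baseChange ℂ Z)

/-- The Weyl tensor at `x`, computed in the chart `e` and extended complex-multilinearly. -/
def LorentzianMetric.weylC (g : LorentzianMetric M) (e : OpenPartialHomeomorph M E5) (x : M)
    (X Y Z W : CTangent x) : ℂ :=
  ∑ a, ∑ b, ∑ c, ∑ d, (weyl (g.coordMatrix e) a b c d (e x) : ℂ) *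
    (componentC e x a X * componentC e x b Y * componentC e x c Z * componentC e x d W)

/-- The Cotton-York tensor at `x`, computed in the chart `e` and extended
complex-multilinearly. -/
def LorentzianMetric.cottonYorkC (g : LorentzianMetric M) (e : OpenPartialHomeomorph M E5) (x : M)
    (X Y Z : CTangent x) : ℂ :=
  ∑ a, ∑ b, ∑ c, (cottonYork (g.coordMatrix e) a b c (e x) : ℂ) *
    (componentC e x a X * componentC e x b Y * componentC e x c Z)

/-! ### Conditions on an almost optical structure -/

namespace AlmostOpticalStructure

variable {g : LorentzianMetric M} (S : AlmostOpticalStructure g)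

/-- `(N, K)` is an optical structure: `N` and its orthogonal complement are integrable. -/
def IsIntegrable : Prop := IsInvolutive S.N ∧ IsInvolutive (g.perp S.N)

/-- The Weyl tensor is algebraically special relative to `N`: `C(X, Y, Z, ·) = 0` for `X, Y` in the
orthogonal complement of `N` and `Z` in `N`. -/
def WeylAlgebraicallySpecial : Prop :=
  ∀ e ∈ atlas E5 M, ∀ x ∈ e.source, ∀ X ∈ g.perp S.N x, ∀ Y ∈ g.perp S.N x, ∀ Z ∈ S.N x,
    ∀ W : CTangent x, g.weylC e x X Y Z W = 0

/-- The Cotton-York tensor satisfies `A(Z, X, Y) = 0` for `X, Y` in the orthogonal complement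
of `N` and `Z` in `N`. -/
def CottonYorkDegenerate : Prop :=
  ∀ e ∈ atlas E5 M, ∀ x ∈ e.source, ∀ X ∈ g.perp S.N x, ∀ Y ∈ g.perp S.N x, ∀ Z ∈ S.N x,
    g.cottonYorkC e x Z X Y = 0

/-- `(k, l, m, conj m, u)` is a null frame at `x` adapted to `(N, K)`: the metric is
`2 k l + 2 m (conj m) + u u`, the vector `k` spans `K`, and `k`, `conj m` span `N`. -/
structure IsAdaptedFrame (x : M) (k l u : TangentSpace 𝓘(ℝ, E5) x) (m : CTangent x) : Prop where
  k_mem : k ∈ S.K x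
  conj_m_mem : conjC m ∈ S.N x
  kk : g.inner x k k = 0
  ll : g.inner x l l = 0
  kl : g.inner x k l = 1
  uu : g.inner x u u = 1
  ku : g.inner x k u = 0
  lu : g.inner x l u = 0
  mm : g.complexForm x m m = 0
  m_conj_m : g.complexForm x m (conjC m) = 1
  km : g.complexForm x m (1 ⊗ₜ k) = 0
  lm : g.complexForm x m (1 ⊗ₜ l) = 0
  um : g.complexForm x m (1 ⊗ₜ u) = 0

/-- The complex Weyl component `Ψ₂ = C(k, conj m, l, m)`. -/
def psi2 (_S : AlmostOpticalStructure g) (e : OpenPartialHomeomorph M E5) (x : M)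
    (k l : TangentSpace 𝓘(ℝ, E5) x) (m : CTangent x) : ℂ :=
  g.weylC e x (1 ⊗ₜ k) (conjC m) (1 ⊗ₜ l) m

/-- The (real-valued) Weyl component `Ψ⁰₂ = C(k, u, l, u)`. -/
def psi02 (_S : AlmostOpticalStructure g) (e : OpenPartialHomeomorph M E5) (x : M)
    (k l u : TangentSpace 𝓘(ℝ, E5) x) : ℂ :=
  g.weylC e x (1 ⊗ₜ k) (1 ⊗ₜ u) (1 ⊗ₜ l) (1 ⊗ₜ u)

/-- Nondegeneracy at `x` of an algebraically special Weyl tensor: the eigenvalue `Ψ₂` of the Weyl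
operator on bivectors differs from its eigenvalues `Ψ⁰₂` and `-Ψ⁰₂`.  For algebraically special
Weyl tensors `Ψ₂` and `Ψ⁰₂` do not depend on the adapted frame, nor on the chart. -/
def WeylNondegenerateAt (x : M) : Prop :=
  ∀ e ∈ atlas E5 M, x ∈ e.source →
    ∀ (k l u : TangentSpace 𝓘(ℝ, E5) x) (m : CTangent x), S.IsAdaptedFrame x k l u m →
      S.psi2 e x k l m ≠ S.psi02 e x k l u ∧ S.psi2 e x k l m ≠ -S.psi02 e x k l u

/-- The Weyl tensor is generically algebraically special relative to `N`: it is algebraically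
special, and nondegenerate at the points of a dense set. -/
def WeylGenericallyAlgebraicallySpecial : Prop :=
  S.WeylAlgebraicallySpecial ∧ Dense {x : M | S.WeylNondegenerateAt x}

end AlmostOpticalStructure

end GoldbergSachs

end

/-! At a point take a null frame k, l, m, m̄, u adapted to N (indices 0 to 4), extended to nearby
vector fields so that those starting in N stay in N and those starting in N⊥ stay in N⊥. Put `w x b
c` = g(∇_x b, c). The obstructions to involutivity of N and N⊥ are finitely many of these numbers,
so the point is to make them vanish.

The equation C(X, Y, Z, ·) = 0 for X, Y in N⊥ and Z in N holds on a neighbourhood, so it can be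
differentiated. This writes ∇C on such arguments as a sum of products of `w` with components of C
itself. Algebraic speciality, its complex conjugate, the trace condition and the cyclic identity
reduce the coefficients that matter to φ = Ψ₂⁰, ψ = Ψ₂ and ψ' = the conjugate of Ψ₂. Inserted into
suitable components of the Bianchi identity of the Weyl tensor and of its contraction, where the
hypothesis on the Cotton-York tensor removes the right-hand side, it yields linear equations for
`w`.

As ψ ≠ φ, the scalars φ and ψ are not both zero, and this kills `w x 0 3` for x in N⊥. The unknowns
`w 0 0 4`, `w 3 0 4`, `w 0 3 4`, `w 3 3 4` are then multiplied by ψ' + φ, ψ + φ, ψ - φ, ψ' - φ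
respectively; all four are nonzero because φ is real. This algebra is `frame_goldberg_sachs`. The
second fundamental form of N vanishes as a result, and that of N⊥ keeps only its (u, u) part, which
an antisymmetric bracket does not see (`contr₂_bracketC_eq_zero`).

The argument works at points where the Weyl tensor is nondegenerate. The pairing of a bracket with a
section of the annihilator is continuous, so it vanishes everywhere once it vanishes on a dense set
(`eq_zero_of_frequently`).

The geometric input is `covFour_weyl_bianchi` and `covFour_weyl_trace`, computed in a chart from
Christoffel symbols, together with `exists_adapted_frame`, which is Lorentzian linear algebra.
Adapted frames are chosen point by point; no smooth family of them is needed. -/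

noncomputable section

namespace GoldbergSachs

open Filter Topology

section

/-! ### Algebra of the Bianchi identity in an adapted null frame

Frame indices `0, 1, 2, 3, 4` stand for `k, l, m, conj m, u`. -/

/-- The algebraic symmetries of a curvature tensor. -/
structure IsCurvatureLike {ι R : Type*} [AddCommGroup R] (C : ι → ι → ι → ι → R) : Prop where
  antisymm_left : ∀ a b c d, C a b c d = -C b a c d
  antisymm_right : ∀ a b c d, C a b c d = -C a b d c
  pair : ∀ a b c d, C a b c d = C c d a b
  cyclic : ∀ a b c d, C a b c d + C b c a d + C c a b d = 0

/-- The index of the frame vector dual to a given one. -/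
def dual (a : Fin 5) : Fin 5 := ![1, 0, 3, 2, 4] a

theorem dual_dual (a : Fin 5) : dual (dual a) = a := by
  fin_cases a <;> rfl

/-- Scalar products of the vectors of a null frame. -/
def frameGram (a b : Fin 5) : ℂ := if dual a = b then 1 else 0

theorem frameGram_comm (a b : Fin 5) : frameGram a b = frameGram b a := by
  fin_cases a <;> fin_cases b <;> rfl

theorem sum_frameGram_dual (c : Fin 5) (f : Fin 5 → ℂ) :
    ∑ a, frameGram c (dual a) * f a = f c := by
  rw [Finset.sum_eq_single c]
  · simp [frameGram]
  · intro a _ h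
    rw [frameGram, if_neg, zero_mul]
    intro h'
    exact h (by rw [← dual_dual a, ← h', dual_dual])
  · simp

theorem sum_frameGram_apply_dual (b : Fin 5) (f : Fin 5 → ℂ) :
    ∑ a, frameGram a b * f (dual a) = f b := by
  rw [Finset.sum_eq_single (dual b)]
  · simp [frameGram, dual_dual]
  · intro a _ h
    rw [frameGram, if_neg, zero_mul]
    intro h'
    exact h (by rw [← h', dual_dual])
  · simp

theorem sum_frameGram_self : ∑ a, frameGram a (dual a) = 5 := by
  simp [frameGram]

/-- Membership of a frame vector in `N`. -/
def inN (a : Fin 5) : Bool := a = 0 || a = 3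

/-- Membership of a frame vector in the orthogonal complement of `N`. -/
def inP (a : Fin 5) : Bool := a = 0 || a = 3 || a = 4

/-- Membership of a frame vector in the conjugate of `N`. -/
def inNbar (a : Fin 5) : Bool := a = 0 || a = 2

/-- Membership of a frame vector in the orthogonal complement of the conjugate of `N`. -/
def inPbar (a : Fin 5) : Bool := a = 0 || a = 2 || a = 4

/-- Components annihilated by algebraic speciality, up to the symmetries of the pairs. -/
def degenerateIndex (a b c : Fin 5) : Bool :=
  (inP a && inP b && inN c) || (inPbar a && inPbar b && inNbar c) ||
    (inN a && inN b && inP c) || (inNbar a && inNbar b && inPbar c)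

/-- All components annihilated by algebraic speciality. -/
def vanishingIndex (a b c d : Fin 5) : Bool :=
  a = b || c = d || degenerateIndex a b c || degenerateIndex a b d ||
    degenerateIndex c d a || degenerateIndex c d b

theorem IsCurvatureLike.self_left {ι : Type*} {C : ι → ι → ι → ι → ℂ} (h : IsCurvatureLike C)
    (a c d : ι) : C a a c d = 0 := by
  have := h.antisymm_left a a c d
  exact self_eq_neg.mp this

theorem IsCurvatureLike.self_right {ι : Type*} {C : ι → ι → ι → ι → ℂ} (h : IsCurvatureLike C)
    (a b c : ι) : C a b c c = 0 := by
  have := h.antisymm_right a b c c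
  exact self_eq_neg.mp this

theorem inP_of_inN {a : Fin 5} (h : inN a) : inP a := by
  revert a; decide

theorem inPbar_of_inNbar {a : Fin 5} (h : inNbar a) : inPbar a := by
  revert a; decide

/-- In the cyclic identity on arguments of type (N, N, N⊥), the two other terms have type (N⊥, N⊥,
N) up to enlarging N to N⊥, so the first one vanishes too. The pair symmetries carry both types to
all positions. -/
theorem IsCurvatureLike.component_eq_zero {C : Fin 5 → Fin 5 → Fin 5 → Fin 5 → ℂ}
    (hC : IsCurvatureLike C)
    (hN : ∀ a b c d, inP a → inP b → inN c → C a b c d = 0)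
    (hNbar : ∀ a b c d, inPbar a → inPbar b → inNbar c → C a b c d = 0)
    (a b c d : Fin 5) (h : vanishingIndex a b c d = true) :
    C a b c d = 0 := by
  have key : ∀ a b c d, degenerateIndex a b c = true → C a b c d = 0 := by
    intro a b c d h
    simp only [degenerateIndex, Bool.or_eq_true, Bool.and_eq_true] at h
    rcases h with ((⟨⟨h1, h2⟩, h3⟩ | ⟨⟨h1, h2⟩, h3⟩) | ⟨⟨h1, h2⟩, h3⟩) | ⟨⟨h1, h2⟩, h3⟩
    · exact hN _ _ _ _ h1 h2 h3
    · exact hNbar _ _ _ _ h1 h2 h3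
    · have := hC.cyclic a b c d
      rwa [hN b c a d (inP_of_inN h2) h3 h1, hN c a b d h3 (inP_of_inN h1) h2, add_zero,
        add_zero] at this
    · have := hC.cyclic a b c d
      rwa [hNbar b c a d (inPbar_of_inNbar h2) h3 h1,
        hNbar c a b d h3 (inPbar_of_inNbar h1) h2, add_zero, add_zero] at this
  simp only [vanishingIndex, Bool.or_eq_true, decide_eq_true_eq] at h
  rcases h with ((((h | h) | h) | h) | h) | h
  · rw [h, hC.self_left]
  · rw [h, hC.self_right]
  · exact key _ _ _ _ h
  · rw [hC.antisymm_right, key _ _ _ _ h, neg_zero]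
  · rw [hC.pair, key _ _ _ _ h]
  · rw [hC.pair, hC.antisymm_right, key _ _ _ _ h, neg_zero]

/-- The contraction of the differential Bianchi identity. -/
theorem frame_divergence_eq_zero {A : Fin 5 → Fin 5 → Fin 5 → ℂ}
    {D : Fin 5 → Fin 5 → Fin 5 → Fin 5 → Fin 5 → ℂ}
    (hD : ∀ x, IsCurvatureLike (D x))
    (htr : ∀ x b d, ∑ a, D x a b (dual a) d = 0)
    (hB : ∀ a b c d e, D a b c d e + D b c a d e + D c a b d e =
      (frameGram b d * A e a c - frameGram b e * A d a c)
      + (frameGram c d * A e b a - frameGram c e * A d b a)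
      + (frameGram a d * A e c b - frameGram a e * A d c b))
    (hA : ∀ a b c, A a b c = -A a c b)
    (b c d : Fin 5) (hb : A b c d = 0) (hbc : frameGram b c = 0) (hbd : frameGram b d = 0) :
    ∑ a, D a c d b (dual a) = 0 := by
  -- Summing the Bianchi identity over the derivative slot and the fourth tensor slot turns two of
  -- the three terms into traces of `D`, which vanish; the divergence remains.
  have h : ∑ a, (D a c d (dual a) b + D c d a (dual a) b + D d a c (dual a) b) = _ :=
    Finset.sum_congr rfl fun a _ => hB a c d (dual a) b
  have h1 : ∑ a, D c d a (dual a) b = 0 := by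
    rw [← neg_eq_zero, ← Finset.sum_neg_distrib, ← htr c d b]
    exact Finset.sum_congr rfl fun a _ => by rw [(hD c).antisymm_left d a, neg_neg]
  have h2 : ∑ a, D d a c (dual a) b = 0 := htr d c b
  have h3 : ∑ a, D a c d b (dual a) = -∑ a, D a c d (dual a) b := by
    rw [← Finset.sum_neg_distrib]
    exact Finset.sum_congr rfl fun a _ => (hD a).antisymm_right c d b (dual a)
  have h4 := hA b d c
  have h5 : ∀ a, A b a a = 0 := fun a => self_eq_neg.mp (hA b a a)
  rw [Finset.sum_add_distrib, Finset.sum_add_distrib, h1, h2, add_zero, add_zero] at h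
  rw [h3, h, neg_eq_zero]
  have hbc' : frameGram c b = 0 := by rw [frameGram_comm, hbc]
  have hbd' : frameGram d b = 0 := by rw [frameGram_comm, hbd]
  simp only [hbc', hbd', zero_mul, sub_zero]
  simp only [Finset.sum_add_distrib, Finset.sum_sub_distrib, sum_frameGram_dual,
    sum_frameGram_apply_dual _ (fun a => A a d c), ← Finset.sum_mul, sum_frameGram_self]
  -- The right-hand side contracts to 2 A b c d + (5 - 1) A b d c = -2 A b c d, the usual factor n -
  -- 3 in dimension n = 5.
  linear_combination (4 : ℂ) * h4 - 2 * hb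

set_option maxHeartbeats 2000000 in
/-- The Bianchi identity for an algebraically special Weyl tensor in an adapted null frame forces
the vanishing of the obstructions to integrability.  Here `D` is the covariant derivative of the
Weyl tensor, and `w x b c` is the scalar product of `∇_x b` with `c`. -/
theorem frame_goldberg_sachs {C : Fin 5 → Fin 5 → Fin 5 → Fin 5 → ℂ} (hC : IsCurvatureLike C)
    (hCtr : ∀ b d, ∑ a, C a b (dual a) d = 0)
    (hN : ∀ a b c d, inP a → inP b → inN c → C a b c d = 0)
    (hNbar : ∀ a b c d, inPbar a → inPbar b → inNbar c → C a b c d = 0)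
    (h1 : C 0 3 1 2 ≠ C 0 4 1 4) (h2 : C 0 3 1 2 ≠ -C 0 4 1 4)
    (h1' : C 0 2 1 3 ≠ C 0 4 1 4) (h2' : C 0 2 1 3 ≠ -C 0 4 1 4)
    {A : Fin 5 → Fin 5 → Fin 5 → ℂ}
    {D : Fin 5 → Fin 5 → Fin 5 → Fin 5 → Fin 5 → ℂ}
    (hD : ∀ x, IsCurvatureLike (D x))
    (htr : ∀ x b d, ∑ a, D x a b (dual a) d = 0)
    (hB : ∀ a b c d e, D a b c d e + D b c a d e + D c a b d e =
      (frameGram b d * A e a c - frameGram b e * A d a c)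
      + (frameGram c d * A e b a - frameGram c e * A d b a)
      + (frameGram a d * A e c b - frameGram a e * A d c b))
    (hA : ∀ a b c, A a b c = -A a c b)
    (hAcyc : ∀ a b c, A a b c + A b c a + A c a b = 0)
    (hAN : ∀ a b c, inN a → inP b → inP c → A a b c = 0)
    {w : Fin 5 → Fin 5 → Fin 5 → ℂ}
    (hw : ∀ x b c, inN b → inP c → w x b c = -w x c b)
    (hDw : ∀ x a b c d, inP a → inP b → inN c → D x a b c d =
      -∑ e, (w x a e * C (dual e) b c d + w x b e * C a (dual e) c d
        + w x c e * C a b (dual e) d)) :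
    (∀ x, inP x → w x 0 3 = 0) ∧ w 0 0 4 = 0 ∧ w 3 0 4 = 0 ∧ w 0 3 4 = 0 ∧ w 3 3 4 = 0 := by
  have zero : ∀ a b c d, vanishingIndex a b c d = true → C a b c d = 0 :=
    hC.component_eq_zero hN hNbar
  -- The `decide` guards turn the symmetries into terminating rewrite rules, so that `simp` brings
  -- every component of C to one order of its indices.
  have swl : ∀ a b c d, decide (b < a) = true → C a b c d = -C b a c d :=
    fun a b c d _ => hC.antisymm_left a b c d
  have swr : ∀ a b c d, decide (d < c) = true → C a b c d = -C a b d c :=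
    fun a b c d _ => hC.antisymm_right a b c d
  have swp : ∀ a b c d, decide (c < a ∨ (c = a ∧ d < b)) = true → C a b c d = C c d a b :=
    fun a b c d _ => hC.pair a b c d
  have w00 : ∀ x, w x 0 0 = 0 := fun x => self_eq_neg.mp (hw x 0 0 rfl rfl)
  have w33 : ∀ x, w x 3 3 = 0 := fun x => self_eq_neg.mp (hw x 3 3 rfl rfl)
  have w30 : ∀ x, w x 3 0 = -w x 0 3 := fun x => hw x 3 0 rfl rfl
  have w40 : ∀ x, w x 4 0 = -w x 0 4 := fun x => by rw [hw x 0 4 rfl rfl, neg_neg]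
  have w43 : ∀ x, w x 4 3 = -w x 3 4 := fun x => by rw [hw x 3 4 rfl rfl, neg_neg]
  have sl : ∀ a c d, C a a c d = 0 := hC.self_left
  have sr : ∀ a b c, C a b c c = 0 := hC.self_right
  have hdiv := frame_divergence_eq_zero hD htr hB hA
  have cyc : ∀ x a b c d, D x a b c d = -(D x b c a d + D x c a b d) := fun x a b c d => by
    linear_combination (hD x).cyclic a b c d
  have t24 := hCtr 4 4
  have t00 := hCtr 0 1
  have t23 := hCtr 2 3
  have c01 := hC.cyclic 0 1 2 3
  have C0 : C 0 1 0 2 = 0 ∧ C 0 1 0 3 = 0 ∧ C 0 1 0 4 = 0 ∧ C 0 1 2 4 = 0 ∧ C 0 1 3 4 = 0 ∧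
      C 0 2 0 2 = 0 ∧ C 0 2 0 3 = 0 ∧ C 0 2 0 4 = 0 ∧ C 0 2 1 2 = 0 ∧ C 0 2 1 4 = 0 ∧
      C 0 2 2 3 = 0 ∧ C 0 2 2 4 = 0 ∧ C 0 2 3 4 = 0 ∧ C 0 3 0 3 = 0 ∧ C 0 3 0 4 = 0 ∧
      C 0 3 1 3 = 0 ∧ C 0 3 1 4 = 0 ∧ C 0 3 2 3 = 0 ∧ C 0 3 2 4 = 0 ∧ C 0 3 3 4 = 0 ∧
      C 0 4 0 4 = 0 ∧ C 0 4 1 2 = 0 ∧ C 0 4 1 3 = 0 ∧ C 0 4 2 3 = 0 ∧ C 0 4 2 4 = 0 ∧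
      C 0 4 3 4 = 0 ∧ C 1 2 2 4 = 0 ∧ C 1 3 3 4 = 0 ∧ C 2 3 2 4 = 0 ∧ C 2 3 3 4 = 0 ∧
      C 2 4 2 4 = 0 ∧ C 3 4 3 4 = 0 :=
    ⟨zero 0 1 0 2 rfl, zero 0 1 0 3 rfl, zero 0 1 0 4 rfl, zero 0 1 2 4 rfl, zero 0 1 3 4 rfl,
     zero 0 2 0 2 rfl, zero 0 2 0 3 rfl, zero 0 2 0 4 rfl, zero 0 2 1 2 rfl, zero 0 2 1 4 rfl,
     zero 0 2 2 3 rfl, zero 0 2 2 4 rfl, zero 0 2 3 4 rfl, zero 0 3 0 3 rfl, zero 0 3 0 4 rfl,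
     zero 0 3 1 3 rfl, zero 0 3 1 4 rfl, zero 0 3 2 3 rfl, zero 0 3 2 4 rfl, zero 0 3 3 4 rfl,
     zero 0 4 0 4 rfl, zero 0 4 1 2 rfl, zero 0 4 1 3 rfl, zero 0 4 2 3 rfl, zero 0 4 2 4 rfl,
     zero 0 4 3 4 rfl, zero 1 2 2 4 rfl, zero 1 3 3 4 rfl, zero 2 3 2 4 rfl, zero 2 3 3 4 rfl,
     zero 2 4 2 4 rfl, zero 3 4 3 4 rfl⟩
  simp [Fin.sum_univ_five, dual, sl, swl, swr, swp] at t24 t00 t23 c01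
  -- These ten identities are chosen so that the symmetries of `D` bring each derivative term to
  -- arguments of type (N⊥, N⊥, N, ·), where `hDw` applies, while every Cotton-York term has type
  -- (N, N⊥, N⊥) or vanishes by the cyclic identity.
  have B1 := hB 0 3 4 0 4
  have D1 := hdiv 0 0 3 (hAN 0 0 3 rfl rfl rfl) rfl rfl
  have B3 := hB 0 3 4 0 2
  have D2 := hdiv 3 0 3 (hAN 3 0 3 rfl rfl rfl) rfl rfl
  have B2 := hB 0 3 4 3 4
  have B4 := hB 0 3 4 1 3
  have D3 := hdiv 4 0 3
    (by linear_combination hAcyc 4 0 3 - hAN 0 3 4 rfl rfl rfl - hAN 3 4 0 rfl rfl rfl) rfl rfl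
  have D4 := hdiv 0 3 4 (hAN 0 3 4 rfl rfl rfl) rfl rfl
  have B5 := hB 2 3 4 0 3
  have B6 := hB 0 1 4 0 3
  rw [(hD 0).antisymm_right _ _ 1 3, (hD 3).antisymm_right _ _ 1 3,
    (hD 4).antisymm_right _ _ 1 3] at B4
  simp only [Fin.sum_univ_five, cyc _ 0 3 4] at D1 D2 D3 D4
  -- The terms of `B5` and `B6` whose first three arguments have the wrong type are reached through
  -- the pair symmetry, followed by the cyclic identity when this leaves (k, m̄, u, ·).
  rw [(hD 3).pair 4 2 0 3, cyc 3 0 3 4 2, (hD 4).pair 2 3 0 3, (hD 4).antisymm_right 0 3 2 3] at B5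
  rw [(hD 0).pair 1 4 0 3, (hD 0).antisymm_right 0 3 1 4, cyc 0 0 3 4 1, (hD 4).pair 0 1 0 3] at B6
  simp [hDw, hAN, inP, inN, frameGram, Fin.sum_univ_five, dual, sl, sr, swl, swr, swp, w00, w33,
    w30, w40, w43, C0] at B1 B2 B3 B4 B5 B6 D1 D2 D3 D4
  clear hD hB hA hAcyc hAN hw hDw zero swl swr swp hdiv cyc htr hN hNbar hC hCtr sl sr w00 w33 w30
    w40 w43 C0
  set φ := C 0 4 1 4
  set ψ := C 0 3 1 2
  set ψ' := C 0 2 1 3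
  -- Trace-freeness and the cyclic identity express the remaining boost-neutral components in the
  -- equations through φ, ψ and ψ'.
  have e2434 : C 2 4 3 4 = -φ := by linear_combination (1 / 2 : ℂ) * t24
  have e0123 : C 0 1 2 3 = ψ' - ψ := by linear_combination c01
  have e0101 : C 0 1 0 1 = ψ' + ψ + φ := by linear_combination -t00
  have e2323 : C 2 3 2 3 = ψ' + ψ - φ := by linear_combination -t23 + e2434
  rw [e2434] at B1 B3 B2 D3 D4 B5
  rw [e0123] at D1 D2 D3 D4 B5 B6
  rw [e0101] at D1 B6
  rw [e2323] at D2 B5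
  -- Since ψ ≠ φ, the two cannot vanish together, so an unknown annihilated by both is zero.
  have hor : ∀ z : ℂ, z * φ = 0 → z * ψ = 0 → z = 0 := by
    intro z hz hz'
    by_contra hne
    have e1 : φ = 0 := (mul_eq_zero.mp hz).resolve_left hne
    have e2 : ψ = 0 := (mul_eq_zero.mp hz').resolve_left hne
    exact h1 (by rw [e1, e2])
  have a1 : w 0 0 3 = 0 := hor _ (by linear_combination (1 / 2 : ℂ) * B1)
    (by linear_combination (1 / 3 : ℂ) * D1 - (1 / 6 : ℂ) * B1)
  have a2 : w 0 0 4 = 0 := by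
    have : w 0 0 4 * (ψ' + φ) = 0 := by linear_combination -B3
    exact (mul_eq_zero.mp this).resolve_right fun h => h2' (eq_neg_of_add_eq_zero_left h)
  -- The order of elimination matters: components of C outside the span of φ, ψ, ψ' do occur in the
  -- later equations, but only with factors `w` that have been shown to vanish by then.
  simp only [a1, zero_mul, neg_zero, add_zero, zero_add] at B2 D2 B4 D3 D4 B5 B6
  simp only [a2, zero_mul, neg_zero, add_zero, zero_add] at B4 D3 D4 B6
  have a3 : w 3 0 3 = 0 := hor _ (by linear_combination -(1 / 2 : ℂ) * B2)
    (by linear_combination (1 / 3 : ℂ) * D2 - (1 / 6 : ℂ) * B2)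
  simp only [a3, zero_mul, add_zero] at B4
  have a4 : w 4 0 3 * ψ = 0 := by linear_combination (1 / 6 : ℂ) * (B6 - B5 + D3)
  have a5 : w 4 0 3 * φ = 0 := by
    by_cases hψ : ψ = 0
    · have hφ : φ ≠ 0 := fun h => h1 (by rw [hψ, h])
      rw [hψ] at D4 B5 B6
      refine (mul_eq_zero.mp ?_).resolve_right hφ
      -- With ψ = 0 the multipliers of `B5` and `B6` eliminate `w 3 0 4` and `w 0 3 4` from `D4`.
      linear_combination (1 / 3 : ℂ) * (φ * D4 - ψ' * B6 + (φ + ψ') * B5)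
    · rw [(mul_eq_zero.mp a4).resolve_right hψ, zero_mul]
  have a6 : w 4 0 3 = 0 := hor _ a5 a4
  simp only [a6, zero_mul, neg_zero, add_zero] at B4 B5 B6
  -- From here on each equation is a single unknown times one of ψ + φ, ψ - φ, ψ' - φ.
  have a7 : w 3 0 4 = 0 := by
    have : w 3 0 4 * (ψ + φ) = 0 := by linear_combination B5
    exact (mul_eq_zero.mp this).resolve_right fun h => h2 (eq_neg_of_add_eq_zero_left h)
  have a8 : w 0 3 4 = 0 := by
    have : w 0 3 4 * (ψ - φ) = 0 := by linear_combination B6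
    exact (mul_eq_zero.mp this).resolve_right fun h => h1 (sub_eq_zero.mp h)
  simp only [a7, a8, zero_mul, neg_zero, add_zero, zero_add] at B4
  have a9 : w 3 3 4 = 0 := by
    have : w 3 3 4 * (ψ' - φ) = 0 := by linear_combination -B4
    exact (mul_eq_zero.mp this).resolve_right fun h => h1' (sub_eq_zero.mp h)
  refine ⟨fun x hx => ?_, a2, a7, a8, a9⟩
  revert hx
  fin_cases x <;> simp [inP, a1, a3, a6]

end

section

/-! ### Calculus of partial derivatives -/

section Calculus

variable {f h : E5 → ℝ} {y : E5}

theorem _root_.ContDiffAt.differentiableAt_top {F : Type*} [NormedAddCommGroup F]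
    [NormedSpace ℝ F] {f : E5 → F} {y : E5} (hf : ContDiffAt ℝ ∞ f y) :
    DifferentiableAt ℝ f y :=
  hf.differentiableAt (by simp)

theorem contDiffAt_pd (i : Fin 5) (hf : ContDiffAt ℝ ∞ f y) : ContDiffAt ℝ ∞ (pd i f) y :=
  (hf.fderiv_right (m := ∞) (by simp)).clm_apply contDiffAt_const

theorem pd_congr (i : Fin 5) (hfh : f =ᶠ[𝓝 y] h) : pd i f y = pd i h y := by
  rw [pd, pd, hfh.fderiv_eq]

theorem pd_const (i : Fin 5) (c : ℝ) : pd i (fun _ => c) y = 0 := by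
  simp [pd]

theorem pd_add (i : Fin 5) (hf : ContDiffAt ℝ ∞ f y) (hh : ContDiffAt ℝ ∞ h y) :
    pd i (fun z => f z + h z) y = pd i f y + pd i h y := by
  simp [pd, fderiv_fun_add hf.differentiableAt_top hh.differentiableAt_top]

theorem pd_neg (i : Fin 5) : pd i (fun z => -f z) y = -pd i f y := by
  simp [pd, fderiv_fun_neg]

theorem pd_sub (i : Fin 5) (hf : ContDiffAt ℝ ∞ f y) (hh : ContDiffAt ℝ ∞ h y) :
    pd i (fun z => f z - h z) y = pd i f y - pd i h y := by
  simp [pd, fderiv_fun_sub hf.differentiableAt_top hh.differentiableAt_top]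

theorem pd_mul (i : Fin 5) (hf : ContDiffAt ℝ ∞ f y) (hh : ContDiffAt ℝ ∞ h y) :
    pd i (fun z => f z * h z) y = pd i f y * h y + f y * pd i h y := by
  simp [pd, fderiv_fun_mul hf.differentiableAt_top hh.differentiableAt_top]
  ring

theorem pd_sum {ι : Type*} (s : Finset ι) (i : Fin 5) {f : ι → E5 → ℝ}
    (hf : ∀ k ∈ s, ContDiffAt ℝ ∞ (f k) y) :
    pd i (fun z => ∑ k ∈ s, f k z) y = ∑ k ∈ s, pd i (f k) y := by
  simp [pd, fderiv_fun_sum fun k hk => (hf k hk).differentiableAt_top]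

theorem pd_comm (i j : Fin 5) (hf : ContDiffAt ℝ ∞ f y) :
    pd i (pd j f) y = pd j (pd i f) y := by
  have h2 : ContDiffAt ℝ ∞ (fderiv ℝ f) y := hf.fderiv_right (m := ∞) (by simp)
  have key : ∀ i j : Fin 5, pd i (pd j f) y =
      fderiv ℝ (fderiv ℝ f) y (EuclideanSpace.single i 1) (EuclideanSpace.single j 1) := by
    intro i j
    rw [pd]
    unfold pd
    rw [fderiv_clm_apply h2.differentiableAt_top (by fun_prop)]
    simp
  rw [key, key]
  exact (hf.isSymmSndFDerivAt (by
    rw [minSmoothness_of_isRCLikeNormedField]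
    exact WithTop.coe_le_coe.mpr (le_top : (2 : ℕ∞) ≤ ⊤))).eq _ _

end Calculus

/-! ### Matrix-valued functions -/

section MatrixCalculus

variable {y : E5}

/-- Smoothness of the entries of a matrix-valued function. -/
def SmoothMatrixAt (A : E5 → Matrix (Fin 5) (Fin 5) ℝ) (y : E5) : Prop :=
  ∀ j k, ContDiffAt ℝ ∞ (fun z => A z j k) y

/-- The entrywise partial derivative. -/
def pdM (i : Fin 5) (A : E5 → Matrix (Fin 5) (Fin 5) ℝ) (y : E5) : Matrix (Fin 5) (Fin 5) ℝ :=
  Matrix.of fun j k => pd i (fun z => A z j k) y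

variable {A B : E5 → Matrix (Fin 5) (Fin 5) ℝ}

theorem SmoothMatrixAt.add (hA : SmoothMatrixAt A y) (hB : SmoothMatrixAt B y) :
    SmoothMatrixAt (fun z => A z + B z) y :=
  fun j k => (hA j k).add (hB j k)

theorem SmoothMatrixAt.sub (hA : SmoothMatrixAt A y) (hB : SmoothMatrixAt B y) :
    SmoothMatrixAt (fun z => A z - B z) y :=
  fun j k => (hA j k).sub (hB j k)

theorem SmoothMatrixAt.transpose (hA : SmoothMatrixAt A y) :
    SmoothMatrixAt (fun z => (A z).transpose) y :=
  fun j k => hA k j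

theorem SmoothMatrixAt.mul (hA : SmoothMatrixAt A y) (hB : SmoothMatrixAt B y) :
    SmoothMatrixAt (fun z => A z * B z) y := by
  intro j k
  simp only [Matrix.mul_apply]
  exact ContDiffAt.sum fun l _ => (hA j l).mul (hB l k)

theorem SmoothMatrixAt.pdM (i : Fin 5) (hA : SmoothMatrixAt A y) :
    SmoothMatrixAt (fun z => pdM i A z) y :=
  fun j k => contDiffAt_pd i (hA j k)

theorem pdM_congr (i : Fin 5) (h : A =ᶠ[𝓝 y] B) : pdM i A y = pdM i B y := by
  ext j k
  exact pd_congr i (h.mono fun z hz => by simp only [hz])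

theorem pdM_add (i : Fin 5) (hA : SmoothMatrixAt A y) (hB : SmoothMatrixAt B y) :
    pdM i (fun z => A z + B z) y = pdM i A y + pdM i B y := by
  ext j k
  exact pd_add i (hA j k) (hB j k)

theorem pdM_sub (i : Fin 5) (hA : SmoothMatrixAt A y) (hB : SmoothMatrixAt B y) :
    pdM i (fun z => A z - B z) y = pdM i A y - pdM i B y := by
  ext j k
  exact pd_sub i (hA j k) (hB j k)

theorem pdM_transpose (i : Fin 5) :
    pdM i (fun z => (A z).transpose) y = (pdM i A y).transpose := rfl

theorem pdM_mul (i : Fin 5) (hA : SmoothMatrixAt A y) (hB : SmoothMatrixAt B y) :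
    pdM i (fun z => A z * B z) y = pdM i A y * B y + A y * pdM i B y := by
  ext j k
  simp only [pdM, Matrix.of_apply, Matrix.add_apply, Matrix.mul_apply]
  rw [pd_sum _ _ fun l _ => (hA j l).mul (hB l k), ← Finset.sum_add_distrib]
  exact Finset.sum_congr rfl fun l _ => pd_mul i (hA j l) (hB l k)

theorem pdM_comm (i j : Fin 5) (hA : SmoothMatrixAt A y) :
    pdM i (pdM j A) y = pdM j (pdM i A) y := by
  ext k l
  exact pd_comm i j (hA k l)

theorem contDiffAt_det (hA : SmoothMatrixAt A y) : ContDiffAt ℝ ∞ (fun z => (A z).det) y := by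
  simp only [Matrix.det_apply']
  exact ContDiffAt.sum fun σ _ => contDiffAt_const.mul (contDiffAt_prod fun k _ => hA _ _)

/-- By Cramer's rule the entries of the inverse are quotients of determinants, hence smooth where
the denominator is nonzero. -/
theorem SmoothMatrixAt.inv (hA : SmoothMatrixAt A y) (hdet : (A y).det ≠ 0) :
    SmoothMatrixAt (fun z => (A z)⁻¹) y := by
  intro j k
  simp only [Matrix.inv_def, Matrix.smul_apply, Ring.inverse_eq_inv, smul_eq_mul,
    Matrix.adjugate_apply]
  refine ((contDiffAt_det hA).inv hdet).mul (contDiffAt_det fun l m => ?_)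
  by_cases hl : l = k
  · subst hl
    simpa using contDiffAt_const
  · simpa [Matrix.updateRow_apply, hl] using hA l m

end MatrixCalculus

end

section

/-! ### The curvature identities in coordinates -/

/-- The components of a smooth nondegenerate metric on an open subset of the model space. -/
structure IsMetricOn (G : E5 → Matrix (Fin 5) (Fin 5) ℝ) (Ω : Set E5) : Prop where
  isOpen : IsOpen Ω
  smooth : ∀ y ∈ Ω, SmoothMatrixAt G y
  symm : ∀ y ∈ Ω, ∀ i j, G y i j = G y j i
  det : ∀ y ∈ Ω, (G y).det ≠ 0

/-- The matrix-valued connection form. -/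
def connMatrix (G : E5 → Matrix (Fin 5) (Fin 5) ℝ) (i : Fin 5) (y : E5) :
    Matrix (Fin 5) (Fin 5) ℝ :=
  Matrix.of fun k j => christoffel G k i j y

/-- The matrix-valued curvature form. -/
def curvMatrix (G : E5 → Matrix (Fin 5) (Fin 5) ℝ) (a b : Fin 5) (y : E5) :
    Matrix (Fin 5) (Fin 5) ℝ :=
  pdM a (connMatrix G b) y - pdM b (connMatrix G a) y
    + (connMatrix G a y * connMatrix G b y - connMatrix G b y * connMatrix G a y)

/-- The covariant derivative `∇_e T_{abcd}`. -/
def covFour (G : E5 → Matrix (Fin 5) (Fin 5) ℝ) (T : Fin 5 → Fin 5 → Fin 5 → Fin 5 → E5 → ℝ)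
    (e a b c d : Fin 5) (y : E5) : ℝ :=
  pd e (T a b c d) y
    - ∑ m, (christoffel G m e a y * T m b c d y + christoffel G m e b y * T a m c d y
      + christoffel G m e c y * T a b m d y + christoffel G m e d y * T a b c m y)

/-- The last two indices of the curvature become column and row of a matrix, so that its identities
follow from noncommutative algebra with Ω = dΓ + Γ ∧ Γ. -/
theorem curvMatrix_apply (G : E5 → Matrix (Fin 5) (Fin 5) ℝ) (a b c d : Fin 5) (y : E5) :
    curvMatrix G a b y d c = riemannUp G a b c d y := by
  simp [curvMatrix, riemannUp, pdM, connMatrix, Matrix.mul_apply, Finset.sum_sub_distrib]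

namespace IsMetricOn

variable {G : E5 → Matrix (Fin 5) (Fin 5) ℝ} {Ω : Set E5} (hG : IsMetricOn G Ω) {y : E5}
  (hy : y ∈ Ω)

theorem mem_nhds (hG : IsMetricOn G Ω) (hy : y ∈ Ω) : Ω ∈ 𝓝 y := hG.isOpen.mem_nhds hy

theorem transpose_eq (hG : IsMetricOn G Ω) (hy : y ∈ Ω) : (G y).transpose = G y := by
  ext i j
  exact hG.symm y hy j i

theorem mul_inv (hG : IsMetricOn G Ω) (hy : y ∈ Ω) : G y * (G y)⁻¹ = 1 :=
  Matrix.mul_nonsing_inv _ (isUnit_iff_ne_zero.mpr (hG.det y hy))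

theorem inv_mul (hG : IsMetricOn G Ω) (hy : y ∈ Ω) : (G y)⁻¹ * G y = 1 :=
  Matrix.nonsing_inv_mul _ (isUnit_iff_ne_zero.mpr (hG.det y hy))

theorem inv_symm (hG : IsMetricOn G Ω) (hy : y ∈ Ω) (i j : Fin 5) :
    (G y)⁻¹ i j = (G y)⁻¹ j i := by
  have : ((G y)⁻¹).transpose = (G y)⁻¹ := by
    rw [Matrix.transpose_nonsing_inv, hG.transpose_eq hy]
  exact congrFun (congrFun this j) i

theorem pd_symm (hG : IsMetricOn G Ω) (hy : y ∈ Ω) (l i j : Fin 5) :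
    pd l (fun z => G z i j) y = pd l (fun z => G z j i) y :=
  pd_congr l (Filter.eventually_of_mem (hG.mem_nhds hy) fun z hz => hG.symm z hz i j)

theorem smooth_conn (hG : IsMetricOn G Ω) (hy : y ∈ Ω) (i : Fin 5) :
    SmoothMatrixAt (connMatrix G i) y := by
  intro k j
  simp only [connMatrix, Matrix.of_apply]
  unfold christoffel
  exact contDiffAt_const.mul (ContDiffAt.sum fun l _ =>
    ((hG.smooth y hy).inv (hG.det y hy) k l).mul
      (((contDiffAt_pd _ (hG.smooth y hy _ _)).add (contDiffAt_pd _ (hG.smooth y hy _ _))).sub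
        (contDiffAt_pd _ (hG.smooth y hy _ _))))

theorem smooth_curv (hG : IsMetricOn G Ω) (hy : y ∈ Ω) (a b : Fin 5) :
    SmoothMatrixAt (curvMatrix G a b) y :=
  ((((hG.smooth_conn hy b).pdM a).sub ((hG.smooth_conn hy a).pdM b))).add
    (((hG.smooth_conn hy a).mul (hG.smooth_conn hy b)).sub
      ((hG.smooth_conn hy b).mul (hG.smooth_conn hy a)))

theorem christoffel_symm (hG : IsMetricOn G Ω) (hy : y ∈ Ω) (k i j : Fin 5) :
    christoffel G k i j y = christoffel G k j i y := by
  unfold christoffel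
  congr 1
  refine Finset.sum_congr rfl fun l _ => ?_
  rw [hG.pd_symm hy l i j]
  ring

theorem metric_mul_conn (hG : IsMetricOn G Ω) (hy : y ∈ Ω) (i l j : Fin 5) :
    (G y * connMatrix G i y) l j = 1 / 2 *
      (pd i (fun z => G z j l) y + pd j (fun z => G z i l) y - pd l (fun z => G z i j) y) := by
  have h : connMatrix G i y = (G y)⁻¹ * Matrix.of fun l j => (1 / 2 : ℝ) *
      (pd i (fun z => G z j l) y + pd j (fun z => G z i l) y - pd l (fun z => G z i j) y) := by
    ext k j
    simp only [connMatrix, christoffel, Matrix.of_apply, Matrix.mul_apply, Finset.mul_sum]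
    exact Finset.sum_congr rfl fun l _ => by ring
  rw [h, ← Matrix.mul_assoc, hG.mul_inv hy, Matrix.one_mul, Matrix.of_apply]

/-- Compatibility of the Levi-Civita connection with the metric. -/
theorem pdM_metric (hG : IsMetricOn G Ω) (hy : y ∈ Ω) (a : Fin 5) :
    pdM a G y = (connMatrix G a y).transpose * G y + G y * connMatrix G a y := by
  have h : (connMatrix G a y).transpose * G y = (G y * connMatrix G a y).transpose := by
    rw [Matrix.transpose_mul, hG.transpose_eq hy]
  ext b c
  rw [h, Matrix.add_apply, Matrix.transpose_apply, hG.metric_mul_conn hy, hG.metric_mul_conn hy,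
    pdM, Matrix.of_apply, hG.pd_symm hy a c b]
  ring

theorem pd_metric (hG : IsMetricOn G Ω) (hy : y ∈ Ω) (e a c : Fin 5) :
    pd e (fun z => G z a c) y =
      ∑ m, (christoffel G m e a y * G y m c + christoffel G m e c y * G y a m) := by
  have h := congrFun (congrFun (hG.pdM_metric hy e) a) c
  simp only [pdM, Matrix.of_apply, Matrix.add_apply, Matrix.mul_apply, Matrix.transpose_apply,
    connMatrix] at h
  rw [h, ← Finset.sum_add_distrib]
  exact Finset.sum_congr rfl fun m _ => by ring

/-- Differentiating G G⁻¹ = 1 and using metric compatibility: the inverse metric is parallel as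
well. -/
theorem pdM_inv (hG : IsMetricOn G Ω) (hy : y ∈ Ω) (a : Fin 5) :
    pdM a (fun z => (G z)⁻¹) y =
      -(connMatrix G a y * (G y)⁻¹ + (G y)⁻¹ * (connMatrix G a y).transpose) := by
  have h0 : pdM a (fun z => G z * (G z)⁻¹) y = 0 := by
    rw [pdM_congr a (B := fun _ => 1)
      (Filter.eventually_of_mem (hG.mem_nhds hy) fun z hz => hG.mul_inv hz)]
    ext i j
    exact pd_const a _
  rw [pdM_mul a (hG.smooth y hy) ((hG.smooth y hy).inv (hG.det y hy)), hG.pdM_metric hy] at h0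
  have h1 : (G y)⁻¹ * (G y * pdM a (fun z => (G z)⁻¹) y) = pdM a (fun z => (G z)⁻¹) y := by
    rw [← Matrix.mul_assoc, hG.inv_mul hy, Matrix.one_mul]
  rw [← h1, eq_neg_of_add_eq_zero_right h0, Matrix.mul_neg, Matrix.add_mul, Matrix.mul_add]
  congr 1
  rw [Matrix.mul_assoc _ (G y), hG.mul_inv hy, Matrix.mul_one, Matrix.mul_assoc (G y),
    ← Matrix.mul_assoc _ (G y), hG.inv_mul hy, Matrix.one_mul, add_comm]

theorem curv_antisymm (a b : Fin 5) : curvMatrix G a b y = -curvMatrix G b a y := by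
  simp only [curvMatrix]
  abel

/-- The lowered curvature is antisymmetric. -/
theorem curv_lowered (hG : IsMetricOn G Ω) (hy : y ∈ Ω) (a b : Fin 5) :
    (curvMatrix G a b y).transpose * G y + G y * curvMatrix G a b y = 0 := by
  -- The metric equation dG = ΓᵀG + GΓ is differentiated once more. Symmetry of the second
  -- derivatives of G then leaves ΩᵀG + GΩ = 0, since all other products are symmetric in a and b.
  have key : ∀ a b, pdM a (pdM b G) y =
      (pdM a (connMatrix G b) y).transpose * G y
      + (connMatrix G b y).transpose *
        ((connMatrix G a y).transpose * G y + G y * connMatrix G a y)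
      + (((connMatrix G a y).transpose * G y + G y * connMatrix G a y) * connMatrix G b y
      + G y * pdM a (connMatrix G b) y) := by
    intro a b
    have hb := hG.smooth_conn hy b
    rw [pdM_congr a (Filter.eventually_of_mem (hG.mem_nhds hy) fun z hz => hG.pdM_metric hz b),
      pdM_add a (hb.transpose.mul (hG.smooth y hy)) ((hG.smooth y hy).mul hb),
      pdM_mul a hb.transpose (hG.smooth y hy), pdM_mul a (hG.smooth y hy) hb, pdM_transpose,
      hG.pdM_metric hy]
  have h := pdM_comm a b (hG.smooth y hy)
  rw [key, key] at h
  rw [curvMatrix, Matrix.transpose_add, Matrix.transpose_sub, Matrix.transpose_sub,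
    Matrix.transpose_mul, Matrix.transpose_mul]
  rw [← sub_eq_zero] at h
  rw [← h]
  noncomm_ring

/-- The second Bianchi identity. -/
theorem curv_bianchi (hG : IsMetricOn G Ω) (hy : y ∈ Ω) (a b c : Fin 5) :
    (pdM a (curvMatrix G b c) y
      + (connMatrix G a y * curvMatrix G b c y - curvMatrix G b c y * connMatrix G a y))
    + (pdM b (curvMatrix G c a) y
      + (connMatrix G b y * curvMatrix G c a y - curvMatrix G c a y * connMatrix G b y))
    + (pdM c (curvMatrix G a b) y
      + (connMatrix G c y * curvMatrix G a b y - curvMatrix G a b y * connMatrix G c y)) = 0 := by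
  have hs := hG.smooth_conn hy
  -- In the cyclic sum the second derivatives of Γ cancel in pairs by symmetry; the terms ∂Γ · Γ and
  -- Γ · Γ · Γ then cancel formally.
  have key : ∀ a b c, pdM a (curvMatrix G b c) y =
      pdM a (pdM b (connMatrix G c)) y - pdM a (pdM c (connMatrix G b)) y
      + ((pdM a (connMatrix G b) y * connMatrix G c y + connMatrix G b y * pdM a (connMatrix G c) y)
      - (pdM a (connMatrix G c) y * connMatrix G b y
        + connMatrix G c y * pdM a (connMatrix G b) y)) := by
    intro a b c
    unfold curvMatrix
    rw [pdM_add a (((hs c).pdM b).sub ((hs b).pdM c)) (((hs b).mul (hs c)).sub ((hs c).mul (hs b))),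
      pdM_sub a ((hs c).pdM b) ((hs b).pdM c), pdM_sub a ((hs b).mul (hs c)) ((hs c).mul (hs b)),
      pdM_mul a (hs b) (hs c), pdM_mul a (hs c) (hs b)]
  rw [key, key, key, pdM_comm a b (hs c), pdM_comm a c (hs b), pdM_comm b c (hs a)]
  simp only [curvMatrix]
  noncomm_ring

end IsMetricOn

end

/-! ### Symmetries of the Riemann and Weyl tensors, and the trace of the Weyl tensor. -/

section

/-- The classical octahedron argument: four cyclic identities, one for each choice of the last
index, combine with the antisymmetries into pair symmetry. -/
theorem IsCurvatureLike.of_antisymm_cyclic {ι : Type*} {C : ι → ι → ι → ι → ℝ}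
    (h1 : ∀ a b c d, C a b c d = -C b a c d) (h2 : ∀ a b c d, C a b c d = -C a b d c)
    (h3 : ∀ a b c d, C a b c d + C b c a d + C c a b d = 0) : IsCurvatureLike C where
  antisymm_left := h1
  antisymm_right := h2
  cyclic := h3
  pair := by
    intro a b c d
    linarith [h3 a b c d, h3 b c d a, h3 c d a b, h3 d a b c, h1 a b c d, h2 a b c d, h1 b c a d,
      h2 b c a d, h1 c a b d, h2 c a b d, h1 b c d a, h2 b c d a, h1 c d b a, h2 c d b a,
      h1 d b c a, h2 d b c a, h1 c d a b, h2 c d a b, h1 d a c b, h2 d a c b, h1 a c d b,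
      h2 a c d b, h1 d a b c, h2 d a b c, h1 a b d c, h2 a b d c, h1 b d a c, h2 b d a c]

namespace IsMetricOn

variable {G : E5 → Matrix (Fin 5) (Fin 5) ℝ} {Ω : Set E5} {y : E5}

theorem riemann_eq (hG : IsMetricOn G Ω) (hy : y ∈ Ω) (a b c d : Fin 5) :
    riemann G a b c d y = (G y * curvMatrix G a b y) d c := by
  rw [riemann, Matrix.mul_apply]
  refine Finset.sum_congr rfl fun e _ => ?_
  rw [curvMatrix_apply, hG.symm y hy d e, mul_comm]

/-- Torsion-freeness: by symmetry of Γ in its lower indices both the derivative terms and the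
quadratic terms cancel in the cyclic sum. -/
theorem riemannUp_cyclic (hG : IsMetricOn G Ω) (hy : y ∈ Ω) (a b c d : Fin 5) :
    riemannUp G a b c d y + riemannUp G b c a d y + riemannUp G c a b d y = 0 := by
  have hs : ∀ a k i j, pd a (christoffel G k i j) y = pd a (christoffel G k j i) y :=
    fun a k i j => pd_congr a
      (Filter.eventually_of_mem (hG.mem_nhds hy) fun z hz => hG.christoffel_symm hz k i j)
  have h : ∑ m, ((christoffel G d a m y * christoffel G m b c y
      - christoffel G d b m y * christoffel G m a c y)
      + (christoffel G d b m y * christoffel G m c a y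
      - christoffel G d c m y * christoffel G m b a y)
      + (christoffel G d c m y * christoffel G m a b y
      - christoffel G d a m y * christoffel G m c b y)) = 0 := by
    refine Finset.sum_eq_zero fun m _ => ?_
    rw [hG.christoffel_symm hy m c a, hG.christoffel_symm hy m c b, hG.christoffel_symm hy m b a]
    ring
  rw [Finset.sum_add_distrib, Finset.sum_add_distrib] at h
  unfold riemannUp
  rw [hs a d c b, hs b d c a, hs c d b a]
  linarith

theorem riemann_curvatureLike (hG : IsMetricOn G Ω) (hy : y ∈ Ω) :
    IsCurvatureLike fun a b c d => riemann G a b c d y := by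
  refine IsCurvatureLike.of_antisymm_cyclic ?_ ?_ ?_
  · intro a b c d
    rw [hG.riemann_eq hy, hG.riemann_eq hy, curv_antisymm, Matrix.mul_neg, Matrix.neg_apply]
  · intro a b c d
    have h := congrFun (congrFun (hG.curv_lowered hy a b) c) d
    have h' : (curvMatrix G a b y).transpose * G y = (G y * curvMatrix G a b y).transpose := by
      rw [Matrix.transpose_mul, hG.transpose_eq hy]
    rw [h', Matrix.add_apply, Matrix.transpose_apply] at h
    rw [hG.riemann_eq hy, hG.riemann_eq hy]
    exact eq_neg_of_add_eq_zero_left h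
  · intro a b c d
    simp only [riemann]
    rw [← Finset.sum_add_distrib, ← Finset.sum_add_distrib]
    refine Finset.sum_eq_zero fun e _ => ?_
    rw [← add_mul, ← add_mul, hG.riemannUp_cyclic hy, zero_mul]

theorem sum_inv_metric (hG : IsMetricOn G Ω) (hy : y ∈ Ω) (f : Fin 5 → ℝ) (b : Fin 5) :
    ∑ a, ∑ c, (G y)⁻¹ a c * (G y b c * f a) = f b := by
  have h : ∀ a, ∑ c, (G y)⁻¹ a c * (G y b c * f a) = (1 : Matrix (Fin 5) (Fin 5) ℝ) a b * f a := by
    intro a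
    rw [← hG.inv_mul hy, Matrix.mul_apply, Finset.sum_mul]
    refine Finset.sum_congr rfl fun c _ => ?_
    rw [hG.symm y hy b c]
    ring
  simp [h, Matrix.one_apply]

theorem ricci_eq (hG : IsMetricOn G Ω) (hy : y ∈ Ω) (b c : Fin 5) :
    ricci G b c y = ∑ a, ∑ d, (G y)⁻¹ a d * riemann G a b c d y := by
  unfold ricci
  refine Finset.sum_congr rfl fun a _ => ?_
  simp only [riemann, Finset.mul_sum]
  rw [Finset.sum_comm]
  have h : ∀ e, ∑ d, (G y)⁻¹ a d * (riemannUp G a b c e y * G y e d)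
      = (1 : Matrix (Fin 5) (Fin 5) ℝ) a e * riemannUp G a b c e y := by
    intro e
    rw [← hG.inv_mul hy, Matrix.mul_apply, Finset.sum_mul]
    refine Finset.sum_congr rfl fun c _ => ?_
    rw [hG.symm y hy e c]
    ring
  simp [h, Matrix.one_apply]

theorem ricci_symm (hG : IsMetricOn G Ω) (hy : y ∈ Ω) (b c : Fin 5) :
    ricci G b c y = ricci G c b y := by
  have hR := hG.riemann_curvatureLike hy
  rw [hG.ricci_eq hy, hG.ricci_eq hy, Finset.sum_comm]
  refine Finset.sum_congr rfl fun d _ => Finset.sum_congr rfl fun a _ => ?_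
  rw [hG.inv_symm hy, hR.pair a b c d, hR.antisymm_left, hR.antisymm_right, neg_neg]

theorem rho_symm (hG : IsMetricOn G Ω) (hy : y ∈ Ω) (b c : Fin 5) :
    rho G b c y = rho G c b y := by
  rw [rho, rho, hG.ricci_symm hy, hG.symm y hy]

theorem weyl_curvatureLike (hG : IsMetricOn G Ω) (hy : y ∈ Ω) :
    IsCurvatureLike fun a b c d => weyl G a b c d y := by
  have hR := hG.riemann_curvatureLike hy
  have hg := hG.symm y hy
  have hr := hG.rho_symm hy
  refine IsCurvatureLike.of_antisymm_cyclic ?_ ?_ ?_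
  · intro a b c d
    have := hR.antisymm_left a b c d
    simp only [weyl]
    linarith
  · intro a b c d
    have := hR.antisymm_right a b c d
    simp only [weyl]
    linarith
  · intro a b c d
    have := hR.cyclic a b c d
    simp only [weyl]
    rw [hg c a, hg c b, hg b a, hr c a, hr c b, hr b a]
    linarith

/-- The trace equals -Ric + (5 - 1 - 1) P + (tr P) g, because Ric contracts the first and fourth
slots whereas here the first and third are contracted. With tr P = S / 8, for the scalar curvature
S, this is zero by the definition of P. -/
theorem weyl_trace (hG : IsMetricOn G Ω) (hy : y ∈ Ω) (b d : Fin 5) :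
    ∑ a, ∑ c, (G y)⁻¹ a c * weyl G a b c d y = 0 := by
  have hR := hG.riemann_curvatureLike hy
  have h1 : ∑ a, ∑ c, (G y)⁻¹ a c * riemann G a b c d y = -ricci G b d y := by
    rw [hG.ricci_eq hy, ← Finset.sum_neg_distrib]
    refine Finset.sum_congr rfl fun a _ => ?_
    rw [← Finset.sum_neg_distrib]
    refine Finset.sum_congr rfl fun c _ => ?_
    rw [hR.antisymm_right a b c d, mul_neg]
  have hgg : ∑ a, ∑ c, (G y)⁻¹ a c * G y a c = 5 := by
    have : ∀ a, ∑ c, (G y)⁻¹ a c * G y a c = 1 := by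
      intro a
      have h := congrFun (congrFun (hG.inv_mul hy) a) a
      rw [Matrix.mul_apply, Matrix.one_apply_eq] at h
      rw [← h]
      exact Finset.sum_congr rfl fun c _ => by rw [hG.symm y hy]
    simp [this]
  have h2 : ∑ a, ∑ c, (G y)⁻¹ a c * (G y a c * rho G b d y) = 5 * rho G b d y := by
    rw [← hgg, Finset.sum_mul]
    refine Finset.sum_congr rfl fun a _ => ?_
    rw [Finset.sum_mul]
    exact Finset.sum_congr rfl fun c _ => by ring
  have h3 : ∑ a, ∑ c, (G y)⁻¹ a c * (G y b c * rho G a d y) = rho G b d y :=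
    hG.sum_inv_metric hy (fun a => rho G a d y) b
  have h4 : ∑ a, ∑ c, (G y)⁻¹ a c * (G y a d * rho G b c y) = rho G b d y := by
    rw [Finset.sum_comm]
    rw [← hG.sum_inv_metric hy (fun c => rho G b c y) d]
    refine Finset.sum_congr rfl fun a _ => Finset.sum_congr rfl fun c _ => ?_
    rw [hG.inv_symm hy, hG.symm y hy c d]
  -- The constant is 1 / 3 - 5 / 24 = 1 / 8.
  have h5 : ∑ a, ∑ c, (G y)⁻¹ a c * rho G a c y = 1 / 8 * scalarCurv G y := by
    have : ∑ a, ∑ c, (G y)⁻¹ a c * rho G a c y = 1 / 3 * scalarCurv G y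
        - 1 / 24 * scalarCurv G y * ∑ a, ∑ c, (G y)⁻¹ a c * G y a c := by
      conv_rhs => rw [Finset.mul_sum]; arg 1; rw [scalarCurv, Finset.mul_sum]
      rw [← Finset.sum_sub_distrib]
      refine Finset.sum_congr rfl fun a _ => ?_
      rw [Finset.mul_sum, Finset.mul_sum, ← Finset.sum_sub_distrib]
      exact Finset.sum_congr rfl fun c _ => by rw [rho]; ring
    rw [this, hgg]
    ring
  have h6 : ∑ a, ∑ c, (G y)⁻¹ a c * (G y b d * rho G a c y) =
      G y b d * (1 / 8 * scalarCurv G y) := by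
    rw [← h5, Finset.mul_sum]
    refine Finset.sum_congr rfl fun a _ => ?_
    rw [Finset.mul_sum]
    exact Finset.sum_congr rfl fun c _ => by ring
  have h : ∑ a, ∑ c, (G y)⁻¹ a c * weyl G a b c d y =
      -ricci G b d y + 5 * rho G b d y - rho G b d y - rho G b d y
        + G y b d * (1 / 8 * scalarCurv G y) := by
    rw [← h1, ← h6]
    have e : -(∑ a, ∑ c, (G y)⁻¹ a c * (G y b c * rho G a d y)) = -rho G b d y := by rw [h3]
    have e' : -(∑ a, ∑ c, (G y)⁻¹ a c * (G y a d * rho G b c y)) = -rho G b d y := by rw [h4]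
    rw [sub_eq_add_neg, sub_eq_add_neg]
    nth_rw 1 [← e]
    rw [← e', ← h2]
    simp only [← Finset.sum_add_distrib, ← Finset.sum_neg_distrib]
    exact Finset.sum_congr rfl fun a _ => Finset.sum_congr rfl fun c _ => by rw [weyl]; ring
  rw [h, rho]
  ring

/-! #### Smoothness -/

theorem smooth_riemannUp (hG : IsMetricOn G Ω) (hy : y ∈ Ω) (a b c d : Fin 5) :
    ContDiffAt ℝ ∞ (riemannUp G a b c d) y := by
  have h : riemannUp G a b c d = fun z => curvMatrix G a b z d c := by
    ext z
    rw [curvMatrix_apply]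
  rw [h]
  exact hG.smooth_curv hy a b d c

theorem smooth_riemann (hG : IsMetricOn G Ω) (hy : y ∈ Ω) (a b c d : Fin 5) :
    ContDiffAt ℝ ∞ (riemann G a b c d) y := by
  unfold riemann
  exact ContDiffAt.sum fun e _ => (hG.smooth_riemannUp hy a b c e).mul (hG.smooth y hy e d)

theorem smooth_ricci (hG : IsMetricOn G Ω) (hy : y ∈ Ω) (b c : Fin 5) :
    ContDiffAt ℝ ∞ (ricci G b c) y := by
  unfold ricci
  exact ContDiffAt.sum fun a _ => hG.smooth_riemannUp hy a b c a

theorem smooth_rho (hG : IsMetricOn G Ω) (hy : y ∈ Ω) (a b : Fin 5) :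
    ContDiffAt ℝ ∞ (rho G a b) y := by
  have hs : ContDiffAt ℝ ∞ (scalarCurv G) y := by
    unfold scalarCurv
    exact ContDiffAt.sum fun a _ => ContDiffAt.sum fun b _ =>
      ((hG.smooth y hy).inv (hG.det y hy) a b).mul (hG.smooth_ricci hy a b)
  unfold rho
  exact contDiffAt_const.mul ((hG.smooth_ricci hy a b).sub
    ((contDiffAt_const.mul hs).mul (hG.smooth y hy a b)))

theorem smooth_weyl (hG : IsMetricOn G Ω) (hy : y ∈ Ω) (a b c d : Fin 5) :
    ContDiffAt ℝ ∞ (weyl G a b c d) y := by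
  have hp : ∀ i j k l, ContDiffAt ℝ ∞ (fun z => G z i j * rho G k l z) y :=
    fun i j k l => (hG.smooth y hy i j).mul (hG.smooth_rho hy k l)
  unfold weyl
  exact (hG.smooth_riemann hy a b c d).add
    ((((hp a c b d).sub (hp b c a d)).sub (hp a d b c)).add (hp b d a c))

end IsMetricOn

end

/-! ### Covariant derivatives: the differential Bianchi identity and the trace of ∇C. -/

section

theorem sum_swap_outer {ι R : Type*} [Fintype ι] [AddCommMonoid R] (F : ι → ι → ι → R) :
    ∑ a, ∑ c, ∑ m, F a c m = ∑ a, ∑ c, ∑ m, F m c a := by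
  rw [Finset.sum_comm]
  conv_rhs => rw [Finset.sum_comm]
  exact Finset.sum_congr rfl fun c _ => Finset.sum_comm

theorem sum_rotate {ι R : Type*} [Fintype ι] [AddCommMonoid R] (F : ι → ι → ι → R) :
    ∑ a, ∑ c, ∑ m, F m a c = ∑ m, ∑ a, ∑ c, F m a c := by
  rw [Finset.sum_comm (s := Finset.univ (α := ι)) (t := Finset.univ (α := ι))
    (f := fun m a => ∑ c, F m a c)]
  exact Finset.sum_congr rfl fun a _ => Finset.sum_comm

namespace IsMetricOn

variable {G : E5 → Matrix (Fin 5) (Fin 5) ℝ} {Ω : Set E5} {y : E5}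

theorem covFour_curvatureLike (hG : IsMetricOn G Ω) (hy : y ∈ Ω)
    {T : Fin 5 → Fin 5 → Fin 5 → Fin 5 → E5 → ℝ}
    (hT : ∀ z ∈ Ω, IsCurvatureLike fun a b c d => T a b c d z)
    (hs : ∀ a b c d, ContDiffAt ℝ ∞ (T a b c d) y) (e : Fin 5) :
    IsCurvatureLike fun a b c d => covFour G T e a b c d y := by
  have hy' := hT y hy
  have hn := hG.mem_nhds hy
  refine IsCurvatureLike.of_antisymm_cyclic ?_ ?_ ?_
  · intro a b c d
    have h : pd e (T a b c d) y = -pd e (T b a c d) y := by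
      rw [← pd_neg]
      exact pd_congr e (Filter.eventually_of_mem hn fun z hz => (hT z hz).antisymm_left a b c d)
    simp only [covFour]
    rw [h, neg_sub, ← neg_add', neg_eq_iff_eq_neg, neg_sub, sub_eq_add_neg, add_right_inj,
      ← Finset.sum_neg_distrib]
    refine Finset.sum_congr rfl fun m _ => ?_
    rw [hy'.antisymm_left m b, hy'.antisymm_left a m, hy'.antisymm_left a b m,
      hy'.antisymm_left a b c]
    ring
  · intro a b c d
    have h : pd e (T a b c d) y = -pd e (T a b d c) y := by
      rw [← pd_neg]
      exact pd_congr e (Filter.eventually_of_mem hn fun z hz => (hT z hz).antisymm_right a b c d)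
    simp only [covFour]
    rw [h, neg_sub, ← neg_add', neg_eq_iff_eq_neg, neg_sub, sub_eq_add_neg, add_right_inj,
      ← Finset.sum_neg_distrib]
    refine Finset.sum_congr rfl fun m _ => ?_
    rw [hy'.antisymm_right m b, hy'.antisymm_right a m, hy'.antisymm_right a b m,
      hy'.antisymm_right a b c]
    ring
  · intro a b c d
    have h : pd e (T a b c d) y + pd e (T b c a d) y + pd e (T c a b d) y = 0 := by
      rw [← pd_add e (hs _ _ _ _) (hs _ _ _ _),
        ← pd_add e ((hs _ _ _ _).add (hs _ _ _ _)) (hs _ _ _ _), ← pd_const e 0]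
      exact pd_congr e (Filter.eventually_of_mem hn fun z hz => (hT z hz).cyclic a b c d)
    simp only [covFour]
    have h' : ∀ p q r s t u : ℝ, p + q + r = 0 → s + t + u = 0 → p - s + (q - t) + (r - u) = 0 := by
      intros; linarith
    refine h' _ _ _ _ _ _ h ?_
    rw [← Finset.sum_add_distrib, ← Finset.sum_add_distrib]
    refine Finset.sum_eq_zero fun m _ => ?_
    linear_combination christoffel G m e a y * hy'.cyclic m b c d
      + christoffel G m e b y * hy'.cyclic a m c d + christoffel G m e c y * hy'.cyclic a b m d
      + christoffel G m e d y * hy'.cyclic a b c m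

theorem covFour_riemann_bianchi (hG : IsMetricOn G Ω) (hy : y ∈ Ω) (a b c d e : Fin 5) :
    covFour G (riemann G) a b c d e y + covFour G (riemann G) b c a d e y
      + covFour G (riemann G) c a b d e y = 0 := by
  have hR := hG.riemann_curvatureLike hy
  -- The Christoffel terms in the last two slots combine with ∂(GΩ) into the matrix covariant
  -- derivative of Ω, treated by `curv_bianchi`. Those in the two form slots are left over and
  -- cancel cyclically by the symmetry of Γ.
  have key : ∀ a b c, covFour G (riemann G) a b c d e y =
      (G y * (pdM a (curvMatrix G b c) y
        + (connMatrix G a y * curvMatrix G b c y - curvMatrix G b c y * connMatrix G a y))) e d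
      - ∑ m, (christoffel G m a b y * riemann G m c d e y
        + christoffel G m a c y * riemann G b m d e y) := by
    intro a b c
    have h1 : pd a (riemann G b c d e) y = pdM a (fun z => G z * curvMatrix G b c z) y e d :=
      pd_congr a (Filter.eventually_of_mem (hG.mem_nhds hy) fun z hz => hG.riemann_eq hz b c d e)
    have h2 : ∑ m, christoffel G m a d y * riemann G b c m e y
        = (G y * curvMatrix G b c y * connMatrix G a y) e d := by
      rw [Matrix.mul_apply]
      refine Finset.sum_congr rfl fun m _ => ?_
      rw [hG.riemann_eq hy, mul_comm]
      rfl
    have h3 : ∑ m, christoffel G m a e y * riemann G b c d m y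
        = ((connMatrix G a y).transpose * (G y * curvMatrix G b c y)) e d := by
      rw [Matrix.mul_apply]
      refine Finset.sum_congr rfl fun m _ => ?_
      rw [hG.riemann_eq hy]
      rfl
    have h4 : G y * (pdM a (curvMatrix G b c) y
        + (connMatrix G a y * curvMatrix G b c y - curvMatrix G b c y * connMatrix G a y))
        = ((connMatrix G a y).transpose * G y + G y * connMatrix G a y) * curvMatrix G b c y
          + G y * pdM a (curvMatrix G b c) y - G y * curvMatrix G b c y * connMatrix G a y
          - (connMatrix G a y).transpose * (G y * curvMatrix G b c y) := by
      noncomm_ring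
    rw [h4, Matrix.sub_apply, Matrix.sub_apply, ← h2, ← h3, covFour, h1,
      pdM_mul a (hG.smooth y hy) (hG.smooth_curv hy b c), hG.pdM_metric hy]
    simp only [Finset.sum_add_distrib]
    ring
  have hmul : ∀ X Y Z : Matrix (Fin 5) (Fin 5) ℝ, X + Y + Z = 0 →
      (G y * X) e d + (G y * Y) e d + (G y * Z) e d = 0 := by
    intro X Y Z h
    rw [← Matrix.add_apply, ← Matrix.add_apply, ← Matrix.mul_add, ← Matrix.mul_add, h,
      Matrix.mul_zero, Matrix.zero_apply]
  have hB := hmul _ _ _ (hG.curv_bianchi hy a b c)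
  rw [key, key, key]
  have hsum : ∑ m, (christoffel G m a b y * riemann G m c d e y
        + christoffel G m a c y * riemann G b m d e y)
      + ∑ m, (christoffel G m b c y * riemann G m a d e y
        + christoffel G m b a y * riemann G c m d e y)
      + ∑ m, (christoffel G m c a y * riemann G m b d e y
        + christoffel G m c b y * riemann G a m d e y) = 0 := by
    rw [← Finset.sum_add_distrib, ← Finset.sum_add_distrib]
    refine Finset.sum_eq_zero fun m _ => ?_
    have e1 := hR.antisymm_left m c d e
    have e2 := hR.antisymm_left m a d e
    have e3 := hR.antisymm_left m b d e
    rw [hG.christoffel_symm hy m b a, hG.christoffel_symm hy m c a, hG.christoffel_symm hy m c b,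
      e1, e2, e3]
    ring
  linarith

/-- The product rule with ∇g = 0, the Christoffel terms being listed slot by slot as in `covFour` so
that they can be matched there. -/
theorem pd_metric_mul_rho (hG : IsMetricOn G Ω) (hy : y ∈ Ω) (e a b c d : Fin 5) :
    pd e (fun z => G z a c * rho G b d z) y = G y a c * covRho G e b d y
      + ∑ m, (christoffel G m e a y * (G y m c * rho G b d y)
        + christoffel G m e c y * (G y a m * rho G b d y)
        + christoffel G m e b y * (G y a c * rho G m d y)
        + christoffel G m e d y * (G y a c * rho G b m y)) := by
  rw [pd_mul e (hG.smooth y hy a c) (hG.smooth_rho hy b d), hG.pd_metric hy, covRho]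
  have h : G y a c * (pd e (rho G b d) y
      - ∑ m, (christoffel G m e b y * rho G m d y + christoffel G m e d y * rho G b m y))
      = G y a c * pd e (rho G b d) y - ∑ m, G y a c *
        (christoffel G m e b y * rho G m d y + christoffel G m e d y * rho G b m y) := by
    rw [mul_sub, Finset.mul_sum]
  rw [h, Finset.sum_mul, sub_add, add_comm, sub_eq_add_neg, add_right_inj,
    ← Finset.sum_sub_distrib, ← Finset.sum_neg_distrib]
  exact Finset.sum_congr rfl fun m _ => by ring

/-- The metric is parallel, so in the correction terms of the Weyl tensor the derivative falls on
the Rho tensor alone. -/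
theorem covFour_weyl (hG : IsMetricOn G Ω) (hy : y ∈ Ω) (e a b c d : Fin 5) :
    covFour G (weyl G) e a b c d y = covFour G (riemann G) e a b c d y
      + (G y a c * covRho G e b d y - G y b c * covRho G e a d y
        - G y a d * covRho G e b c y + G y b d * covRho G e a c y) := by
  have hp : ∀ i j k l, ContDiffAt ℝ ∞ (fun z => G z i j * rho G k l z) y :=
    fun i j k l => (hG.smooth y hy i j).mul (hG.smooth_rho hy k l)
  have h : pd e (weyl G a b c d) y = pd e (riemann G a b c d) y
      + (pd e (fun z => G z a c * rho G b d z) y - pd e (fun z => G z b c * rho G a d z) y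
        - pd e (fun z => G z a d * rho G b c z) y + pd e (fun z => G z b d * rho G a c z) y) := by
    unfold weyl
    rw [pd_add e (hG.smooth_riemann hy a b c d)
        ((((hp a c b d).sub (hp b c a d)).sub (hp a d b c)).add (hp b d a c)),
      pd_add e (((hp a c b d).sub (hp b c a d)).sub (hp a d b c)) (hp b d a c),
      pd_sub e ((hp a c b d).sub (hp b c a d)) (hp a d b c),
      pd_sub e (hp a c b d) (hp b c a d)]
  rw [covFour, covFour, h, hG.pd_metric_mul_rho hy, hG.pd_metric_mul_rho hy,
    hG.pd_metric_mul_rho hy, hG.pd_metric_mul_rho hy]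
  have h' : ∀ r s w p q t u p' q' t' u' : ℝ, w = s + (p' - q' - t' + u') →
      r + (p + p' - (q + q') - (t + t') + (u + u')) - w = r - s + (p - q - t + u) := by
    intros; linarith
  refine h' _ _ _ _ _ _ _ _ _ _ _ ?_
  simp only [← Finset.sum_add_distrib, ← Finset.sum_sub_distrib]
  refine Finset.sum_congr rfl fun m _ => ?_
  simp only [weyl]
  ring

theorem covRho_symm (hG : IsMetricOn G Ω) (hy : y ∈ Ω) (c a b : Fin 5) :
    covRho G c a b y = covRho G c b a y := by
  rw [covRho, covRho, pd_congr c
    (Filter.eventually_of_mem (hG.mem_nhds hy) fun z hz => hG.rho_symm hz a b)]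
  congr 1
  refine Finset.sum_congr rfl fun m _ => ?_
  rw [hG.rho_symm hy m b, hG.rho_symm hy a m]
  ring

/-- The six terms cancel in pairs because ∇P is symmetric in its last two indices. -/
theorem cottonYork_cyclic (hG : IsMetricOn G Ω) (hy : y ∈ Ω) (a b c : Fin 5) :
    cottonYork G a b c y + cottonYork G b c a y + cottonYork G c a b y = 0 := by
  rw [cottonYork, cottonYork, cottonYork, hG.covRho_symm hy b c a, hG.covRho_symm hy c b a,
    hG.covRho_symm hy a b c]
  ring

/-- The Bianchi identity for the Weyl tensor. -/
theorem covFour_weyl_bianchi (hG : IsMetricOn G Ω) (hy : y ∈ Ω) (a b c d e : Fin 5) :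
    covFour G (weyl G) a b c d e y + covFour G (weyl G) b c a d e y
      + covFour G (weyl G) c a b d e y =
      (G y b d * cottonYork G e a c y - G y b e * cottonYork G d a c y)
      + (G y c d * cottonYork G e b a y - G y c e * cottonYork G d b a y)
      + (G y a d * cottonYork G e c b y - G y a e * cottonYork G d c b y) := by
  have h := hG.covFour_riemann_bianchi hy a b c d e
  rw [hG.covFour_weyl hy, hG.covFour_weyl hy, hG.covFour_weyl hy]
  simp only [cottonYork]
  linear_combination h

/-- Contraction commutes with ∇ because the inverse metric is parallel: the vanishing trace of the
Weyl tensor is differentiated, and the Christoffel terms of G⁻¹ match those of the contracted slots.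
The terms of the free slots are again traces. -/
theorem covFour_weyl_trace (hG : IsMetricOn G Ω) (hy : y ∈ Ω) (e b d : Fin 5) :
    ∑ a, ∑ c, (G y)⁻¹ a c * covFour G (weyl G) e a b c d y = 0 := by
  have hinv := (hG.smooth y hy).inv (hG.det y hy)
  have hp : ∀ a c, ContDiffAt ℝ ∞ (fun z => (G z)⁻¹ a c * weyl G a b c d z) y :=
    fun a c => (hinv a c).mul (hG.smooth_weyl hy a b c d)
  have h0 : pd e (fun z => ∑ a, ∑ c, (G z)⁻¹ a c * weyl G a b c d z) y = 0 := by
    rw [← pd_const e 0]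
    exact pd_congr e (Filter.eventually_of_mem (hG.mem_nhds hy) fun z hz => hG.weyl_trace hz b d)
  have hpd : ∀ a c, pd e (fun z => (G z)⁻¹ a c) y =
      -∑ m, (christoffel G a e m y * (G y)⁻¹ m c + christoffel G c e m y * (G y)⁻¹ a m) := by
    intro a c
    have h := congrFun (congrFun (hG.pdM_inv hy e) a) c
    simp only [pdM, Matrix.of_apply, Matrix.neg_apply, Matrix.add_apply, Matrix.mul_apply,
      Matrix.transpose_apply, connMatrix] at h
    rw [h, ← Finset.sum_add_distrib]
    congr 1
    exact Finset.sum_congr rfl fun m _ => by ring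
  rw [pd_sum _ _ fun a _ => ContDiffAt.sum fun c _ => hp a c] at h0
  have h1 : ∀ a, pd e (fun z => ∑ c, (G z)⁻¹ a c * weyl G a b c d z) y =
      ∑ c, ((G y)⁻¹ a c * pd e (weyl G a b c d) y
        - ∑ m, (christoffel G a e m y * ((G y)⁻¹ m c * weyl G a b c d y)
          + christoffel G c e m y * ((G y)⁻¹ a m * weyl G a b c d y))) := by
    intro a
    rw [pd_sum _ _ fun c _ => hp a c]
    refine Finset.sum_congr rfl fun c _ => ?_
    rw [pd_mul e (hinv a c) (hG.smooth_weyl hy a b c d), hpd, neg_mul, Finset.sum_mul, add_comm,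
      ← sub_eq_add_neg]
    congr 1
    exact Finset.sum_congr rfl fun m _ => by ring
  simp only [h1] at h0
  have hbt : ∀ m, ∑ a, ∑ c, (G y)⁻¹ a c * weyl G a m c d y = 0 := fun m => hG.weyl_trace hy m d
  have hdt : ∀ m, ∑ a, ∑ c, (G y)⁻¹ a c * weyl G a b c m y = 0 := fun m => hG.weyl_trace hy b m
  have hb0 : ∑ m, christoffel G m e b y * ∑ a, ∑ c, (G y)⁻¹ a c * weyl G a m c d y = 0 := by
    simp [hbt]
  have hd0 : ∑ m, christoffel G m e d y * ∑ a, ∑ c, (G y)⁻¹ a c * weyl G a b c m y = 0 := by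
    simp [hdt]
  simp only [Finset.sum_sub_distrib, Finset.sum_add_distrib, covFour, mul_sub, mul_add,
    Finset.mul_sum] at h0 hb0 hd0 ⊢
  have s1 : ∑ a, ∑ c, ∑ m, (G y)⁻¹ a c * (christoffel G m e a y * weyl G m b c d y)
      = ∑ a, ∑ c, ∑ m, christoffel G a e m y * ((G y)⁻¹ m c * weyl G a b c d y) := by
    have hsw := sum_swap_outer fun a c m =>
      (G y)⁻¹ a c * (christoffel G m e a y * weyl G m b c d y)
    rw [hsw]
    exact Finset.sum_congr rfl fun a _ => Finset.sum_congr rfl fun c _ =>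
      Finset.sum_congr rfl fun m _ => by ring
  have s2 : ∑ a, ∑ c, ∑ m, (G y)⁻¹ a c * (christoffel G m e c y * weyl G a b m d y)
      = ∑ a, ∑ c, ∑ m, christoffel G c e m y * ((G y)⁻¹ a m * weyl G a b c d y) := by
    refine Finset.sum_congr rfl fun a _ => ?_
    rw [Finset.sum_comm]
    exact Finset.sum_congr rfl fun c _ => Finset.sum_congr rfl fun m _ => by ring
  have s3 : ∑ a, ∑ c, ∑ m, (G y)⁻¹ a c * (christoffel G m e b y * weyl G a m c d y) = 0 := by
    refine Eq.trans ?_ ((sum_rotate fun m a c => christoffel G m e b y *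
      ((G y)⁻¹ a c * weyl G a m c d y)).trans hb0)
    exact Finset.sum_congr rfl fun a _ => Finset.sum_congr rfl fun c _ =>
      Finset.sum_congr rfl fun m _ => by ring
  have s4 : ∑ a, ∑ c, ∑ m, (G y)⁻¹ a c * (christoffel G m e d y * weyl G a b c m y) = 0 := by
    refine Eq.trans ?_ ((sum_rotate fun m a c => christoffel G m e d y *
      ((G y)⁻¹ a c * weyl G a b c m y)).trans hd0)
    exact Finset.sum_congr rfl fun a _ => Finset.sum_congr rfl fun c _ =>
      Finset.sum_congr rfl fun m _ => by ring
  rw [s1, s2, s3, s4]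
  linarith

end IsMetricOn

end

section

/-! ### Contraction of real tensors with complex vectors -/

/-- Complex vectors in coordinates. -/
abbrev CVec : Type := Fin 5 → ℂ

/-- Contraction of a tensor with two vectors. -/
def contr₂ (T : Matrix (Fin 5) (Fin 5) ℝ) (X Y : CVec) : ℂ :=
  ∑ p : Fin 5 × Fin 5, (T p.1 p.2 : ℂ) * (X p.1 * Y p.2)

/-- Contraction of a tensor with three vectors. -/
def contr₃ (T : Fin 5 → Fin 5 → Fin 5 → ℝ) (X Y Z : CVec) : ℂ :=
  ∑ p : Fin 5 × Fin 5 × Fin 5, (T p.1 p.2.1 p.2.2 : ℂ) * (X p.1 * Y p.2.1 * Z p.2.2)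

/-- Contraction of a tensor with four vectors. -/
def contr₄ (T : Fin 5 → Fin 5 → Fin 5 → Fin 5 → ℝ) (X Y Z W : CVec) : ℂ :=
  ∑ p : Fin 5 × Fin 5 × Fin 5 × Fin 5, (T p.1 p.2.1 p.2.2.1 p.2.2.2 : ℂ) *
    (X p.1 * Y p.2.1 * Z p.2.2.1 * W p.2.2.2)

/-- Contraction of a tensor with five vectors. -/
def contr₅ (T : Fin 5 → Fin 5 → Fin 5 → Fin 5 → Fin 5 → ℝ) (X Y Z W V : CVec) : ℂ :=
  ∑ p : Fin 5 × Fin 5 × Fin 5 × Fin 5 × Fin 5,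
    (T p.1 p.2.1 p.2.2.1 p.2.2.2.1 p.2.2.2.2 : ℂ) *
    (X p.1 * Y p.2.1 * Z p.2.2.1 * W p.2.2.2.1 * V p.2.2.2.2)

theorem contr₂_comm {T : Matrix (Fin 5) (Fin 5) ℝ} (hT : ∀ a b, T a b = T b a) (X Y : CVec) :
    contr₂ T X Y = contr₂ T Y X := by
  refine Fintype.sum_equiv (Equiv.prodComm _ _) _ _ ?_
  rintro ⟨a, b⟩
  simp only [Equiv.prodComm_apply, Prod.swap, hT a b]
  ring

/-! #### Linearity -/

section Linear

variable {ι : Type*} (s : Finset ι) (c : ι → ℂ) (V : ι → CVec)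

theorem contr₂_sum_left (T : Matrix (Fin 5) (Fin 5) ℝ) (Y : CVec) :
    contr₂ T (∑ i ∈ s, c i • V i) Y = ∑ i ∈ s, c i * contr₂ T (V i) Y := by
  simp only [contr₂, Finset.sum_apply, Pi.smul_apply, smul_eq_mul, Finset.mul_sum, Finset.sum_mul]
  rw [Finset.sum_comm]
  exact Finset.sum_congr rfl fun i _ => Finset.sum_congr rfl fun p _ => by ring

theorem contr₂_sum_right (T : Matrix (Fin 5) (Fin 5) ℝ) (X : CVec) :
    contr₂ T X (∑ i ∈ s, c i • V i) = ∑ i ∈ s, c i * contr₂ T X (V i) := by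
  simp only [contr₂, Finset.sum_apply, Pi.smul_apply, smul_eq_mul, Finset.mul_sum]
  rw [Finset.sum_comm]
  exact Finset.sum_congr rfl fun i _ => Finset.sum_congr rfl fun p _ => by ring

theorem contr₄_sum₁ (T : Fin 5 → Fin 5 → Fin 5 → Fin 5 → ℝ) (Y Z W : CVec) :
    contr₄ T (∑ i ∈ s, c i • V i) Y Z W = ∑ i ∈ s, c i * contr₄ T (V i) Y Z W := by
  simp only [contr₄, Finset.sum_apply, Pi.smul_apply, smul_eq_mul, Finset.mul_sum, Finset.sum_mul]
  rw [Finset.sum_comm]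
  exact Finset.sum_congr rfl fun i _ => Finset.sum_congr rfl fun p _ => by ring

theorem contr₄_sum₂ (T : Fin 5 → Fin 5 → Fin 5 → Fin 5 → ℝ) (X Z W : CVec) :
    contr₄ T X (∑ i ∈ s, c i • V i) Z W = ∑ i ∈ s, c i * contr₄ T X (V i) Z W := by
  simp only [contr₄, Finset.sum_apply, Pi.smul_apply, smul_eq_mul, Finset.mul_sum, Finset.sum_mul]
  rw [Finset.sum_comm]
  exact Finset.sum_congr rfl fun i _ => Finset.sum_congr rfl fun p _ => by ring

theorem contr₄_sum₃ (T : Fin 5 → Fin 5 → Fin 5 → Fin 5 → ℝ) (X Y W : CVec) :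
    contr₄ T X Y (∑ i ∈ s, c i • V i) W = ∑ i ∈ s, c i * contr₄ T X Y (V i) W := by
  simp only [contr₄, Finset.sum_apply, Pi.smul_apply, smul_eq_mul, Finset.mul_sum, Finset.sum_mul]
  rw [Finset.sum_comm]
  exact Finset.sum_congr rfl fun i _ => Finset.sum_congr rfl fun p _ => by ring

theorem contr₄_sum₄ (T : Fin 5 → Fin 5 → Fin 5 → Fin 5 → ℝ) (X Y Z : CVec) :
    contr₄ T X Y Z (∑ i ∈ s, c i • V i) = ∑ i ∈ s, c i * contr₄ T X Y Z (V i) := by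
  simp only [contr₄, Finset.sum_apply, Pi.smul_apply, smul_eq_mul, Finset.mul_sum]
  rw [Finset.sum_comm]
  exact Finset.sum_congr rfl fun i _ => Finset.sum_congr rfl fun p _ => by ring

end Linear

theorem contr₅_eq_sum (T : Fin 5 → Fin 5 → Fin 5 → Fin 5 → Fin 5 → ℝ) (X Y Z W V : CVec) :
    contr₅ T X Y Z W V = ∑ e, X e * contr₄ (T e) Y Z W V := by
  rw [contr₅, Fintype.sum_prod_type]
  simp only [contr₄, Finset.mul_sum]
  exact Finset.sum_congr rfl fun e _ => Finset.sum_congr rfl fun p _ => by ring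

/-! #### Permutation of the arguments -/

/-- Contractions are single sums over a product type, so that every permutation of the arguments is
one reindexing. -/
theorem contr₄_swap₁₂ (T : Fin 5 → Fin 5 → Fin 5 → Fin 5 → ℝ) (X Y Z W : CVec) :
    contr₄ T X Y Z W = contr₄ (fun a b c d => T b a c d) Y X Z W := by
  refine Fintype.sum_equiv ⟨fun p => (p.2.1, p.1, p.2.2), fun p => (p.2.1, p.1, p.2.2),
    fun _ => rfl, fun _ => rfl⟩ _ _ ?_
  rintro ⟨a, b, c, d⟩
  simp only [Equiv.coe_fn_mk]
  ring

theorem contr₄_swap₃₄ (T : Fin 5 → Fin 5 → Fin 5 → Fin 5 → ℝ) (X Y Z W : CVec) :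
    contr₄ T X Y Z W = contr₄ (fun a b c d => T a b d c) X Y W Z := by
  refine Fintype.sum_equiv ⟨fun p => (p.1, p.2.1, p.2.2.2, p.2.2.1),
    fun p => (p.1, p.2.1, p.2.2.2, p.2.2.1), fun _ => rfl, fun _ => rfl⟩ _ _ ?_
  rintro ⟨a, b, c, d⟩
  simp only [Equiv.coe_fn_mk]
  ring

theorem contr₄_pair (T : Fin 5 → Fin 5 → Fin 5 → Fin 5 → ℝ) (X Y Z W : CVec) :
    contr₄ T X Y Z W = contr₄ (fun a b c d => T c d a b) Z W X Y := by
  refine Fintype.sum_equiv ⟨fun p => (p.2.2.1, p.2.2.2, p.1, p.2.1),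
    fun p => (p.2.2.1, p.2.2.2, p.1, p.2.1), fun _ => rfl, fun _ => rfl⟩ _ _ ?_
  rintro ⟨a, b, c, d⟩
  simp only [Equiv.coe_fn_mk]
  ring

theorem contr₄_rotate (T : Fin 5 → Fin 5 → Fin 5 → Fin 5 → ℝ) (X Y Z W : CVec) :
    contr₄ T Y Z X W = contr₄ (fun a b c d => T b c a d) X Y Z W := by
  refine Fintype.sum_equiv ⟨fun p => (p.2.2.1, p.1, p.2.1, p.2.2.2),
    fun p => (p.2.1, p.2.2.1, p.1, p.2.2.2), fun _ => rfl, fun _ => rfl⟩ _ _ ?_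
  rintro ⟨a, b, c, d⟩
  simp only [Equiv.coe_fn_mk]
  ring

theorem contr₅_rotate (T : Fin 5 → Fin 5 → Fin 5 → Fin 5 → Fin 5 → ℝ) (X Y Z W V : CVec) :
    contr₅ T Y Z X W V = contr₅ (fun a b c d e => T b c a d e) X Y Z W V := by
  refine Fintype.sum_equiv ⟨fun p => (p.2.2.1, p.1, p.2.1, p.2.2.2),
    fun p => (p.2.1, p.2.2.1, p.1, p.2.2.2), fun _ => rfl, fun _ => rfl⟩ _ _ ?_
  rintro ⟨a, b, c, d, e⟩
  simp only [Equiv.coe_fn_mk]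
  ring

theorem contr₃_swap₂₃ (T : Fin 5 → Fin 5 → Fin 5 → ℝ) (X Y Z : CVec) :
    contr₃ T X Y Z = contr₃ (fun a b c => T a c b) X Z Y := by
  refine Fintype.sum_equiv ⟨fun p => (p.1, p.2.2, p.2.1), fun p => (p.1, p.2.2, p.2.1),
    fun _ => rfl, fun _ => rfl⟩ _ _ ?_
  rintro ⟨a, b, c⟩
  simp only [Equiv.coe_fn_mk]
  ring

theorem contr₃_rotate (T : Fin 5 → Fin 5 → Fin 5 → ℝ) (X Y Z : CVec) :
    contr₃ T Y Z X = contr₃ (fun a b c => T b c a) X Y Z := by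
  refine Fintype.sum_equiv ⟨fun p => (p.2.2, p.1, p.2.1), fun p => (p.2.1, p.2.2, p.1),
    fun _ => rfl, fun _ => rfl⟩ _ _ ?_
  rintro ⟨a, b, c⟩
  simp only [Equiv.coe_fn_mk]
  ring

theorem contr₅_mul (g : Matrix (Fin 5) (Fin 5) ℝ) (A : Fin 5 → Fin 5 → Fin 5 → ℝ) (X Y Z W V : CVec) :
    contr₅ (fun a b c d e => g b d * A e a c) X Y Z W V = contr₂ g Y W * contr₃ A V X Z := by
  rw [contr₂, contr₃, Fintype.sum_mul_sum, ← Fintype.sum_prod_type']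
  refine Fintype.sum_equiv ⟨fun p => ((p.2.1, p.2.2.2.1), (p.2.2.2.2, p.1, p.2.2.1)),
    fun p => (p.2.2.1, p.1.1, p.2.2.2, p.1.2, p.2.1), fun _ => rfl, fun _ => rfl⟩ _ _ ?_
  rintro ⟨a, b, c, d, e⟩
  simp only [Equiv.coe_fn_mk]
  push_cast
  ring

theorem contr₅_mul' (g : Matrix (Fin 5) (Fin 5) ℝ) (A : Fin 5 → Fin 5 → Fin 5 → ℝ) (X Y Z W V : CVec) :
    contr₅ (fun a b c d e => g b e * A d a c) X Y Z W V = contr₂ g Y V * contr₃ A W X Z := by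
  rw [contr₂, contr₃, Fintype.sum_mul_sum, ← Fintype.sum_prod_type']
  refine Fintype.sum_equiv ⟨fun p => ((p.2.1, p.2.2.2.2), (p.2.2.2.1, p.1, p.2.2.1)),
    fun p => (p.2.2.1, p.1.1, p.2.2.2, p.2.1, p.1.2), fun _ => rfl, fun _ => rfl⟩ _ _ ?_
  rintro ⟨a, b, c, d, e⟩
  simp only [Equiv.coe_fn_mk]
  push_cast
  ring

theorem IsCurvatureLike.contr₄ {T : Fin 5 → Fin 5 → Fin 5 → Fin 5 → ℝ} (hT : IsCurvatureLike T)
    {ι : Type*} (f : ι → CVec) :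
    IsCurvatureLike fun a b c d => contr₄ T (f a) (f b) (f c) (f d) where
  antisymm_left a b c d := by
    rw [contr₄_swap₁₂, GoldbergSachs.contr₄, GoldbergSachs.contr₄, ← Finset.sum_neg_distrib]
    refine Finset.sum_congr rfl fun p _ => ?_
    rw [hT.antisymm_left p.2.1]
    push_cast
    ring
  antisymm_right a b c d := by
    rw [contr₄_swap₃₄, GoldbergSachs.contr₄, GoldbergSachs.contr₄, ← Finset.sum_neg_distrib]
    refine Finset.sum_congr rfl fun p _ => ?_
    rw [hT.antisymm_right p.1 p.2.1 p.2.2.2]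
    push_cast
    ring
  pair a b c d := by
    rw [contr₄_pair]
    congr
    ext a b c d
    rw [hT.pair]
  cyclic a b c d := by
    rw [contr₄_rotate T (f a) (f b) (f c), contr₄_rotate T (f b) (f c) (f a),
      contr₄_rotate _ (f a) (f b) (f c)]
    simp only [GoldbergSachs.contr₄, ← Finset.sum_add_distrib]
    refine Finset.sum_eq_zero fun p _ => ?_
    have h := congrArg (Complex.ofReal) (hT.cyclic p.1 p.2.1 p.2.2.1 p.2.2.2)
    push_cast at h
    linear_combination (f a p.1 * f b p.2.1 * f c p.2.2.1 * f d p.2.2.2) * h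

end

section

/-! ### Covariant differentiation of complex vector fields -/

/-- The partial derivative of a complex-valued function. -/
def cpd (i : Fin 5) (f : E5 → ℂ) (y : E5) : ℂ :=
  fderiv ℝ f y (EuclideanSpace.single i 1)

section

variable {f h : E5 → ℂ} {y : E5}

theorem cpd_congr (i : Fin 5) (hfh : f =ᶠ[𝓝 y] h) : cpd i f y = cpd i h y := by
  rw [cpd, cpd, hfh.fderiv_eq]

theorem cpd_const (i : Fin 5) (c : ℂ) : cpd i (fun _ => c) y = 0 := by
  simp [cpd]

theorem cpd_add (i : Fin 5) (hf : DifferentiableAt ℝ f y) (hh : DifferentiableAt ℝ h y) :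
    cpd i (fun z => f z + h z) y = cpd i f y + cpd i h y := by
  simp [cpd, fderiv_fun_add hf hh]

theorem cpd_mul (i : Fin 5) (hf : DifferentiableAt ℝ f y) (hh : DifferentiableAt ℝ h y) :
    cpd i (fun z => f z * h z) y = cpd i f y * h y + f y * cpd i h y := by
  simp [cpd, fderiv_fun_mul hf hh]
  ring

theorem cpd_sum {ι : Type*} (s : Finset ι) (i : Fin 5) {f : ι → E5 → ℂ}
    (hf : ∀ k ∈ s, DifferentiableAt ℝ (f k) y) :
    cpd i (fun z => ∑ k ∈ s, f k z) y = ∑ k ∈ s, cpd i (f k) y := by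
  simp [cpd, fderiv_fun_sum hf]

theorem _root_.DifferentiableAt.complex_ofReal {f : E5 → ℝ} (hf : DifferentiableAt ℝ f y) :
    DifferentiableAt ℝ (fun z => (f z : ℂ)) y :=
  Complex.ofRealCLM.differentiableAt.comp y hf

theorem cpd_ofReal (i : Fin 5) {f : E5 → ℝ} (hf : DifferentiableAt ℝ f y) :
    cpd i (fun z => (f z : ℂ)) y = (pd i f y : ℂ) := by
  have h : (fun z => (f z : ℂ)) = Complex.ofRealCLM ∘ f := rfl
  rw [cpd, pd, h, fderiv_comp y Complex.ofRealCLM.differentiableAt hf]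
  simp

end

/-- Differentiability of the components of a complex vector field. -/
def DiffFieldAt (F : E5 → CVec) (y : E5) : Prop :=
  ∀ a, DifferentiableAt ℝ (fun z => F z a) y

/-- The covariant derivative of a complex vector field in a coordinate direction. -/
def covVec (G : E5 → Matrix (Fin 5) (Fin 5) ℝ) (e : Fin 5) (F : E5 → CVec) (y : E5) : CVec :=
  fun a => cpd e (fun z => F z a) y + ∑ m, (christoffel G a e m y : ℂ) * F y m

/-- The covariant derivative of a complex vector field in a complex direction. -/
def dirCov (G : E5 → Matrix (Fin 5) (Fin 5) ℝ) (X : CVec) (F : E5 → CVec) (y : E5) : CVec :=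
  ∑ e, X e • covVec G e F y

section Slots

variable (M : Fin 5 → Fin 5 → ℝ)

/-- An endomorphism acting on a tensor slot can be moved to the vector in that slot. Applied to
Christoffel symbols, this is what makes the covariant Leibniz rules work. -/
theorem contr₂_slot₁ (T : Matrix (Fin 5) (Fin 5) ℝ) (X Y : CVec) :
    contr₂ (Matrix.of fun a b => ∑ m, M m a * T m b) X Y = contr₂ T (fun a => ∑ m, (M a m : ℂ) * X m) Y := by
  simp only [contr₂, Matrix.of_apply, Complex.ofReal_sum, Complex.ofReal_mul, Finset.mul_sum, Finset.sum_mul]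
  rw [← Fintype.sum_prod_type', ← Fintype.sum_prod_type']
  refine Fintype.sum_equiv ⟨fun p => ((p.2, p.1.2), p.1.1), fun p => ((p.2, p.1.2), p.1.1),
    fun _ => rfl, fun _ => rfl⟩ _ _ ?_
  rintro ⟨⟨a, b⟩, m⟩
  simp only [Equiv.coe_fn_mk]
  ring

theorem contr₂_slot₂ (T : Matrix (Fin 5) (Fin 5) ℝ) (X Y : CVec) :
    contr₂ (Matrix.of fun a b => ∑ m, M m b * T a m) X Y = contr₂ T X (fun a => ∑ m, (M a m : ℂ) * Y m) := by
  simp only [contr₂, Matrix.of_apply, Complex.ofReal_sum, Complex.ofReal_mul, Finset.mul_sum, Finset.sum_mul]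
  rw [← Fintype.sum_prod_type', ← Fintype.sum_prod_type']
  refine Fintype.sum_equiv ⟨fun p => ((p.1.1, p.2), p.1.2), fun p => ((p.1.1, p.2), p.1.2),
    fun _ => rfl, fun _ => rfl⟩ _ _ ?_
  rintro ⟨⟨a, b⟩, m⟩
  simp only [Equiv.coe_fn_mk]
  ring

variable (T : Fin 5 → Fin 5 → Fin 5 → Fin 5 → ℝ) (X Y Z W : CVec)

theorem contr₄_slot₁ :
    contr₄ (fun a b c d => ∑ m, M m a * T m b c d) X Y Z W =
      contr₄ T (fun a => ∑ m, (M a m : ℂ) * X m) Y Z W := by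
  simp only [contr₄, Complex.ofReal_sum, Complex.ofReal_mul, Finset.mul_sum, Finset.sum_mul]
  rw [← Fintype.sum_prod_type', ← Fintype.sum_prod_type']
  refine Fintype.sum_equiv ⟨fun p => ((p.2, p.1.2), p.1.1), fun p => ((p.2, p.1.2), p.1.1),
    fun _ => rfl, fun _ => rfl⟩ _ _ ?_
  rintro ⟨⟨a, b, c, d⟩, m⟩
  simp only [Equiv.coe_fn_mk]
  ring

theorem contr₄_slot₂ :
    contr₄ (fun a b c d => ∑ m, M m b * T a m c d) X Y Z W =
      contr₄ T X (fun a => ∑ m, (M a m : ℂ) * Y m) Z W := by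
  rw [contr₄_swap₁₂, contr₄_swap₁₂ T, ← contr₄_slot₁]

theorem contr₄_slot₃ :
    contr₄ (fun a b c d => ∑ m, M m c * T a b m d) X Y Z W =
      contr₄ T X Y (fun a => ∑ m, (M a m : ℂ) * Z m) W := by
  rw [contr₄_pair, contr₄_pair T, ← contr₄_slot₁]

theorem contr₄_slot₄ :
    contr₄ (fun a b c d => ∑ m, M m d * T a b c m) X Y Z W =
      contr₄ T X Y Z (fun a => ∑ m, (M a m : ℂ) * W m) := by
  rw [contr₄_pair, contr₄_pair T, ← contr₄_slot₂]

end Slots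

section Leibniz

variable {G : E5 → Matrix (Fin 5) (Fin 5) ℝ} {y : E5}

/-- The ordinary product rule holds, and the Christoffel terms subtracted in ∇T are exactly those
added in the covariant derivatives of the four vectors. -/
theorem contr₄_leibniz_aux {T : Fin 5 → Fin 5 → Fin 5 → Fin 5 → E5 → ℝ}
    (hT : ∀ a b c d, DifferentiableAt ℝ (T a b c d) y) {F₁ F₂ F₃ F₄ : E5 → CVec}
    (h₁ : DiffFieldAt F₁ y) (h₂ : DiffFieldAt F₂ y) (h₃ : DiffFieldAt F₃ y)
    (h₄ : DiffFieldAt F₄ y) (e : Fin 5) :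
    cpd e (fun z => contr₄ (fun a b c d => T a b c d z) (F₁ z) (F₂ z) (F₃ z) (F₄ z)) y =
      contr₄ (fun a b c d => covFour G T e a b c d y) (F₁ y) (F₂ y) (F₃ y) (F₄ y)
      + contr₄ (fun a b c d => T a b c d y) (covVec G e F₁ y) (F₂ y) (F₃ y) (F₄ y)
      + contr₄ (fun a b c d => T a b c d y) (F₁ y) (covVec G e F₂ y) (F₃ y) (F₄ y)
      + contr₄ (fun a b c d => T a b c d y) (F₁ y) (F₂ y) (covVec G e F₃ y) (F₄ y)
      + contr₄ (fun a b c d => T a b c d y) (F₁ y) (F₂ y) (F₃ y) (covVec G e F₄ y) := by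
  have s₁ := contr₄_slot₁ (fun m a => christoffel G m e a y) (fun a b c d => T a b c d y)
    (F₁ y) (F₂ y) (F₃ y) (F₄ y)
  have s₂ := contr₄_slot₂ (fun m a => christoffel G m e a y) (fun a b c d => T a b c d y)
    (F₁ y) (F₂ y) (F₃ y) (F₄ y)
  have s₃ := contr₄_slot₃ (fun m a => christoffel G m e a y) (fun a b c d => T a b c d y)
    (F₁ y) (F₂ y) (F₃ y) (F₄ y)
  have s₄ := contr₄_slot₄ (fun m a => christoffel G m e a y) (fun a b c d => T a b c d y)
    (F₁ y) (F₂ y) (F₃ y) (F₄ y)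
  simp only [contr₄] at s₁ s₂ s₃ s₄ ⊢
  rw [cpd_sum _ _ fun p _ => ((hT _ _ _ _).complex_ofReal).fun_mul
    ((((h₁ _).fun_mul (h₂ _)).fun_mul (h₃ _)).fun_mul (h₄ _))]
  have hterm : ∀ p : Fin 5 × Fin 5 × Fin 5 × Fin 5,
      cpd e (fun z => (T p.1 p.2.1 p.2.2.1 p.2.2.2 z : ℂ) *
        (F₁ z p.1 * F₂ z p.2.1 * F₃ z p.2.2.1 * F₄ z p.2.2.2)) y =
      (pd e (T p.1 p.2.1 p.2.2.1 p.2.2.2) y : ℂ) *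
        (F₁ y p.1 * F₂ y p.2.1 * F₃ y p.2.2.1 * F₄ y p.2.2.2)
      + (T p.1 p.2.1 p.2.2.1 p.2.2.2 y : ℂ) *
        (cpd e (fun z => F₁ z p.1) y * F₂ y p.2.1 * F₃ y p.2.2.1 * F₄ y p.2.2.2
        + F₁ y p.1 * cpd e (fun z => F₂ z p.2.1) y * F₃ y p.2.2.1 * F₄ y p.2.2.2
        + F₁ y p.1 * F₂ y p.2.1 * cpd e (fun z => F₃ z p.2.2.1) y * F₄ y p.2.2.2
        + F₁ y p.1 * F₂ y p.2.1 * F₃ y p.2.2.1 * cpd e (fun z => F₄ z p.2.2.2) y) := by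
    intro p
    rw [cpd_mul e (hT _ _ _ _).complex_ofReal
        ((((h₁ _).fun_mul (h₂ _)).fun_mul (h₃ _)).fun_mul (h₄ _)),
      cpd_ofReal e (hT _ _ _ _), cpd_mul e (((h₁ _).fun_mul (h₂ _)).fun_mul (h₃ _)) (h₄ _),
      cpd_mul e ((h₁ _).fun_mul (h₂ _)) (h₃ _), cpd_mul e (h₁ _) (h₂ _)]
    ring
  simp only [hterm]
  simp only [covFour, covVec, Finset.sum_add_distrib, Complex.ofReal_sub, Complex.ofReal_add,
    mul_add, add_mul, sub_mul, Finset.sum_sub_distrib] at s₁ s₂ s₃ s₄ ⊢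
  rw [← s₁, ← s₂, ← s₃, ← s₄]
  ring

theorem contr₄_leibniz {T : Fin 5 → Fin 5 → Fin 5 → Fin 5 → E5 → ℝ}
    (hT : ∀ a b c d, DifferentiableAt ℝ (T a b c d) y) {F₁ F₂ F₃ F₄ : E5 → CVec}
    (h₁ : DiffFieldAt F₁ y) (h₂ : DiffFieldAt F₂ y) (h₃ : DiffFieldAt F₃ y)
    (h₄ : DiffFieldAt F₄ y) (X : CVec) :
    ∑ e, X e * cpd e
      (fun z => contr₄ (fun a b c d => T a b c d z) (F₁ z) (F₂ z) (F₃ z) (F₄ z)) y =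
      contr₅ (fun e a b c d => covFour G T e a b c d y) X (F₁ y) (F₂ y) (F₃ y) (F₄ y)
      + contr₄ (fun a b c d => T a b c d y) (dirCov G X F₁ y) (F₂ y) (F₃ y) (F₄ y)
      + contr₄ (fun a b c d => T a b c d y) (F₁ y) (dirCov G X F₂ y) (F₃ y) (F₄ y)
      + contr₄ (fun a b c d => T a b c d y) (F₁ y) (F₂ y) (dirCov G X F₃ y) (F₄ y)
      + contr₄ (fun a b c d => T a b c d y) (F₁ y) (F₂ y) (F₃ y) (dirCov G X F₄ y) := by
  simp only [dirCov, contr₄_sum₁, contr₄_sum₂, contr₄_sum₃, contr₄_sum₄, contr₅_eq_sum,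
    ← Finset.sum_add_distrib]
  refine Finset.sum_congr rfl fun e _ => ?_
  rw [contr₄_leibniz_aux (G := G) hT h₁ h₂ h₃ h₄ e]
  ring

theorem IsMetricOn.contr₂_leibniz {Ω : Set E5} (hG : IsMetricOn G Ω) (hy : y ∈ Ω)
    {F₁ F₂ : E5 → CVec} (h₁ : DiffFieldAt F₁ y) (h₂ : DiffFieldAt F₂ y) (X : CVec) :
    ∑ e, X e * cpd e (fun z => contr₂ (G z) (F₁ z) (F₂ z)) y =
      contr₂ (G y) (dirCov G X F₁ y) (F₂ y) + contr₂ (G y) (F₁ y) (dirCov G X F₂ y) := by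
  simp only [dirCov, contr₂_sum_left, contr₂_sum_right, ← Finset.sum_add_distrib]
  refine Finset.sum_congr rfl fun e _ => ?_
  rw [← mul_add]
  congr 1
  have s₁ := contr₂_slot₁ (fun m a => christoffel G m e a y) (G y) (F₁ y) (F₂ y)
  have s₂ := contr₂_slot₂ (fun m a => christoffel G m e a y) (G y) (F₁ y) (F₂ y)
  have hT : ∀ a b, DifferentiableAt ℝ (fun z => G z a b) y :=
    fun a b => (hG.smooth y hy a b).differentiableAt_top
  simp only [contr₂, Matrix.of_apply] at s₁ s₂ ⊢
  rw [cpd_sum _ _ fun p _ => ((hT _ _).complex_ofReal).fun_mul ((h₁ _).fun_mul (h₂ _))]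
  have hterm : ∀ p : Fin 5 × Fin 5,
      cpd e (fun z => (G z p.1 p.2 : ℂ) * (F₁ z p.1 * F₂ z p.2)) y =
      ((∑ m, christoffel G m e p.1 y * G y m p.2 : ℝ) : ℂ) * (F₁ y p.1 * F₂ y p.2)
      + ((∑ m, christoffel G m e p.2 y * G y p.1 m : ℝ) : ℂ) * (F₁ y p.1 * F₂ y p.2)
      + (G y p.1 p.2 : ℂ) *
        (cpd e (fun z => F₁ z p.1) y * F₂ y p.2 + F₁ y p.1 * cpd e (fun z => F₂ z p.2) y) := by
    intro p
    rw [cpd_mul e (hT _ _).complex_ofReal ((h₁ _).fun_mul (h₂ _)),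
      cpd_ofReal e (hT _ _), cpd_mul e (h₁ _) (h₂ _), hG.pd_metric hy, Finset.sum_add_distrib]
    push_cast
    ring
  simp only [hterm, Finset.sum_add_distrib, covVec, mul_add, add_mul]
  rw [s₁, s₂]
  ring

end Leibniz

/-! ### Null frames -/

section NullFrame

variable {G : E5 → Matrix (Fin 5) (Fin 5) ℝ} {Ω : Set E5} {y : E5} {f : Fin 5 → CVec}

/-- The Gram relations say that the frame matrix times the metric has the dual frame as right
inverse; for square matrices it is also a left inverse. -/
theorem frame_completeness (hf : ∀ a b, contr₂ (G y) (f a) (f b) = frameGram a b) :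
    (Matrix.of fun i a => f (dual a) i) * (Matrix.of fun a i => f a i) *
      (G y).map Complex.ofReal = 1 := by
  have h : (Matrix.of fun a i => f a i) * (G y).map Complex.ofReal *
      (Matrix.of fun i a => f (dual a) i) = 1 := by
    ext a b
    have h := hf a (dual b)
    rw [contr₂, Fintype.sum_prod_type] at h
    simp only [Matrix.mul_apply, Matrix.of_apply, Matrix.map_apply, Finset.sum_mul]
    rw [Finset.sum_comm]
    have e : frameGram a (dual b) = (1 : Matrix (Fin 5) (Fin 5) ℂ) a b := by
      rw [frameGram, Matrix.one_apply]
      congr 1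
      refine propext ⟨fun h => ?_, fun h => by rw [h]⟩
      rw [← dual_dual a, h, dual_dual]
    rw [← e, ← h]
    exact Finset.sum_congr rfl fun i _ => Finset.sum_congr rfl fun j _ => by ring
  rw [Matrix.mul_assoc]
  exact mul_eq_one_comm.mp h

theorem frame_expansion (hf : ∀ a b, contr₂ (G y) (f a) (f b) = frameGram a b) (V : CVec) :
    V = ∑ a, contr₂ (G y) (f a) V • f (dual a) := by
  have h := congrArg (fun X => X.mulVec V) (frame_completeness hf)
  simp only [Matrix.one_mulVec, Matrix.mul_assoc, ← Matrix.mulVec_mulVec] at h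
  nth_rw 1 [← h]
  ext i
  simp only [Matrix.mulVec, dotProduct, Matrix.of_apply, Matrix.map_apply, Finset.sum_apply,
    Pi.smul_apply, smul_eq_mul, contr₂, Fintype.sum_prod_type]
  refine Finset.sum_congr rfl fun a _ => ?_
  rw [mul_comm]
  congr 1
  refine Finset.sum_congr rfl fun j _ => ?_
  rw [Finset.mul_sum]
  exact Finset.sum_congr rfl fun k _ => by ring

/-- Completeness of the frame gives g⁻¹ = ∑ f_a ⊗ f_{a*}, where a* is the dual index. Metric traces
thereby become sums over the frame. -/
theorem frame_inverse (hG : IsMetricOn G Ω) (hy : y ∈ Ω)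
    (hf : ∀ a b, contr₂ (G y) (f a) (f b) = frameGram a b) (i j : Fin 5) :
    ((G y)⁻¹ i j : ℂ) = ∑ a, f a i * f (dual a) j := by
  have h1 : (G y).map Complex.ofReal * ((G y)⁻¹).map Complex.ofReal = 1 := by
    have h := congrArg (Complex.ofRealHom.mapMatrix) (hG.mul_inv hy)
    rwa [map_mul, map_one] at h
  have h2 := congrArg (fun X => X * ((G y)⁻¹).map Complex.ofReal) (frame_completeness hf)
  simp only [Matrix.mul_assoc, h1, Matrix.one_mul, Matrix.mul_one] at h2
  have h3 := congrFun (congrFun h2 j) i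
  simp only [Matrix.mul_apply, Matrix.of_apply, Matrix.map_apply] at h3
  rw [hG.inv_symm hy, ← h3]
  exact Finset.sum_congr rfl fun a _ => by ring

theorem frame_trace (hG : IsMetricOn G Ω) (hy : y ∈ Ω)
    (hf : ∀ a b, contr₂ (G y) (f a) (f b) = frameGram a b)
    {T : Fin 5 → Fin 5 → Fin 5 → Fin 5 → ℝ}
    (hT : ∀ b d, ∑ a, ∑ c, (G y)⁻¹ a c * T a b c d = 0) (Y W : CVec) :
    ∑ a, contr₄ T (f a) Y (f (dual a)) W = 0 := by
  have h : ∑ a, contr₄ T (f a) Y (f (dual a)) W =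
      contr₂ (Matrix.of fun b d => ∑ a, ∑ c, (G y)⁻¹ a c * T a b c d) Y W := by
    have h2 : contr₂ (Matrix.of fun b d => ∑ a, ∑ c, (G y)⁻¹ a c * T a b c d) Y W =
        ∑ p : Fin 5 × Fin 5, ∑ q : Fin 5 × Fin 5 × Fin 5,
          f q.2.2 q.1 * f (dual q.2.2) q.2.1 * (T q.1 p.1 q.2.1 p.2 : ℂ) * (Y p.1 * W p.2) := by
      simp only [contr₂, Matrix.of_apply]
      push_cast
      simp only [frame_inverse hG hy hf, Finset.sum_mul, Fintype.sum_prod_type]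
    rw [h2]
    simp only [contr₄]
    rw [← Fintype.sum_prod_type', ← Fintype.sum_prod_type']
    refine Fintype.sum_equiv
      ⟨fun p => ((p.2.2.1, p.2.2.2.2), (p.2.1, p.2.2.2.1, p.1)),
        fun p => (p.2.2.2, p.2.1, p.1.1, p.2.2.1, p.1.2), fun _ => rfl, fun _ => rfl⟩ _ _ ?_
    rintro ⟨r, a, b, c, d⟩
    simp only [Equiv.coe_fn_mk]
    ring
  rw [h]
  simp [contr₂, hT]

end NullFrame

end

section

/-! ### Frobenius integrability at a point, in coordinates -/

theorem contr₂_sub_left (T : Matrix (Fin 5) (Fin 5) ℝ) (X X' Y : CVec) :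
    contr₂ T (X - X') Y = contr₂ T X Y - contr₂ T X' Y := by
  simp only [contr₂, ← Finset.sum_sub_distrib, Pi.sub_apply]
  exact Finset.sum_congr rfl fun p _ => by ring

theorem contr₂_sub_right (T : Matrix (Fin 5) (Fin 5) ℝ) (X Y Y' : CVec) :
    contr₂ T X (Y - Y') = contr₂ T X Y - contr₂ T X Y' := by
  simp only [contr₂, ← Finset.sum_sub_distrib, Pi.sub_apply]
  exact Finset.sum_congr rfl fun p _ => by ring

theorem contr₂_add_left (T : Matrix (Fin 5) (Fin 5) ℝ) (X X' Y : CVec) :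
    contr₂ T (X + X') Y = contr₂ T X Y + contr₂ T X' Y := by
  simp only [contr₂, ← Finset.sum_add_distrib, Pi.add_apply]
  exact Finset.sum_congr rfl fun p _ => by ring

theorem contr₂_add_right (T : Matrix (Fin 5) (Fin 5) ℝ) (X Y Y' : CVec) :
    contr₂ T X (Y + Y') = contr₂ T X Y + contr₂ T X Y' := by
  simp only [contr₂, ← Finset.sum_add_distrib, Pi.add_apply]
  exact Finset.sum_congr rfl fun p _ => by ring

theorem contr₂_smul_left (T : Matrix (Fin 5) (Fin 5) ℝ) (c : ℂ) (X Y : CVec) :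
    contr₂ T (c • X) Y = c * contr₂ T X Y := by
  simp only [contr₂, Finset.mul_sum, Pi.smul_apply, smul_eq_mul]
  exact Finset.sum_congr rfl fun p _ => by ring

theorem contr₂_smul_right (T : Matrix (Fin 5) (Fin 5) ℝ) (c : ℂ) (X Y : CVec) :
    contr₂ T X (c • Y) = c * contr₂ T X Y := by
  simp only [contr₂, Finset.mul_sum, Pi.smul_apply, smul_eq_mul]
  exact Finset.sum_congr rfl fun p _ => by ring

/-- The orthogonal complement of a complex subspace. -/
def perpC (A : Matrix (Fin 5) (Fin 5) ℝ) (N : Submodule ℂ CVec) : Submodule ℂ CVec where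
  carrier := {X | ∀ Z ∈ N, contr₂ A Z X = 0}
  add_mem' := by
    intro X Y hX hY Z hZ
    rw [contr₂_add_right, hX Z hZ, hY Z hZ, add_zero]
  zero_mem' := by
    intro Z _
    simp [contr₂]
  smul_mem' := by
    intro c X hX Z hZ
    rw [contr₂_smul_right, hX Z hZ, mul_zero]

/-- The Lie bracket of complex vector fields in coordinates. -/
def bracketC (F F' : E5 → CVec) (y : E5) : CVec :=
  fun a => ∑ e, (F y e * cpd e (fun z => F' z a) y - F' y e * cpd e (fun z => F z a) y)

/-- The Levi-Civita connection is torsion-free, so the Christoffel terms cancel. -/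
theorem IsMetricOn.bracketC_eq {G : E5 → Matrix (Fin 5) (Fin 5) ℝ} {Ω : Set E5}
    (hG : IsMetricOn G Ω) {y : E5} (hy : y ∈ Ω) (F F' : E5 → CVec) :
    bracketC F F' y = dirCov G (F y) F' y - dirCov G (F' y) F y := by
  ext a
  simp only [bracketC, dirCov, covVec, Finset.sum_apply, Pi.smul_apply, smul_eq_mul, Pi.sub_apply,
    mul_add, Finset.sum_add_distrib, Finset.sum_sub_distrib, Finset.mul_sum]
  have h : ∑ e, ∑ m, F y e * ((christoffel G a e m y : ℂ) * F' y m) =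
      ∑ e, ∑ m, F' y e * ((christoffel G a e m y : ℂ) * F y m) := by
    rw [Finset.sum_comm]
    refine Finset.sum_congr rfl fun e _ => Finset.sum_congr rfl fun m _ => ?_
    rw [hG.christoffel_symm hy a m e]
    ring
  rw [h]
  ring

theorem IsCurvatureLike.sum {ι κ : Type*} (s : Finset κ) (x : κ → ℂ)
    {T : κ → ι → ι → ι → ι → ℂ} (hT : ∀ k, IsCurvatureLike (T k)) :
    IsCurvatureLike fun a b c d => ∑ k ∈ s, x k * T k a b c d where
  antisymm_left a b c d := by
    rw [← Finset.sum_neg_distrib]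
    exact Finset.sum_congr rfl fun k _ => by rw [(hT k).antisymm_left, mul_neg]
  antisymm_right a b c d := by
    rw [← Finset.sum_neg_distrib]
    exact Finset.sum_congr rfl fun k _ => by rw [(hT k).antisymm_right, mul_neg]
  pair a b c d := Finset.sum_congr rfl fun k _ => by rw [(hT k).pair]
  cyclic a b c d := by
    rw [← Finset.sum_add_distrib, ← Finset.sum_add_distrib]
    refine Finset.sum_eq_zero fun k _ => ?_
    rw [← mul_add, ← mul_add, (hT k).cyclic, mul_zero]

theorem contr₅_bianchi {T : Fin 5 → Fin 5 → Fin 5 → Fin 5 → Fin 5 → ℝ}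
    {g : Matrix (Fin 5) (Fin 5) ℝ} {A : Fin 5 → Fin 5 → Fin 5 → ℝ}
    (h : ∀ a b c d e, T a b c d e + T b c a d e + T c a b d e =
      (g b d * A e a c - g b e * A d a c) + (g c d * A e b a - g c e * A d b a)
      + (g a d * A e c b - g a e * A d c b)) (X Y Z W V : CVec) :
    contr₅ T X Y Z W V + contr₅ T Y Z X W V + contr₅ T Z X Y W V =
      (contr₂ g Y W * contr₃ A V X Z - contr₂ g Y V * contr₃ A W X Z)
      + (contr₂ g Z W * contr₃ A V Y X - contr₂ g Z V * contr₃ A W Y X)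
      + (contr₂ g X W * contr₃ A V Z Y - contr₂ g X V * contr₃ A W Z Y) := by
  rw [← contr₅_mul g A X Y Z W V, ← contr₅_mul' g A X Y Z W V, ← contr₅_mul g A Y Z X W V,
    ← contr₅_mul' g A Y Z X W V, ← contr₅_mul g A Z X Y W V, ← contr₅_mul' g A Z X Y W V]
  have hrot : ∀ T : Fin 5 → Fin 5 → Fin 5 → Fin 5 → Fin 5 → ℝ,
      contr₅ T Z X Y W V = contr₅ (fun a b c d e => T c a b d e) X Y Z W V := by
    intro T
    rw [contr₅_rotate T Y Z X, contr₅_rotate _ X Y Z]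
  rw [contr₅_rotate T X Y Z, hrot T, contr₅_rotate (fun a b c d e => g b d * A e a c) X Y Z,
    contr₅_rotate (fun a b c d e => g b e * A d a c) X Y Z,
    hrot (fun a b c d e => g b d * A e a c), hrot (fun a b c d e => g b e * A d a c)]
  simp only [contr₅, ← Finset.sum_add_distrib, ← Finset.sum_sub_distrib]
  refine Finset.sum_congr rfl fun p _ => ?_
  have h := congrArg Complex.ofReal (h p.1 p.2.1 p.2.2.1 p.2.2.2.1 p.2.2.2.2)
  push_cast at h ⊢
  linear_combination (X p.1 * Y p.2.1 * Z p.2.2.1 * W p.2.2.2.1 * V p.2.2.2.2) * h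

/-- Complex conjugation of coordinate vectors. -/
def conjV (X : CVec) : CVec := fun a => starRingEnd ℂ (X a)

theorem contr₄_conj (T : Fin 5 → Fin 5 → Fin 5 → Fin 5 → ℝ) (X Y Z W : CVec) :
    contr₄ T (conjV X) (conjV Y) (conjV Z) (conjV W) = starRingEnd ℂ (contr₄ T X Y Z W) := by
  simp [contr₄, conjV]

/-- A complex distribution `N` in coordinates near `y`, spanned by the vector fields `Z`, totally
null for the metric `G`, and a null frame at `y` adapted to it. -/
structure IsOpticalAt (G : E5 → Matrix (Fin 5) (Fin 5) ℝ) (N : E5 → Submodule ℂ CVec)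
    (Z : Fin 2 → E5 → CVec) (f : Fin 5 → CVec) (y : E5) : Prop where
  diff : ∀ i, DiffFieldAt (Z i) y
  span : ∀ᶠ z in 𝓝 y, N z = Submodule.span ℂ (Set.range fun i => Z i z)
  null : ∀ᶠ z in 𝓝 y, N z ≤ perpC (G z) (N z)
  gram : ∀ a b, contr₂ (G y) (f a) (f b) = frameGram a b
  conj : ∀ a, conjV (f a) = f (Equiv.swap 2 3 a)
  k_mem : f 0 ∈ N y
  conj_m_mem : f 3 ∈ N y

/-- A complex distribution in coordinates near `y`, null for the metric `G`, with respect to which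
the Weyl tensor is algebraically special and nondegenerate, and the Cotton-York tensor is
degenerate. -/
structure IsSpecialAt (G : E5 → Matrix (Fin 5) (Fin 5) ℝ) (N : E5 → Submodule ℂ CVec)
    (Z : Fin 2 → E5 → CVec) (f : Fin 5 → CVec) (y : E5) : Prop extends
    IsOpticalAt G N Z f y where
  weyl : ∀ᶠ z in 𝓝 y, ∀ X ∈ perpC (G z) (N z), ∀ Y ∈ perpC (G z) (N z), ∀ V ∈ N z, ∀ W,
    contr₄ (fun a b c d => weyl G a b c d z) X Y V W = 0
  cotton : ∀ X ∈ perpC (G y) (N y), ∀ Y ∈ perpC (G y) (N y), ∀ V ∈ N y,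
    contr₃ (fun a b c => cottonYork G a b c y) V X Y = 0
  nondeg : contr₄ (fun a b c d => GoldbergSachs.weyl G a b c d y) (f 0) (f 3) (f 1) (f 2) ≠
    contr₄ (fun a b c d => GoldbergSachs.weyl G a b c d y) (f 0) (f 4) (f 1) (f 4)
  nondeg' : contr₄ (fun a b c d => GoldbergSachs.weyl G a b c d y) (f 0) (f 3) (f 1) (f 2) ≠
    -contr₄ (fun a b c d => GoldbergSachs.weyl G a b c d y) (f 0) (f 4) (f 1) (f 4)

/-! ### Sections of N and of its orthogonal complement near a point. -/

namespace IsOpticalAt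

variable {G : E5 → Matrix (Fin 5) (Fin 5) ℝ} {Ω : Set E5} {y : E5}
  {N : E5 → Submodule ℂ CVec} {Z : Fin 2 → E5 → CVec} {f : Fin 5 → CVec}

theorem mem_N (h : IsOpticalAt G N Z f y) {a : Fin 5} (ha : inN a) : f a ∈ N y := by
  have : a = 0 ∨ a = 3 := by simpa [inN] using ha
  rcases this with rfl | rfl
  exacts [h.k_mem, h.conj_m_mem]

theorem expand_of_perp (h : IsOpticalAt G N Z f y) {X : CVec} (hX : X ∈ perpC (G y) (N y)) :
    X = contr₂ (G y) (f 1) X • f 0 + contr₂ (G y) (f 2) X • f 3 + contr₂ (G y) (f 4) X • f 4 := by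
  have e := frame_expansion h.gram X
  rw [Fin.sum_univ_five, hX _ h.k_mem, hX _ h.conj_m_mem] at e
  simpa [dual] using e

/-- That k and m̄ span N is not assumed but follows here: X in N lies in N⊥, so X is a combination
of k, m̄ and u, and nullity of X makes the square of its u coefficient zero. -/
theorem u_mem (h : IsOpticalAt G N Z f y) : f 4 ∈ perpC (G y) (N y) := by
  intro X hX
  have hX' := h.null.self_of_nhds hX
  have e := h.expand_of_perp hX'
  set a := contr₂ (G y) (f 1) X
  set b := contr₂ (G y) (f 2) X
  set c := contr₂ (G y) (f 4) X
  have hn : contr₂ (G y) X X = 0 := hX' X hX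
  have key : contr₂ (G y) X X = c * c := by
    rw [e]
    simp only [contr₂_add_left, contr₂_add_right, contr₂_smul_left, contr₂_smul_right, h.gram]
    simp [frameGram, dual]
  have hc : c = 0 := mul_self_eq_zero.mp (key.symm.trans hn)
  rw [e, hc]
  simp only [contr₂_add_left, contr₂_smul_left, h.gram]
  simp [frameGram, dual]

theorem mem_P (h : IsOpticalAt G N Z f y) {a : Fin 5} (ha : inP a) :
    f a ∈ perpC (G y) (N y) := by
  have : (a = 0 ∨ a = 3) ∨ a = 4 := by simpa [inP] using ha
  rcases this with (rfl | rfl) | rfl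
  exacts [h.null.self_of_nhds h.k_mem, h.null.self_of_nhds h.conj_m_mem, h.u_mem]

/-- Freeze the coefficients of the vector with respect to the local spanning fields. -/
theorem exists_section (h : IsOpticalAt G N Z f y) {v : CVec} (hv : v ∈ N y) :
    ∃ F : E5 → CVec, DiffFieldAt F y ∧ F y = v ∧ ∀ᶠ z in 𝓝 y, F z ∈ N z := by
  rw [h.span.self_of_nhds, Submodule.mem_span_range_iff_exists_fun] at hv
  obtain ⟨c, hc⟩ := hv
  refine ⟨fun z => ∑ i, c i • Z i z, fun a => ?_, hc, h.span.mono fun z hz => ?_⟩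
  · simp only [Finset.sum_apply, Pi.smul_apply, smul_eq_mul]
    exact DifferentiableAt.fun_sum fun i _ => (h.diff i a).const_mul _
  · rw [hz]
    exact Submodule.sum_mem _ fun i _ => Submodule.smul_mem _ _ (Submodule.subset_span ⟨i, rfl⟩)

theorem _root_.GoldbergSachs.IsMetricOn.differentiableAt_contr₂ (hG : IsMetricOn G Ω) (hy : y ∈ Ω)
    {F₁ F₂ : E5 → CVec} (h₁ : DiffFieldAt F₁ y) (h₂ : DiffFieldAt F₂ y) :
    DifferentiableAt ℝ (fun z => contr₂ (G z) (F₁ z) (F₂ z)) y := by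
  unfold contr₂
  exact DifferentiableAt.fun_sum fun p _ =>
    ((hG.smooth y hy _ _).differentiableAt_top.complex_ofReal).fun_mul ((h₁ _).fun_mul (h₂ _))

/-- The constant field v is corrected by a combination of l and m whose coefficients solve, by
Cramer's rule, the two linear conditions of orthogonality to the spanning fields of N. -/
theorem exists_section_perp (h : IsOpticalAt G N Z f y) (hG : IsMetricOn G Ω) (hy : y ∈ Ω)
    {v : CVec} (hv : v ∈ perpC (G y) (N y)) :
    ∃ F : E5 → CVec, DiffFieldAt F y ∧ F y = v ∧ ∀ᶠ z in 𝓝 y, F z ∈ perpC (G z) (N z) := by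
  have hconst : ∀ w : CVec, DiffFieldAt (fun _ => w) y := fun w a => differentiableAt_const _
  let A : Fin 2 → CVec → E5 → ℂ := fun i w z => contr₂ (G z) (Z i z) w
  have hA : ∀ i w, DifferentiableAt ℝ (A i w) y := fun i w =>
    hG.differentiableAt_contr₂ hy (h.diff i) (hconst w)
  let D : E5 → ℂ := fun z => A 0 (f 1) z * A 1 (f 2) z - A 0 (f 2) z * A 1 (f 1) z
  have hD : DifferentiableAt ℝ D y :=
    ((hA _ _).fun_mul (hA _ _)).fun_sub ((hA _ _).fun_mul (hA _ _))
  -- The pairings of k, m̄ with l, m form the identity matrix, and k, m̄ are combinations of the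
  -- spanning fields; so `D y` is a factor of 1.
  have hD0 : D y ≠ 0 := by
    have h0 := h.k_mem
    have h3 := h.conj_m_mem
    rw [h.span.self_of_nhds, Submodule.mem_span_range_iff_exists_fun] at h0 h3
    obtain ⟨p, hp⟩ := h0
    obtain ⟨q, hq⟩ := h3
    rw [Fin.sum_univ_two] at hp hq
    have e : ∀ (c : Fin 2 → ℂ) (w : CVec), contr₂ (G y) (c 0 • Z 0 y + c 1 • Z 1 y) w =
        c 0 * A 0 w y + c 1 * A 1 w y := by
      intro c w
      rw [contr₂_add_left, contr₂_smul_left, contr₂_smul_left]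
    have e1 := e p (f 1)
    have e2 := e p (f 2)
    have e3 := e q (f 1)
    have e4 := e q (f 2)
    rw [hp, h.gram] at e1 e2
    rw [hq, h.gram] at e3 e4
    simp only [frameGram, dual] at e1 e2 e3 e4
    simp at e1 e2 e3 e4
    intro hD
    have : (1 : ℂ) = (p 0 * q 1 - p 1 * q 0) * D y := by
      simp only [D]
      linear_combination e1 + (p 0 * A 0 (f 1) y + p 1 * A 1 (f 1) y) * e4
        - (q 0 * A 0 (f 1) y + q 1 * A 1 (f 1) y) * e2
    rw [hD, mul_zero] at this
    exact one_ne_zero this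
  have hDi : DifferentiableAt ℝ (fun z => (D z)⁻¹) y :=
    ((differentiableAt_inv (𝕜 := ℂ) hD0).restrictScalars ℝ).comp y hD
  let α : E5 → ℂ := fun z => (A 0 v z * A 1 (f 2) z - A 0 (f 2) z * A 1 v z) * (D z)⁻¹
  let β : E5 → ℂ := fun z => (A 0 (f 1) z * A 1 v z - A 0 v z * A 1 (f 1) z) * (D z)⁻¹
  have hZ : ∀ i, Z i y ∈ N y := fun i => by
    rw [h.span.self_of_nhds]
    exact Submodule.subset_span ⟨i, rfl⟩
  have hAv : ∀ i, A i v y = 0 := fun i => hv _ (hZ i)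
  have hα : DifferentiableAt ℝ α y :=
    (((hA _ _).fun_mul (hA _ _)).fun_sub ((hA _ _).fun_mul (hA _ _))).fun_mul hDi
  have hβ : DifferentiableAt ℝ β y :=
    (((hA _ _).fun_mul (hA _ _)).fun_sub ((hA _ _).fun_mul (hA _ _))).fun_mul hDi
  refine ⟨fun z => v - (α z • f 1 + β z • f 2), fun a => ?_, ?_, ?_⟩
  · simp only [Pi.sub_apply, Pi.add_apply, Pi.smul_apply, smul_eq_mul]
    exact (differentiableAt_const _).fun_sub ((hα.mul_const _).fun_add (hβ.mul_const _))
  · simp [α, β, hAv]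
  · filter_upwards [h.span, hD.continuousAt.eventually_ne hD0] with z hz hDz
    have key : ∀ i, contr₂ (G z) (Z i z) (v - (α z • f 1 + β z • f 2)) = 0 := by
      intro i
      rw [contr₂_sub_right, contr₂_add_right, contr₂_smul_right, contr₂_smul_right]
      change A i v z - (α z * A i (f 1) z + β z * A i (f 2) z) = 0
      simp only [α, β]
      field_simp
      fin_cases i <;> simp only [D] <;> simp <;> ring
    rw [hz]
    intro X hX
    rw [Submodule.mem_span_range_iff_exists_fun] at hX
    obtain ⟨c, rfl⟩ := hX
    rw [contr₂_sum_left]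
    exact Finset.sum_eq_zero fun i _ => by rw [key, mul_zero]

end IsOpticalAt

end

/-! ### Vanishing of the second fundamental forms and integrability in coordinates. -/

section

/-- The second fundamental form of `N` vanishes. -/
theorem second_fundamental_form_N {w : Fin 5 → Fin 5 → Fin 5 → ℂ}
    (hw : ∀ x b c, inN b → inP c → w x b c = -w x c b) (h03 : ∀ x, inP x → w x 0 3 = 0)
    (h004 : w 0 0 4 = 0) (h304 : w 3 0 4 = 0) (h034 : w 0 3 4 = 0) (h334 : w 3 3 4 = 0)
    {a b j : Fin 5} (ha : inN a) (hb : inN b) (hj : inP j) : w a j b = 0 := by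
  have h00 : ∀ x, w x 0 0 = 0 := fun x => self_eq_neg.mp (hw x 0 0 (by decide) (by decide))
  have h33 : ∀ x, w x 3 3 = 0 := fun x => self_eq_neg.mp (hw x 3 3 (by decide) (by decide))
  have h30 : ∀ x, inP x → w x 3 0 = 0 := fun x hx => by
    rw [hw x 3 0 (by decide) (by decide), h03 x hx, neg_zero]
  have h40 : ∀ x, w x 4 0 = -w x 0 4 := fun x => by
    rw [hw x 0 4 (by decide) (by decide), neg_neg]
  have h43 : ∀ x, w x 4 3 = -w x 3 4 := fun x => by
    rw [hw x 3 4 (by decide) (by decide), neg_neg]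
  clear hw
  fin_cases a <;> fin_cases b <;> fin_cases j <;> simp_all [inN, inP]

/-- The second fundamental form of the orthogonal complement of `N` has at most one component. -/
theorem second_fundamental_form_perp {w : Fin 5 → Fin 5 → Fin 5 → ℂ}
    (hw : ∀ x b c, inN b → inP c → w x b c = -w x c b) (h03 : ∀ x, inP x → w x 0 3 = 0)
    (h004 : w 0 0 4 = 0) (h304 : w 3 0 4 = 0) (h034 : w 0 3 4 = 0) (h334 : w 3 3 4 = 0)
    {a b j : Fin 5} (ha : inP a) (hb : inP b) (hj : inN j)
    (hab : ¬(a = 4 ∧ b = 4)) : w a j b = 0 := by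
  have h00 : ∀ x, w x 0 0 = 0 := fun x => self_eq_neg.mp (hw x 0 0 (by decide) (by decide))
  have h33 : ∀ x, w x 3 3 = 0 := fun x => self_eq_neg.mp (hw x 3 3 (by decide) (by decide))
  have h30 : ∀ x, inP x → w x 3 0 = 0 := fun x hx => by
    rw [hw x 3 0 (by decide) (by decide), h03 x hx, neg_zero]
  have h40 : ∀ x, w x 4 0 = -w x 0 4 := fun x => by
    rw [hw x 0 4 (by decide) (by decide), neg_neg]
  have h43 : ∀ x, w x 4 3 = -w x 3 4 := fun x => by
    rw [hw x 3 4 (by decide) (by decide), neg_neg]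
  clear hw
  fin_cases a <;> fin_cases b <;> fin_cases j <;> simp_all [inN, inP]

namespace IsOpticalAt

variable {G : E5 → Matrix (Fin 5) (Fin 5) ℝ} {Ω : Set E5} {y : E5}
  {N : E5 → Submodule ℂ CVec} {Z : Fin 2 → E5 → CVec} {f : Fin 5 → CVec}

/-- Vector fields extending the frame, tangent to `N` and its complement as far as the vectors
of the frame are. -/
theorem exists_frame_fields (h : IsOpticalAt G N Z f y) (hG : IsMetricOn G Ω) (hy : y ∈ Ω) :
    ∃ F : Fin 5 → E5 → CVec, (∀ a, DiffFieldAt (F a) y) ∧ (∀ a, F a y = f a) ∧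
      (∀ a, inN a → ∀ᶠ z in 𝓝 y, F a z ∈ N z) ∧
      (∀ a, inP a → ∀ᶠ z in 𝓝 y, F a z ∈ perpC (G z) (N z)) := by
  have key : ∀ a, ∃ F : E5 → CVec, DiffFieldAt F y ∧ F y = f a ∧
      (inN a → ∀ᶠ z in 𝓝 y, F z ∈ N z) ∧
      (inP a → ∀ᶠ z in 𝓝 y, F z ∈ perpC (G z) (N z)) := by
    intro a
    by_cases ha : inN a
    · obtain ⟨F, h1, h2, h3⟩ := h.exists_section (h.mem_N ha)
      refine ⟨F, h1, h2, fun _ => h3, fun _ => ?_⟩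
      filter_upwards [h3, h.null] with z hz hz'
      exact hz' hz
    · by_cases hb : inP a
      · obtain ⟨F, h1, h2, h3⟩ := h.exists_section_perp hG hy (h.mem_P hb)
        exact ⟨F, h1, h2, fun h => absurd h ha, fun _ => h3⟩
      · exact ⟨fun _ => f a, fun _ => differentiableAt_const _, rfl, fun h => absurd h ha,
          fun h => absurd h hb⟩
  choose F h1 h2 h3 h4 using key
  exact ⟨F, h1, h2, h3, h4⟩

/-- The scalar product is identically zero nearby, so its derivative along X vanishes. -/
theorem leibniz_of_orthogonal (hG : IsMetricOn G Ω) (hy : y ∈ Ω) {F₁ F₂ : E5 → CVec}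
    (h₁ : DiffFieldAt F₁ y) (h₂ : DiffFieldAt F₂ y)
    (h : ∀ᶠ z in 𝓝 y, contr₂ (G z) (F₁ z) (F₂ z) = 0) (X : CVec) :
    contr₂ (G y) (dirCov G X F₁ y) (F₂ y) = -contr₂ (G y) (F₁ y) (dirCov G X F₂ y) := by
  have e := hG.contr₂_leibniz hy h₁ h₂ X
  rw [Finset.sum_eq_zero] at e
  · exact eq_neg_of_add_eq_zero_left e.symm
  · intro i _
    rw [cpd_congr i h, cpd_const, mul_zero]

/-- The frame components of a vector orthogonal to `N`. -/
theorem expand_perp (h : IsOpticalAt G N Z f y) {X : CVec} (hX : X ∈ perpC (G y) (N y)) :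
    ∃ x : Fin 5 → ℂ, X = ∑ a, x a • f a ∧ ∀ a, ¬inP a → x a = 0 := by
  refine ⟨![contr₂ (G y) (f 1) X, 0, 0, contr₂ (G y) (f 2) X, contr₂ (G y) (f 4) X], ?_, ?_⟩
  · nth_rw 1 [h.expand_of_perp hX]
    simp [Fin.sum_univ_five]
  · intro a
    fin_cases a <;> simp [inP]

/-- The frame components of a vector in `N`. -/
theorem expand_N (h : IsOpticalAt G N Z f y) (hsymm : ∀ i j, G y i j = G y j i) {X : CVec} (hX : X ∈ N y) :
    ∃ x : Fin 5 → ℂ, X = ∑ a, x a • f a ∧ ∀ a, ¬inN a → x a = 0 := by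
  refine ⟨![contr₂ (G y) (f 1) X, 0, 0, contr₂ (G y) (f 2) X, 0], ?_, ?_⟩
  · have h4 : contr₂ (G y) (f 4) X = 0 := by
      rw [contr₂_comm hsymm]
      exact h.u_mem X hX
    nth_rw 1 [h.expand_of_perp (h.null.self_of_nhds hX)]
    simp [Fin.sum_univ_five, h4]
  · intro a
    fin_cases a <;> simp [inN]

theorem dirCov_sum (s : Finset (Fin 5)) (x : Fin 5 → ℂ) (V : Fin 5 → CVec) (F : E5 → CVec) :
    dirCov G (∑ a ∈ s, x a • V a) F y = ∑ a ∈ s, x a • dirCov G (V a) F y := by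
  simp only [dirCov, Finset.sum_apply, Pi.smul_apply, smul_eq_mul, Finset.sum_smul,
    Finset.smul_sum, mul_smul]
  rw [Finset.sum_comm]

/-- Integrability of a distribution at a point follows from the symmetry of its second
fundamental form. -/
theorem contr₂_bracketC_eq_zero (hG : IsMetricOn G Ω) (hy : y ∈ Ω)
    {F F' V : E5 → CVec} (hF : DiffFieldAt F y) (hF' : DiffFieldAt F' y) (hV : DiffFieldAt V y)
    (hFV : ∀ᶠ z in 𝓝 y, contr₂ (G z) (F z) (V z) = 0)
    (hFV' : ∀ᶠ z in 𝓝 y, contr₂ (G z) (F' z) (V z) = 0)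
    {J : Fin 5 → Prop} {x x' : Fin 5 → ℂ} (hx : F y = ∑ a, x a • f a)
    (hx' : F' y = ∑ a, x' a • f a) (hJ : ∀ a, ¬J a → x a = 0) (hJ' : ∀ a, ¬J a → x' a = 0)
    (hsym : ∀ a b, J a → J b → contr₂ (G y) (dirCov G (f a) V y) (f b) =
      contr₂ (G y) (dirCov G (f b) V y) (f a)) :
    contr₂ (G y) (bracketC F F' y) (V y) = 0 := by
  -- Orthogonality moves the derivatives onto V: g([F, F'], V) = g(F, ∇_{F'} V) - g(F', ∇_F V). This
  -- depends only on the values of F and F' at y, hence is a bilinear expression in their frame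
  -- components.
  rw [hG.bracketC_eq hy, contr₂_sub_left, leibniz_of_orthogonal hG hy hF' hV hFV',
    leibniz_of_orthogonal hG hy hF hV hFV, hx, hx', dirCov_sum, dirCov_sum,
    contr₂_comm (hG.symm y hy), contr₂_comm (hG.symm y hy) (∑ a, x a • f a)]
  simp only [contr₂_sum_left, contr₂_sum_right, Finset.mul_sum]
  rw [Finset.sum_comm, neg_sub_neg, sub_eq_zero]
  refine Finset.sum_congr rfl fun b _ => Finset.sum_congr rfl fun a _ => ?_
  by_cases ha : J a
  · by_cases hb : J b
    · rw [hsym a b ha hb]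
      ring
    · simp [hJ b hb]
  · simp [hJ' a ha]

end IsOpticalAt

namespace IsSpecialAt

variable {G : E5 → Matrix (Fin 5) (Fin 5) ℝ} {Ω : Set E5} {y : E5}
  {N : E5 → Submodule ℂ CVec} {Z : Fin 2 → E5 → CVec} {f : Fin 5 → CVec}

/-- The obstructions to integrability vanish where the Weyl tensor is nondegenerate. -/
theorem obstructions_eq_zero (h : IsSpecialAt G N Z f y) (hG : IsMetricOn G Ω) (hy : y ∈ Ω)
    {F : Fin 5 → E5 → CVec} (hF : ∀ a, DiffFieldAt (F a) y) (hFf : ∀ a, F a y = f a)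
    (hFN : ∀ a, inN a → ∀ᶠ z in 𝓝 y, F a z ∈ N z)
    (hFP : ∀ a, inP a → ∀ᶠ z in 𝓝 y, F a z ∈ perpC (G z) (N z))
    {w : Fin 5 → Fin 5 → Fin 5 → ℂ}
    (hw : ∀ x b c, w x b c = contr₂ (G y) (dirCov G (f x) (F b) y) (f c)) :
    (∀ x b c, inN b → inP c → w x b c = -w x c b) ∧
    (∀ x, inP x → w x 0 3 = 0) ∧ w 0 0 4 = 0 ∧ w 3 0 4 = 0 ∧ w 0 3 4 = 0 ∧ w 3 3 4 = 0 := by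
  have hsymm : ∀ X Y, contr₂ (G y) X Y = contr₂ (G y) Y X := contr₂_comm (hG.symm y hy)
  -- The extended fields need not form a null frame away from y. Only the products of fields in N
  -- with fields in N⊥ are constant, which is why the antisymmetry of `w` is restricted to such
  -- pairs.
  have hw1 : ∀ x b c, inN b → inP c → w x b c = -w x c b := by
    intro x b c hb hc
    have hperp : ∀ᶠ z in 𝓝 y, contr₂ (G z) (F b z) (F c z) = 0 := by
      filter_upwards [hFN b hb, hFP c hc] with z hz hz'
      exact hz' _ hz
    have e := IsOpticalAt.leibniz_of_orthogonal hG hy (hF b) (hF c) hperp (f x)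
    rw [hw, hw, ← hFf c, e, hFf b, hsymm]
  refine ⟨hw1, ?_⟩
  set T : Fin 5 → Fin 5 → Fin 5 → Fin 5 → ℝ := fun a b c d => GoldbergSachs.weyl G a b c d y
    with hT
  have hTc : IsCurvatureLike T := hG.weyl_curvatureLike hy
  set C : Fin 5 → Fin 5 → Fin 5 → Fin 5 → ℂ := fun a b c d => contr₄ T (f a) (f b) (f c) (f d)
    with hC
  have hCN : ∀ a b c d, inP a → inP b → inN c → C a b c d = 0 := fun a b c d ha hb hc =>
    h.weyl.self_of_nhds _ (h.mem_P ha) _ (h.mem_P hb) _ (h.mem_N hc) _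
  -- The Weyl tensor is real, so conjugating all arguments, which exchanges m and m̄, conjugates the
  -- component. This yields the conjugate speciality conditions, the reality of φ and the
  -- nondegeneracy of ψ'.
  have hconj : ∀ a b c d, C (Equiv.swap 2 3 a) (Equiv.swap 2 3 b) (Equiv.swap 2 3 c)
      (Equiv.swap 2 3 d) = starRingEnd ℂ (C a b c d) := by
    intro a b c d
    simp only [hC]
    rw [← h.conj, ← h.conj, ← h.conj, ← h.conj, contr₄_conj]
  have hpbar : ∀ a, inPbar a → inP (Equiv.swap 2 3 a) := by decide
  have hnbar : ∀ a, inNbar a → inN (Equiv.swap 2 3 a) := by decide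
  have hCNbar : ∀ a b c d, inPbar a → inPbar b → inNbar c → C a b c d = 0 := by
    intro a b c d ha hb hc
    have e := hCN _ _ _ (Equiv.swap 2 3 d) (hpbar a ha) (hpbar b hb) (hnbar c hc)
    rw [hconj] at e
    exact (map_eq_zero _).mp e
  have hc1 : C 0 2 1 3 = starRingEnd ℂ (C 0 3 1 2) := hconj 0 3 1 2
  have hc2 : C 0 4 1 4 = starRingEnd ℂ (C 0 4 1 4) := hconj 0 4 1 4
  have hnd1 : C 0 2 1 3 ≠ C 0 4 1 4 := by
    rw [hc1, hc2]
    exact fun e => h.nondeg (star_injective e)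
  have hnd2 : C 0 2 1 3 ≠ -C 0 4 1 4 := by
    rw [hc1, hc2, ← map_neg]
    exact fun e => h.nondeg' (star_injective e)
  have hcov := fun e => hG.covFour_curvatureLike hy (fun z hz => hG.weyl_curvatureLike hz)
    (hG.smooth_weyl hy) e
  refine frame_goldberg_sachs (C := C) (hTc.contr₄ f) ?_ hCN hCNbar h.nondeg h.nondeg' hnd1 hnd2
    (A := fun a b c => contr₃ (fun a b c => cottonYork G a b c y) (f a) (f b) (f c))
    (D := fun x a b c d => contr₅ (fun e a b c d => covFour G (GoldbergSachs.weyl G) e a b c d y)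
      (f x) (f a) (f b) (f c) (f d)) ?_ ?_ ?_ ?_ ?_ ?_ hw1 ?_
  · exact fun b d => frame_trace hG hy h.gram (hG.weyl_trace hy) _ _
  · intro x
    simp only [contr₅_eq_sum]
    exact IsCurvatureLike.sum _ _ fun e => (hcov e).contr₄ f
  · intro x b d
    simp only [contr₅_eq_sum]
    rw [Finset.sum_comm]
    refine Finset.sum_eq_zero fun e _ => ?_
    rw [← Finset.mul_sum, frame_trace hG hy h.gram (hG.covFour_weyl_trace hy e), mul_zero]
  · intro a b c d e
    simp only [← h.gram]
    exact contr₅_bianchi (hG.covFour_weyl_bianchi hy) _ _ _ _ _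
  · intro a b c
    rw [contr₃_swap₂₃]
    simp only [contr₃, ← Finset.sum_neg_distrib]
    refine Finset.sum_congr rfl fun p _ => ?_
    simp only [cottonYork]
    push_cast
    ring
  · intro a b c
    rw [contr₃_rotate _ (f a) (f b) (f c), contr₃_rotate _ (f b) (f c) (f a),
      contr₃_rotate _ (f a) (f b) (f c)]
    simp only [contr₃, ← Finset.sum_add_distrib]
    refine Finset.sum_eq_zero fun p _ => ?_
    have e := congrArg Complex.ofReal (hG.cottonYork_cyclic hy p.1 p.2.1 p.2.2)
    push_cast at e
    linear_combination (f a p.1 * f b p.2.1 * f c p.2.2) * e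
  · exact fun a b c ha hb hc => h.cotton _ (h.mem_P hb) _ (h.mem_P hc) _ (h.mem_N ha)
  · intro x a b c d ha hb hc
    -- The fourth argument may be extended by a constant field: the special condition leaves it
    -- arbitrary, so its derivative contributes nothing (`hlast`).
    have hconst : DiffFieldAt (fun _ => f d) y := fun _ => differentiableAt_const _
    have e := contr₄_leibniz (G := G) (fun a b c d => (hG.smooth_weyl hy a b c d).differentiableAt_top)
      (hF a) (hF b) (hF c) hconst (f x)
    have hz : ∀ᶠ z in 𝓝 y, contr₄ (fun a b c d => GoldbergSachs.weyl G a b c d z) (F a z) (F b z)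
        (F c z) (f d) = 0 := by
      filter_upwards [hFP a ha, hFP b hb, hFN c hc, h.weyl] with z h1 h2 h3 h4
      exact h4 _ h1 _ h2 _ h3 _
    rw [Finset.sum_eq_zero] at e
    swap
    · intro i _
      rw [cpd_congr i hz, cpd_const, mul_zero]
    have hlast : contr₄ T (f a) (f b) (f c) (dirCov G (f x) (fun _ => f d) y) = 0 :=
      h.weyl.self_of_nhds _ (h.mem_P ha) _ (h.mem_P hb) _ (h.mem_N hc) _
    simp only [hFf] at e
    -- The coefficient along `f (dual e)` is the product with `f e`, whence the dual index in the
    -- formula for `D`.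
    have hexp : ∀ b, dirCov G (f x) (F b) y = ∑ e, w x b e • f (dual e) := by
      intro b
      rw [frame_expansion h.gram (dirCov G (f x) (F b) y)]
      exact Finset.sum_congr rfl fun e _ => by rw [hw, hsymm]
    rw [← hT, hlast, hexp, hexp, hexp, contr₄_sum₁, contr₄_sum₂, contr₄_sum₃] at e
    simp only [Finset.sum_add_distrib, hC]
    linear_combination -e

/-- N is the annihilator of N⊥, so a bracket is tested against N⊥, for which all entries of the
second fundamental form vanish. -/
theorem involutive_N (h : IsSpecialAt G N Z f y) (hG : IsMetricOn G Ω) (hy : y ∈ Ω)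
    {F F' : E5 → CVec} (hF : DiffFieldAt F y) (hF' : DiffFieldAt F' y)
    (hFN : ∀ᶠ z in 𝓝 y, F z ∈ N z) (hFN' : ∀ᶠ z in 𝓝 y, F' z ∈ N z) {v : CVec}
    (hv : v ∈ perpC (G y) (N y)) : contr₂ (G y) (bracketC F F' y) v = 0 := by
  obtain ⟨E, hE, hEf, hEN, hEP⟩ := h.exists_frame_fields hG hy
  obtain ⟨w, hwE⟩ : ∃ w : Fin 5 → Fin 5 → Fin 5 → ℂ, ∀ x b c,
      w x b c = contr₂ (G y) (dirCov G (f x) (E b) y) (f c) := ⟨_, fun _ _ _ => rfl⟩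
  obtain ⟨hw, h03, h004, h304, h034, h334⟩ :=
    h.obstructions_eq_zero hG hy hE hEf hEN hEP
      hwE
  obtain ⟨x, hx, hx0⟩ := h.expand_N (hG.symm y hy) hFN.self_of_nhds
  obtain ⟨x', hx', hx0'⟩ := h.expand_N (hG.symm y hy) hFN'.self_of_nhds
  obtain ⟨c, rfl, hc⟩ := h.expand_perp hv
  rw [contr₂_sum_right]
  refine Finset.sum_eq_zero fun j _ => ?_
  by_cases hj : inP j
  swap
  · rw [hc j hj, zero_mul]
  have hor : ∀ {F : E5 → CVec}, (∀ᶠ z in 𝓝 y, F z ∈ N z) →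
      ∀ᶠ z in 𝓝 y, contr₂ (G z) (F z) (E j z) = 0 := by
    intro F hF
    filter_upwards [hF, hEP j hj] with z h1 h2
    exact h2 _ h1
  rw [← hEf j, IsOpticalAt.contr₂_bracketC_eq_zero hG hy hF hF' (hE j) (hor hFN) (hor hFN')
    (J := fun a => inN a = true) hx hx' hx0 hx0' ?_, mul_zero]
  intro a b ha hb
  rw [← hwE, ← hwE, second_fundamental_form_N hw h03 h004 h304 h034 h334 ha hb hj,
    second_fundamental_form_N hw h03 h004 h304 h034 h334 hb ha hj]

theorem involutive_perp (h : IsSpecialAt G N Z f y) (hG : IsMetricOn G Ω) (hy : y ∈ Ω)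
    {F F' : E5 → CVec} (hF : DiffFieldAt F y) (hF' : DiffFieldAt F' y)
    (hFP : ∀ᶠ z in 𝓝 y, F z ∈ perpC (G z) (N z))
    (hFP' : ∀ᶠ z in 𝓝 y, F' z ∈ perpC (G z) (N z)) {v : CVec}
    (hv : v ∈ N y) : contr₂ (G y) (bracketC F F' y) v = 0 := by
  obtain ⟨E, hE, hEf, hEN, hEP⟩ := h.exists_frame_fields hG hy
  obtain ⟨w, hwE⟩ : ∃ w : Fin 5 → Fin 5 → Fin 5 → ℂ, ∀ x b c,
      w x b c = contr₂ (G y) (dirCov G (f x) (E b) y) (f c) := ⟨_, fun _ _ _ => rfl⟩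
  obtain ⟨hw, h03, h004, h304, h034, h334⟩ :=
    h.obstructions_eq_zero hG hy hE hEf hEN hEP
      hwE
  obtain ⟨x, hx, hx0⟩ := h.expand_perp hFP.self_of_nhds
  obtain ⟨x', hx', hx0'⟩ := h.expand_perp hFP'.self_of_nhds
  obtain ⟨c, rfl, hc⟩ := h.expand_N (hG.symm y hy) hv
  rw [contr₂_sum_right]
  refine Finset.sum_eq_zero fun j _ => ?_
  by_cases hj : inN j
  swap
  · rw [hc j hj, zero_mul]
  have hor : ∀ {F : E5 → CVec}, (∀ᶠ z in 𝓝 y, F z ∈ perpC (G z) (N z)) →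
      ∀ᶠ z in 𝓝 y, contr₂ (G z) (F z) (E j z) = 0 := by
    intro F hF
    filter_upwards [hF, hEN j hj, hG.mem_nhds hy] with z h1 h2 h3
    rw [contr₂_comm (hG.symm z h3)]
    exact h1 _ h2
  rw [← hEf j, IsOpticalAt.contr₂_bracketC_eq_zero hG hy hF hF' (hE j) (hor hFP) (hor hFP')
    (J := fun a => inP a = true) hx hx' hx0 hx0' ?_, mul_zero]
  intro a b ha hb
  -- The (u, u) entry need not vanish, but symmetry is all that is required, and a diagonal entry is
  -- symmetric.
  by_cases hab : a = 4 ∧ b = 4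
  · rw [hab.1, hab.2]
  · rw [← hwE, ← hwE, second_fundamental_form_perp hw h03 h004 h304 h034 h334 ha hb hj hab,
      second_fundamental_form_perp hw h03 h004 h304 h034 h334 hb ha hj fun e => hab e.symm]

end IsSpecialAt

end

section

/-! ### Adapted frames -/

section LinearAlgebra

variable {V : Type*} [AddCommGroup V] [Module ℝ V]

theorem exists_eq_cvec (z : ℂ ⊗[ℝ] V) : ∃ a b : V, z = cvec a b := by
  induction z using TensorProduct.induction_on with
  | zero => exact ⟨0, 0, by simp [cvec]⟩
  | tmul c v =>
    refine ⟨c.re • v, c.im • v, ?_⟩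
    rw [cvec, TensorProduct.tmul_smul, TensorProduct.tmul_smul, TensorProduct.smul_tmul',
      TensorProduct.smul_tmul', ← TensorProduct.add_tmul]
    congr 1
    apply Complex.ext <;> simp
  | add x y hx hy =>
    obtain ⟨a, b, rfl⟩ := hx
    obtain ⟨c, d, rfl⟩ := hy
    refine ⟨a + c, b + d, ?_⟩
    simp only [cvec, TensorProduct.tmul_add]
    abel

theorem conjC_cvec (a b : V) : conjC (cvec a b) = cvec a (-b) := by
  simp [conjC, cvec, TensorProduct.neg_tmul, TensorProduct.tmul_neg]

theorem one_tmul_eq_cvec (a : V) : (1 : ℂ) ⊗ₜ[ℝ] a = cvec a 0 := by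
  simp [cvec]

theorem real_smul_cvec (t : ℝ) (a b : V) : (t : ℂ) • cvec a b = cvec (t • a) (t • b) := by
  simp only [cvec, smul_add, TensorProduct.smul_tmul', TensorProduct.tmul_smul]
  simp

theorem baseChange_cvec (B : LinearMap.BilinForm ℝ V) (a b c d : V) :
    LinearMap.BilinForm.baseChange ℂ B (cvec a b) (cvec c d) =
      ((B a c - B b d : ℝ) : ℂ) + ((B a d + B b c : ℝ) : ℂ) * Complex.I := by
  simp only [cvec, map_add, LinearMap.add_apply, LinearMap.BilinForm.baseChange_tmul]
  simp only [Complex.real_smul]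
  push_cast
  ring_nf
  rw [Complex.I_sq]
  ring

/-- The matrix of the standard Lorentzian form. -/
def IsLorentzianBasis (B : LinearMap.BilinForm ℝ V) (b : Module.Basis (Fin 5) ℝ V) : Prop :=
  ∀ i j, B (b i) (b j) = if i = j then (if i = 0 then -1 else 1) else 0

variable {B : LinearMap.BilinForm ℝ V} {b : Module.Basis (Fin 5) ℝ V}

theorem IsLorentzianBasis.apply (hb : IsLorentzianBasis B b) (v w : V) :
    B v w = -(b.repr v 0 * b.repr w 0) + b.repr v 1 * b.repr w 1 + b.repr v 2 * b.repr w 2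
      + b.repr v 3 * b.repr w 3 + b.repr v 4 * b.repr w 4 := by
  conv_lhs => rw [← b.sum_repr v, ← b.sum_repr w]
  simp only [Fin.sum_univ_five, map_add, map_smul, LinearMap.add_apply, LinearMap.smul_apply,
    hb _ _, smul_eq_mul]
  simp
  ring

/-- Without time component the form is a sum of squares, so a null vector would be zero. -/
theorem IsLorentzianBasis.repr_zero_ne_zero (hb : IsLorentzianBasis B b) {k : V} (hk : k ≠ 0)
    (hkk : B k k = 0) : b.repr k 0 ≠ 0 := by
  intro h0
  rw [hb.apply, h0] at hkk
  refine hk (b.repr.map_eq_zero_iff.mp (Finsupp.ext fun i => ?_))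
  have h1 := sq_nonneg (b.repr k 1)
  have h2 := sq_nonneg (b.repr k 2)
  have h3 := sq_nonneg (b.repr k 3)
  have h4 := sq_nonneg (b.repr k 4)
  fin_cases i
  · exact h0
  all_goals
    refine pow_eq_zero_iff two_ne_zero |>.mp (le_antisymm ?_ (sq_nonneg _))
    simp only [Fin.reduceFinMk, Fin.mk_one]
    linarith

/-- Write k = (k₀, k') and v = (v₀, v'). Since |k'|² = k₀² and k'·v' = k₀v₀, expanding |k₀v' -
v₀k'|² gives k₀² times the square of v. Hence the form is semidefinite on the complement of k, with
null vectors only along k. -/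
theorem IsLorentzianBasis.key_identity (hb : IsLorentzianBasis B b) {k v : V}
    (hkk : B k k = 0) (hkv : B k v = 0) :
    b.repr k 0 ^ 2 * B v v = (b.repr k 0 * b.repr v 1 - b.repr v 0 * b.repr k 1) ^ 2
      + (b.repr k 0 * b.repr v 2 - b.repr v 0 * b.repr k 2) ^ 2
      + (b.repr k 0 * b.repr v 3 - b.repr v 0 * b.repr k 3) ^ 2
      + (b.repr k 0 * b.repr v 4 - b.repr v 0 * b.repr k 4) ^ 2 := by
  rw [hb.apply] at hkk hkv ⊢
  linear_combination (2 * b.repr k 0 * b.repr v 0) * hkv - (b.repr v 0 ^ 2) * hkk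

theorem IsLorentzianBasis.nonneg_of_orthogonal (hb : IsLorentzianBasis B b) {k v : V} (hk : k ≠ 0)
    (hkk : B k k = 0) (hkv : B k v = 0) : 0 ≤ B v v := by
  have h := hb.key_identity hkk hkv
  have h0 : 0 < b.repr k 0 ^ 2 := by
    have := hb.repr_zero_ne_zero hk hkk
    positivity
  refine nonneg_of_mul_nonneg_right (b := B v v) ?_ h0
  rw [h]
  positivity

theorem IsLorentzianBasis.exists_eq_smul (hb : IsLorentzianBasis B b) {k v : V} (hk : k ≠ 0)
    (hkk : B k k = 0) (hkv : B k v = 0) (hvv : B v v = 0) : ∃ c : ℝ, v = c • k := by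
  have h := hb.key_identity hkk hkv
  have h0 := hb.repr_zero_ne_zero hk hkk
  rw [hvv, mul_zero] at h
  have e1 := sq_nonneg (b.repr k 0 * b.repr v 1 - b.repr v 0 * b.repr k 1)
  have e2 := sq_nonneg (b.repr k 0 * b.repr v 2 - b.repr v 0 * b.repr k 2)
  have e3 := sq_nonneg (b.repr k 0 * b.repr v 3 - b.repr v 0 * b.repr k 3)
  have e4 := sq_nonneg (b.repr k 0 * b.repr v 4 - b.repr v 0 * b.repr k 4)
  have f1 := pow_eq_zero_iff two_ne_zero |>.mp (le_antisymm (by linarith) e1)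
  have f2 := pow_eq_zero_iff two_ne_zero |>.mp (le_antisymm (by linarith) e2)
  have f3 := pow_eq_zero_iff two_ne_zero |>.mp (le_antisymm (by linarith) e3)
  have f4 := pow_eq_zero_iff two_ne_zero |>.mp (le_antisymm (by linarith) e4)
  refine ⟨b.repr v 0 / b.repr k 0, b.repr.injective (Finsupp.ext fun i => ?_)⟩
  rw [map_smul, Finsupp.smul_apply, smul_eq_mul]
  fin_cases i
  · simp [h0]
  all_goals simp only [Fin.reduceFinMk, Fin.mk_one]; field_simp; linarith

/-- A totally null complex plane of real index one in a complexified Lorentzian space admits an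
adapted null frame. -/
theorem exists_adapted_frame (hb : IsLorentzianBasis B b) (hsymm : ∀ v w, B v w = B w v)
    {N : Submodule ℂ (ℂ ⊗[ℝ] V)} {K : Submodule ℝ V}
    (hdim : Module.finrank ℂ N = 2)
    (hnull : ∀ z ∈ N, ∀ w ∈ N, LinearMap.BilinForm.baseChange ℂ B z w = 0)
    (hK : K.baseChange ℂ ≤ N) (hK0 : K ≠ ⊥) :
    ∃ (k l u p q : V), k ∈ K ∧ cvec p q ∈ N ∧ B k k = 0 ∧ B l l = 0 ∧ B k l = 1 ∧ B u u = 1 ∧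
      B k u = 0 ∧ B l u = 0 ∧ B p p = 1 / 2 ∧ B q q = 1 / 2 ∧ B p q = 0 ∧ B p k = 0 ∧ B q k = 0 ∧
      B p l = 0 ∧ B q l = 0 ∧ B p u = 0 ∧ B q u = 0 := by
  obtain ⟨k, hkK, hk⟩ := K.ne_bot_iff.mp hK0
  have hkN : cvec k 0 ∈ N := by
    rw [← one_tmul_eq_cvec]
    exact hK (Submodule.tmul_mem_baseChange_of_mem 1 hkK)
  -- N has dimension two and so is not contained in the line of k.
  obtain ⟨z, hzN, hz⟩ : ∃ z ∈ N, z ∉ Submodule.span ℂ {cvec k 0} := by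
    by_contra! h
    have h1 := Submodule.finrank_mono (R := ℂ) (s := N) (t := Submodule.span ℂ {cvec k 0}) h
    have h2 := finrank_span_le_card (R := ℂ) ({cvec k 0} : Set (ℂ ⊗[ℝ] V))
    simp at h2
    omega
  obtain ⟨a, c, rfl⟩ := exists_eq_cvec z
  have hkk : B k k = 0 := by
    have := hnull _ hkN _ hkN
    rw [baseChange_cvec, Complex.ext_iff] at this
    simpa using this.1
  have hka := hnull _ hkN _ hzN
  have haa := hnull _ hzN _ hzN
  rw [baseChange_cvec, Complex.ext_iff] at hka haa
  simp [hsymm c a] at hka haa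
  obtain ⟨hka, hkc⟩ := hka
  obtain ⟨hac, hac'⟩ := haa
  replace hac' : B a c = 0 := by linarith
  -- For z = a + ic, nullity means that a and c are orthogonal with equal squares, both orthogonal
  -- to k. If the common square were zero, a and c would be real multiples of k and z a complex
  -- multiple, which was excluded.
  have hpos : 0 < B a a := by
    refine lt_of_le_of_ne (hb.nonneg_of_orthogonal hk hkk hka) fun h0 => hz ?_
    obtain ⟨α, rfl⟩ := hb.exists_eq_smul hk hkk hka h0.symm
    obtain ⟨β, rfl⟩ := hb.exists_eq_smul hk hkk hkc (by linarith)
    refine Submodule.mem_span_singleton.mpr ⟨⟨α, β⟩, ?_⟩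
    rw [← one_tmul_eq_cvec, cvec, TensorProduct.tmul_smul, TensorProduct.tmul_smul,
      TensorProduct.smul_tmul', TensorProduct.smul_tmul', TensorProduct.smul_tmul',
      ← TensorProduct.add_tmul]
    congr 1
    apply Complex.ext <;> simp
  obtain ⟨t, ht⟩ : ∃ t : ℝ, t * t * B a a = 1 / 2 := by
    refine ⟨√(1 / (2 * B a a)), ?_⟩
    rw [Real.mul_self_sqrt (by positivity)]
    field_simp
  obtain ⟨p, hp⟩ : ∃ p, p = t • a := ⟨_, rfl⟩
  obtain ⟨q, hq⟩ : ∃ q, q = t • c := ⟨_, rfl⟩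
  have hpq : cvec p q ∈ N := by
    rw [hp, hq, ← real_smul_cvec]
    exact N.smul_mem _ hzN
  have hpp : B p p = 1 / 2 := by simp [hp]; linarith
  have hqq : B q q = 1 / 2 := by
    have : B c c = B a a := by linarith
    simp [hq, this]; linarith
  have hpq0 : B p q = 0 := by simp [hp, hq, hac']
  have hkp : B k p = 0 := by simp [hp, hka]
  have hkq : B k q = 0 := by simp [hq, hkc]
  have hpk : B p k = 0 := by rw [hsymm, hkp]
  have hqk : B q k = 0 := by rw [hsymm, hkq]
  have hqp : B q p = 0 := by rw [hsymm, hpq0]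
  -- Any v with k·v = 1 will do; since k·b₀ = -k₀, a multiple of the timelike basis vector works.
  -- Next v is made orthogonal to p and q, whose squares are 1 / 2 (whence the factors 2).
  obtain ⟨v, hv⟩ : ∃ v, B k v = 1 := by
    have h0 := hb.repr_zero_ne_zero hk hkk
    refine ⟨(-(b.repr k 0)⁻¹) • b 0, ?_⟩
    rw [hb.apply]
    simp [h0]
  obtain ⟨l₀, hl₀⟩ : ∃ w, w = v - (2 * B p v) • p - (2 * B q v) • q := ⟨_, rfl⟩
  have hkl₀ : B k l₀ = 1 := by simp [hl₀, hv, hkp, hkq]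
  have hpl₀ : B p l₀ = 0 := by simp [hl₀, hpp, hpq0]; ring
  have hql₀ : B q l₀ = 0 := by simp [hl₀, hqp, hqq]; ring
  have hl₀k : B l₀ k = 1 := by rw [hsymm, hkl₀]
  -- Subtracting half the square of l₀ times k makes the vector null without changing its other
  -- products.
  obtain ⟨l, hl⟩ : ∃ w, w = l₀ - (B l₀ l₀ / 2) • k := ⟨_, rfl⟩
  have hkl : B k l = 1 := by simp [hl, hkl₀, hkk]
  have hpl : B p l = 0 := by simp [hl, hpl₀, hpk]
  have hql : B q l = 0 := by simp [hl, hql₀, hqk]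
  have hll : B l l = 0 := by simp [hl, hkl₀, hl₀k, hkk]; ring
  have hlk : B l k = 1 := by rw [hsymm, hkl]
  have hlp : B l p = 0 := by rw [hsymm, hpl]
  have hlq : B l q = 0 := by rw [hsymm, hql]
  -- Four vectors do not span a five-dimensional space; the projection of w₀ to the complement of
  -- their span is the direction of u.
  obtain ⟨w₀, hw₀⟩ : ∃ w₀, w₀ ∉ Submodule.span ℝ (Set.range ![k, l, p, q]) := by
    by_contra! h
    have h1 := finrank_range_le_card (R := ℝ) ![k, l, p, q]
    rw [Set.finrank, (Submodule.eq_top_iff'.mpr h), finrank_top,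
      Module.finrank_eq_card_basis b] at h1
    simp at h1
  obtain ⟨w, hw⟩ : ∃ w, w = w₀ - B l w₀ • k - B k w₀ • l - (2 * B p w₀) • p
    - (2 * B q w₀) • q := ⟨_, rfl⟩
  have hkw : B k w = 0 := by simp [hw, hkk, hkl, hkp, hkq]
  have hlw : B l w = 0 := by simp [hw, hlk, hll, hlp, hlq]
  have hpw : B p w = 0 := by simp [hw, hpk, hpl, hpp, hpq0]; ring
  have hqw : B q w = 0 := by simp [hw, hqk, hql, hqp, hqq]; ring
  -- If w were null it would be a multiple of k, and orthogonality to l forces the multiple to be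
  -- zero, putting w₀ in the span.
  have hwpos : 0 < B w w := by
    refine lt_of_le_of_ne (hb.nonneg_of_orthogonal hk hkk hkw) fun h0 => hw₀ ?_
    obtain ⟨α, hα⟩ := hb.exists_eq_smul hk hkk hkw h0.symm
    have hα0 : α = 0 := by
      rw [hα] at hlw
      simpa [hlk] using hlw
    rw [hα0, zero_smul] at hα
    have : w₀ = B l w₀ • k + B k w₀ • l + (2 * B p w₀) • p + (2 * B q w₀) • q := by
      rw [hα] at hw
      linear_combination (norm := module) -hw
    rw [this]
    have hmem : ∀ i, ![k, l, p, q] i ∈ Submodule.span ℝ (Set.range ![k, l, p, q]) := fun i =>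
      Submodule.subset_span ⟨i, rfl⟩
    exact add_mem (add_mem (add_mem (Submodule.smul_mem _ _ (hmem 0))
      (Submodule.smul_mem _ _ (hmem 1))) (Submodule.smul_mem _ _ (hmem 2)))
      (Submodule.smul_mem _ _ (hmem 3))
  obtain ⟨s, hs⟩ : ∃ s : ℝ, s * s * B w w = 1 := by
    refine ⟨√(1 / B w w), ?_⟩
    rw [Real.mul_self_sqrt (by positivity)]
    field_simp
  refine ⟨k, l, s • w, p, q, hkK, hpq, hkk, hll, hkl, ?_, ?_, ?_, hpp, hqq, hpq0, hpk, hqk, hpl,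
    hql, ?_, ?_⟩
  · simp only [map_smul, LinearMap.smul_apply, smul_eq_mul]
    linarith
  all_goals simp [hkw, hlw, hpw, hqw]

end LinearAlgebra

variable {M : Type*} [TopologicalSpace M] [ChartedSpace E5 M] [IsManifold 𝓘(ℝ, E5) ∞ M]
  {g : LorentzianMetric M}

theorem AlmostOpticalStructure.exists_isAdaptedFrame (S : AlmostOpticalStructure g) (x : M) :
    ∃ k l u m, S.IsAdaptedFrame x k l u m := by
  obtain ⟨b, hb⟩ := g.signature x
  -- The real index enters here: a zero K would make N and its conjugate intersect trivially.
  have hK0 : S.K x ≠ ⊥ := by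
    intro h
    have h1 := S.realIndex x
    rw [S.complexification_K, h, Submodule.baseChange_bot] at h1
    simp at h1
  obtain ⟨k, l, u, p, q, hk, hpq, hkk, hll, hkl, huu, hku, hlu, hpp, hqq, hpq0, hpk, hqk, hpl, hql,
      hpu, hqu⟩ := exists_adapted_frame (B := (g.inner x).toBilinForm) (b := b) hb (g.symm x)
    (S.subbundle.1 x) (fun z hz w hw => S.totallyNull x hw z hz)
    ((S.complexification_K x).symm.le.trans inf_le_left) hK0
  have hqp : (g.inner x).toBilinForm q p = 0 := (g.symm x q p).trans hpq0
  -- It is m̄ = p + iq that lies in N, so m is p - iq.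
  refine ⟨k, l, u, cvec p (-q), hk, ?_, hkk, hll, hkl, huu, hku, hlu, ?_, ?_, ?_, ?_, ?_⟩
  · simpa [conjC_cvec] using hpq
  all_goals
    simp only [LorentzianMetric.complexForm, conjC_cvec, one_tmul_eq_cvec]
    rw [baseChange_cvec]
    simp only [map_neg, LinearMap.neg_apply, neg_neg, map_zero, hpp, hqq, hpq0, hqp, hpk, hqk, hpl,
      hql, hpu, hqu]
    norm_num

end

section

/-! ### Tensors of a Lorentzian manifold in a chart -/

variable {M : Type*} [TopologicalSpace M] [ChartedSpace E5 M]
  {e : OpenPartialHomeomorph M E5}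

variable (e) in
/-- The components, in the chart `e`, of a complex tangent vector. -/
def coordC (x : M) : CTangent x →ₗ[ℂ] CVec :=
  LinearMap.pi fun i => (TensorProduct.AlgebraTensorModule.rid ℝ ℂ ℂ).toLinearMap ∘ₗ
    (component e x i).baseChange ℂ

theorem coordC_apply (x : M) (Z : CTangent x) (i : Fin 5) : coordC e x Z i = componentC e x i Z :=
  rfl

theorem coordC_tmul (x : M) (c : ℂ) (v : TangentSpace 𝓘(ℝ, E5) x) (i : Fin 5) :
    coordC e x (c ⊗ₜ v) i = component e x i v * c := by
  simp [coordC]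

theorem coordC_cvec (x : M) (v w : TangentSpace 𝓘(ℝ, E5) x) (i : Fin 5) :
    coordC e x (cvec v w) i = component e x i v + component e x i w * Complex.I := by
  rw [cvec, map_add, Pi.add_apply, coordC_tmul, coordC_tmul, mul_one]

theorem coordC_conjC (x : M) (Z : CTangent x) : coordC e x (conjC Z) = conjV (coordC e x Z) := by
  obtain ⟨v, w, rfl⟩ := exists_eq_cvec Z
  ext i
  rw [conjC_cvec, coordC_cvec, conjV, coordC_cvec]
  simp

variable [IsManifold 𝓘(ℝ, E5) ∞ M]

theorem mdifferentiable_of_mem_atlas' (he : e ∈ atlas E5 M) :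
    e.MDifferentiable 𝓘(ℝ, E5) 𝓘(ℝ, E5) :=
  haveI : IsManifold 𝓘(ℝ, E5) 1 M := IsManifold.of_le (n := ∞) (by simp)
  mdifferentiable_of_mem_atlas he

theorem mfderiv_coordVec (he : e ∈ atlas E5 M) {y : E5} (hy : y ∈ e.target) (i : Fin 5) :
    (mfderiv 𝓘(ℝ, E5) 𝓘(ℝ, E5) e (e.symm y) (coordVec e y i) : E5) =
      EuclideanSpace.single i (1 : ℝ) :=
  DFunLike.congr_fun ((mdifferentiable_of_mem_atlas' he).comp_symm_deriv hy)
    (EuclideanSpace.single i (1 : ℝ) : E5)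

theorem component_coordVec (he : e ∈ atlas E5 M) {y : E5} (hy : y ∈ e.target) (i j : Fin 5) :
    component e (e.symm y) i (coordVec e y j) = if i = j then 1 else 0 := by
  change (show E5 from mfderiv 𝓘(ℝ, E5) 𝓘(ℝ, E5) e (e.symm y) (coordVec e y j)) i = _
  rw [mfderiv_coordVec he hy]
  simp

theorem eq_of_component_eq (he : e ∈ atlas E5 M) {x : M} (hx : x ∈ e.source)
    {v w : TangentSpace 𝓘(ℝ, E5) x} (h : ∀ i, component e x i v = component e x i w) : v = w := by
  refine (mdifferentiable_of_mem_atlas' he).mfderiv_injective hx ?_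
  exact PiLp.ext fun i => h i

theorem sum_component_smul_coordVec (he : e ∈ atlas E5 M) {y : E5} (hy : y ∈ e.target)
    (v : TangentSpace 𝓘(ℝ, E5) (e.symm y)) :
    v = ∑ i, component e (e.symm y) i v • coordVec e y i := by
  refine eq_of_component_eq he (e.map_target hy) fun i => ?_
  rw [map_sum]
  simp [component_coordVec he hy]

theorem coordC_injective (he : e ∈ atlas E5 M) {x : M} (hx : x ∈ e.source) :
    Function.Injective (coordC e x) := by
  refine (injective_iff_map_eq_zero _).mpr fun Z hZ => ?_
  obtain ⟨v, w, rfl⟩ := exists_eq_cvec Z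
  have h : ∀ i, component e x i v = 0 ∧ component e x i w = 0 := fun i => by
    have := congrFun hZ i
    rw [coordC_cvec, Complex.ext_iff] at this
    simpa using this
  have hv : v = 0 := eq_of_component_eq he hx fun i => by rw [(h i).1, map_zero]
  have hw : w = 0 := eq_of_component_eq he hx fun i => by rw [(h i).2, map_zero]
  simp [hv, hw, cvec]

theorem coordC_surjective (he : e ∈ atlas E5 M) {y : E5} (hy : y ∈ e.target) :
    Function.Surjective (coordC e (e.symm y)) := by
  intro X
  refine ⟨∑ i, X i ⊗ₜ coordVec e y i, ?_⟩
  ext j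
  rw [map_sum, Finset.sum_apply]
  simp [coordC_tmul, component_coordVec he hy, apply_ite Complex.ofReal, ite_mul]

theorem LorentzianMetric.complexForm_eq_contr₂ (g : LorentzianMetric M) (he : e ∈ atlas E5 M)
    {y : E5} (hy : y ∈ e.target) (Z W : CTangent (e.symm y)) :
    g.complexForm (e.symm y) Z W =
      contr₂ (g.coordMatrix e y) (coordC e _ Z) (coordC e _ W) := by
  have hreal : ∀ v w : TangentSpace 𝓘(ℝ, E5) (e.symm y), g.inner (e.symm y) v w =
      ∑ p : Fin 5 × Fin 5, g.coordMatrix e y p.1 p.2 *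
        (component e (e.symm y) p.1 v * component e (e.symm y) p.2 w) := by
    intro v w
    conv_lhs => rw [sum_component_smul_coordVec he hy v, sum_component_smul_coordVec he hy w]
    simp only [map_sum, map_smul, _root_.sum_apply, _root_.smul_apply,
      Fintype.sum_prod_type, smul_eq_mul, Finset.mul_sum, LorentzianMetric.coordMatrix, Matrix.of_apply]
    rw [Finset.sum_comm]
    exact Finset.sum_congr rfl fun i _ => Finset.sum_congr rfl fun j _ => by ring
  obtain ⟨v, w, rfl⟩ := exists_eq_cvec Z
  obtain ⟨v', w', rfl⟩ := exists_eq_cvec W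
  rw [LorentzianMetric.complexForm, baseChange_cvec]
  change ((g.inner (e.symm y) v v' - g.inner (e.symm y) w w' : ℝ) : ℂ) +
    ((g.inner (e.symm y) v w' + g.inner (e.symm y) w v' : ℝ) : ℂ) * Complex.I = _
  rw [hreal, hreal, hreal, hreal, contr₂]
  push_cast
  rw [← Finset.sum_sub_distrib, ← Finset.sum_add_distrib, Finset.sum_mul, ← Finset.sum_add_distrib]
  refine Finset.sum_congr rfl fun p _ => ?_
  rw [coordC_cvec, coordC_cvec]
  ring_nf
  rw [Complex.I_sq]
  ring

theorem LorentzianMetric.weylC_eq_contr₄ (g : LorentzianMetric M) {y : E5} (hy : y ∈ e.target)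
    (X Y Z W : CTangent (e.symm y)) :
    g.weylC e (e.symm y) X Y Z W = contr₄ (fun a b c d => weyl (g.coordMatrix e) a b c d y)
      (coordC e _ X) (coordC e _ Y) (coordC e _ Z) (coordC e _ W) := by
  simp only [LorentzianMetric.weylC, contr₄, Fintype.sum_prod_type, e.right_inv hy, coordC_apply,
    mul_assoc]

theorem LorentzianMetric.cottonYorkC_eq_contr₃ (g : LorentzianMetric M) {y : E5}
    (hy : y ∈ e.target) (X Y Z : CTangent (e.symm y)) :
    g.cottonYorkC e (e.symm y) X Y Z = contr₃ (fun a b c => cottonYork (g.coordMatrix e) a b c y)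
      (coordC e _ X) (coordC e _ Y) (coordC e _ Z) := by
  simp only [LorentzianMetric.cottonYorkC, contr₃, Fintype.sum_prod_type, e.right_inv hy,
    coordC_apply, mul_assoc]

variable (e) in
/-- A complex distribution in the chart `e`. -/
def coordDistribution (D : ∀ x : M, Submodule ℂ (CTangent x)) (y : E5) : Submodule ℂ CVec :=
  (D (e.symm y)).map (coordC e (e.symm y))

theorem coordC_mem_iff (he : e ∈ atlas E5 M) {y : E5} (hy : y ∈ e.target)
    {D : ∀ x : M, Submodule ℂ (CTangent x)} {Z : CTangent (e.symm y)} :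
    coordC e (e.symm y) Z ∈ coordDistribution e D y ↔ Z ∈ D (e.symm y) := by
  constructor
  · rintro ⟨W, hW, h⟩
    rwa [← coordC_injective he (e.map_target hy) h]
  · exact fun h => ⟨Z, h, rfl⟩

theorem LorentzianMetric.coordDistribution_perp (g : LorentzianMetric M) (he : e ∈ atlas E5 M)
    {y : E5} (hy : y ∈ e.target) (D : ∀ x : M, Submodule ℂ (CTangent x)) :
    coordDistribution e (g.perp D) y = perpC (g.coordMatrix e y) (coordDistribution e D y) := by
  ext X
  obtain ⟨Z, rfl⟩ := coordC_surjective he hy X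
  rw [coordC_mem_iff he hy]
  constructor
  · rintro h _ ⟨W, hW, rfl⟩
    rw [← g.complexForm_eq_contr₂ he hy]
    exact h W hW
  · intro h W hW
    change g.complexForm (e.symm y) W Z = 0
    rw [g.complexForm_eq_contr₂ he hy]
    exact h _ ⟨W, hW, rfl⟩

end

section

/-! ### Smoothness of coordinate expressions -/

variable {M : Type*} [TopologicalSpace M] [ChartedSpace E5 M]
  {e : OpenPartialHomeomorph M E5}

variable (e) in
/-- A real vector field in the chart `e`. -/
def coordField (X : ∀ x : M, TangentSpace 𝓘(ℝ, E5) x) (y : E5) : E5 :=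
  mfderiv 𝓘(ℝ, E5) 𝓘(ℝ, E5) e (e.symm y) (X (e.symm y))

variable (e) in
/-- The complex vector field `X + i Y` in the chart `e`. -/
def coordFieldC (X Y : ∀ x : M, TangentSpace 𝓘(ℝ, E5) x) (y : E5) : CVec :=
  coordC e (e.symm y) (cvec (X (e.symm y)) (Y (e.symm y)))

theorem coordFieldC_apply (X Y : ∀ x : M, TangentSpace 𝓘(ℝ, E5) x) (y : E5) (i : Fin 5) :
    coordFieldC e X Y y i = coordField e X y i + coordField e Y y i * Complex.I :=
  coordC_cvec _ _ _ _

variable [IsManifold 𝓘(ℝ, E5) ∞ M]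

/-- Coordinate fields are the images of constant fields under the tangent map of the inverse chart.
-/
theorem contMDiffOn_coordVec (he : e ∈ atlas E5 M) (i : Fin 5) :
    ContMDiffOn 𝓘(ℝ, E5) (𝓘(ℝ, E5).prod 𝓘(ℝ, E5)) ∞
      (fun y => Bundle.TotalSpace.mk' E5 (E := TangentSpace 𝓘(ℝ, E5)) (e.symm y) (coordVec e y i))
      e.target := by
  have : IsManifold 𝓘(ℝ, E5) 1 M := IsManifold.of_le (n := ∞) (by simp)
  have h1 : ContMDiffOn 𝓘(ℝ, E5) 𝓘(ℝ, E5) ∞ e.symm e.target :=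
    contMDiffOn_symm_of_mem_maximalAtlas (IsManifold.subset_maximalAtlas he)
  have h2 := h1.contMDiffOn_tangentMapWithin (m := ∞) (by simp) e.open_target.uniqueMDiffOn
  have h3 : ContMDiff 𝓘(ℝ, E5) (𝓘(ℝ, E5).prod 𝓘(ℝ, E5)) ∞
      (fun y => Bundle.TotalSpace.mk' E5 (E := TangentSpace 𝓘(ℝ, E5) (M := E5)) y
        (EuclideanSpace.single i (1 : ℝ) : E5)) := fun y =>
    contMDiffAt_vectorSpace_iff_contDiffAt.mpr contDiffAt_const
  refine (h2.comp h3.contMDiffOn (fun y hy => hy)).congr fun y hy => ?_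
  simp only [Function.comp_apply, tangentMapWithin]
  rw [mfderivWithin_of_isOpen e.open_target hy]
  rfl

theorem LorentzianMetric.contDiffOn_coordMatrix (g : LorentzianMetric M) (he : e ∈ atlas E5 M)
    (i j : Fin 5) : ContDiffOn ℝ ∞ (fun y => g.coordMatrix e y i j) e.target := by
  have h1 : ContMDiffOn 𝓘(ℝ, E5) 𝓘(ℝ, E5) ∞ e.symm e.target :=
    contMDiffOn_symm_of_mem_maximalAtlas (IsManifold.subset_maximalAtlas he)
  have h2 := g.contMDiff.comp_contMDiffOn h1
  have h3 := ContMDiffOn.clm_bundle_apply₂ (E₃ := Bundle.Trivial M ℝ) h2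
    (contMDiffOn_coordVec he i) (contMDiffOn_coordVec he j)
  exact fun y hy => ((Bundle.contMDiffWithinAt_totalSpace.mp (h3 y hy)).2).contDiffWithinAt

theorem LorentzianMetric.isMetricOn (g : LorentzianMetric M) (he : e ∈ atlas E5 M) :
    IsMetricOn (g.coordMatrix e) e.target where
  isOpen := e.open_target
  smooth y hy i j := (g.contDiffOn_coordMatrix he i j).contDiffAt (e.open_target.mem_nhds hy)
  symm _ _ _ _ := g.symm _ _ _
  det y hy := by
    intro h
    -- A kernel vector of the Gram matrix would give a tangent vector orthogonal to everything;
    -- testing it on an orthonormal basis shows that it is zero.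
    obtain ⟨v, hv, hGv⟩ := Matrix.exists_mulVec_eq_zero_iff.mpr h
    obtain ⟨b, hb⟩ := g.signature (e.symm y)
    obtain ⟨w, hw⟩ : ∃ w, w = ∑ i, v i • coordVec e y i := ⟨_, rfl⟩
    have h1 : ∀ j, g.inner (e.symm y) (coordVec e y j) w = 0 := by
      intro j
      rw [hw, map_sum]
      refine Eq.trans ?_ (congrFun hGv j)
      simp only [map_smul, smul_eq_mul, Matrix.mulVec, dotProduct, LorentzianMetric.coordMatrix,
        Matrix.of_apply]
      exact Finset.sum_congr rfl fun i _ => mul_comm _ _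
    have h2 : ∀ u, g.inner (e.symm y) u w = 0 := by
      intro u
      rw [sum_component_smul_coordVec he hy u]
      simp [h1]
    have h3 : w = 0 := by
      refine b.repr.map_eq_zero_iff.mp (Finsupp.ext fun i => ?_)
      have e1 := h2 (b i)
      rw [← b.sum_repr w, map_sum] at e1
      simp only [map_smul, hb, smul_eq_mul, mul_ite, mul_zero, Finset.sum_ite_eq,
        Finset.mem_univ, if_true] at e1
      split_ifs at e1 <;> simpa using e1
    refine hv (funext fun i => ?_)
    have e2 := congrArg (component e (e.symm y) i) hw
    rw [h3, map_zero, map_sum] at e2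
    simpa [component_coordVec he hy] using e2.symm

theorem isInvertible_mfderiv_symm (he : e ∈ atlas E5 M) {y : E5} (hy : y ∈ e.target) :
    (mfderiv 𝓘(ℝ, E5) 𝓘(ℝ, E5) e.symm y).IsInvertible :=
  ⟨(mdifferentiable_of_mem_atlas' he).symm.mfderiv hy, rfl⟩

/-- Pulling back along the inverse chart is pushing forward along the chart, by the chain rule. It
gives access to the smoothness and bracket lemmas for pullbacks. -/
theorem mpullback_eq_coordField (he : e ∈ atlas E5 M) {y : E5} (hy : y ∈ e.target)
    (X : ∀ x : M, TangentSpace 𝓘(ℝ, E5) x) :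
    VectorField.mpullback 𝓘(ℝ, E5) 𝓘(ℝ, E5) e.symm X y = coordField e X y := by
  rw [VectorField.mpullback_apply, coordField]
  nth_rw 2 [← (isInvertible_mfderiv_symm he hy).self_apply_inverse (X (e.symm y))]
  exact (DFunLike.congr_fun ((mdifferentiable_of_mem_atlas' he).comp_symm_deriv hy) _).symm

theorem contDiffAt_coordField (he : e ∈ atlas E5 M) {y : E5} (hy : y ∈ e.target)
    {X : ∀ x : M, TangentSpace 𝓘(ℝ, E5) x} {U : Set M} (hU : IsOpen U) (hyU : e.symm y ∈ U)
    (hX : SmoothFieldOn X U) : ContDiffAt ℝ ∞ (coordField e X) y := by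
  have h1 : ContMDiffAt 𝓘(ℝ, E5) 𝓘(ℝ, E5) ∞ e.symm y :=
    (contMDiffOn_symm_of_mem_maximalAtlas (IsManifold.subset_maximalAtlas he)).contMDiffAt
      (e.open_target.mem_nhds hy)
  have h2 := ContMDiffAt.mpullback_vectorField_preimage (m := ∞)
    (hX.contMDiffAt (hU.mem_nhds hyU)) h1 (isInvertible_mfderiv_symm he hy) (by simp)
  refine (contMDiffAt_vectorSpace_iff_contDiffAt.mp h2).congr_of_eventuallyEq ?_
  filter_upwards [e.open_target.mem_nhds hy] with z hz
  exact (mpullback_eq_coordField he hz X).symm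

/-- The components of the Lie bracket. -/
theorem component_mlieBracket (x : M) (X Y : ∀ x : M, TangentSpace 𝓘(ℝ, E5) x) (i : Fin 5) :
    component (chartAt E5 x) x i (VectorField.mlieBracket 𝓘(ℝ, E5) X Y x) =
      VectorField.lieBracket ℝ (coordField (chartAt E5 x) X) (coordField (chartAt E5 x) Y)
        (chartAt E5 x x) i := by
  set e := chartAt E5 x with he
  have hea : e ∈ atlas E5 M := chart_mem_atlas E5 x
  have hex : e x ∈ e.target := e.map_source (mem_chart_source E5 x)
  have h1 : (extChartAt 𝓘(ℝ, E5) x : M → E5) = e := by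
    ext1 z
    simp [extChartAt, he]
  have h2 : ((extChartAt 𝓘(ℝ, E5) x).symm : E5 → M) = e.symm := by
    ext1 z
    simp [extChartAt, he]
  have h3 : ∀ X : ∀ x : M, TangentSpace 𝓘(ℝ, E5) x,
      (fun z => VectorField.mpullback 𝓘(ℝ, E5) 𝓘(ℝ, E5) e.symm X z : E5 → E5) =ᶠ[𝓝 (e x)]
        coordField e X := fun X => by
    filter_upwards [e.open_target.mem_nhds hex] with z hz
    exact mpullback_eq_coordField hea hz X
  have hinv : (mfderiv 𝓘(ℝ, E5) 𝓘(ℝ, E5) e x).IsInvertible :=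
    ⟨(mdifferentiable_of_mem_atlas' hea).mfderiv (mem_chart_source E5 x), rfl⟩
  -- On a manifold the bracket at x is defined through the preferred chart at x, which is why this
  -- chart is used. Its derivative cancels the inverse that occurs in the definition.
  rw [← VectorField.mlieBracketWithin_univ, VectorField.mlieBracketWithin_apply, h1, h2,
    ← (h3 X).lieBracket_vectorField_eq (h3 Y)]
  simp only [modelWithCornersSelf_coe, Set.range_id, VectorField.mpullbackWithin_univ,
    Set.preimage_univ, Set.inter_self]
  refine (congrArg (fun v : E5 => v i) (hinv.self_apply_inverse _)).trans ?_
  exact congrArg (fun v : E5 => v i) (congrFun VectorField.lieBracketWithin_univ (e x))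

theorem lieBracket_apply_eq_sum {V W : E5 → E5} {y : E5} (hV : DifferentiableAt ℝ V y)
    (hW : DifferentiableAt ℝ W y) (i : Fin 5) :
    VectorField.lieBracket ℝ V W y i =
      ∑ j, (V y j * pd j (fun z => W z i) y - W y j * pd j (fun z => V z i) y) := by
  have key : ∀ {V : E5 → E5}, DifferentiableAt ℝ V y → ∀ w : E5,
      (fderiv ℝ V y w) i = ∑ j, w j * pd j (fun z => V z i) y := by
    intro V hV w
    have e1 : ∀ v, fderiv ℝ (fun z => V z i) y v = (fderiv ℝ V y v) i := fun v => by
      have := ((EuclideanSpace.proj i : E5 →L[ℝ] ℝ).hasFDerivAt.comp y hV.hasFDerivAt).fderiv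
      exact DFunLike.congr_fun this v
    simp only [pd, e1]
    have e2 : w = ∑ j, w j • EuclideanSpace.single j (1 : ℝ) := by
      ext k
      simp [Pi.single_apply]
    conv_lhs => rw [e2]
    rw [map_sum]
    simp
  rw [VectorField.lieBracket_eq, PiLp.sub_apply, key hW, key hV, Finset.sum_sub_distrib]

theorem contDiffAt_coordFieldC (he : e ∈ atlas E5 M) {y : E5} (hy : y ∈ e.target)
    {X Y : ∀ x : M, TangentSpace 𝓘(ℝ, E5) x} {U : Set M} (hU : IsOpen U) (hyU : e.symm y ∈ U)
    (hX : SmoothFieldOn X U) (hY : SmoothFieldOn Y U) (i : Fin 5) :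
    ContDiffAt ℝ ∞ (fun z => coordFieldC e X Y z i) y := by
  simp only [coordFieldC_apply]
  have key : ∀ {X : ∀ x : M, TangentSpace 𝓘(ℝ, E5) x}, SmoothFieldOn X U →
      ContDiffAt ℝ ∞ (fun z => (coordField e X z i : ℂ)) y := fun hX =>
    Complex.ofRealCLM.contDiff.contDiffAt.comp y
      ((EuclideanSpace.proj i : E5 →L[ℝ] ℝ).contDiff.contDiffAt.comp y
        (contDiffAt_coordField he hy hU hyU hX))
  exact (key hX).add ((key hY).mul contDiffAt_const)

/-- The Lie bracket of complex vector fields in coordinates. -/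
theorem coordC_bracket (x : M) {X Y X' Y' : ∀ x : M, TangentSpace 𝓘(ℝ, E5) x} {U : Set M}
    (hU : IsOpen U) (hx : x ∈ U) (hX : SmoothFieldOn X U) (hY : SmoothFieldOn Y U)
    (hX' : SmoothFieldOn X' U) (hY' : SmoothFieldOn Y' U) :
    coordC (chartAt E5 x) x (cvec
        (VectorField.mlieBracket 𝓘(ℝ, E5) X X' x - VectorField.mlieBracket 𝓘(ℝ, E5) Y Y' x)
        (VectorField.mlieBracket 𝓘(ℝ, E5) X Y' x + VectorField.mlieBracket 𝓘(ℝ, E5) Y X' x)) =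
      bracketC (coordFieldC (chartAt E5 x) X Y) (coordFieldC (chartAt E5 x) X' Y')
        (chartAt E5 x x) := by
  set e := chartAt E5 x with he
  have hex : e x ∈ e.target := e.map_source (mem_chart_source E5 x)
  have hxU : e.symm (e x) ∈ U := by rwa [e.left_inv (mem_chart_source E5 x)]
  have hd : ∀ {X : ∀ x : M, TangentSpace 𝓘(ℝ, E5) x}, SmoothFieldOn X U →
      DifferentiableAt ℝ (coordField e X) (e x) := fun hX =>
    (contDiffAt_coordField (chart_mem_atlas E5 x) hex hU hxU hX).differentiableAt (by simp)
  have hdi : ∀ {X : ∀ x : M, TangentSpace 𝓘(ℝ, E5) x}, SmoothFieldOn X U → ∀ i,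
      DifferentiableAt ℝ (fun z => coordField e X z i) (e x) := fun hX i =>
    (EuclideanSpace.proj i : E5 →L[ℝ] ℝ).differentiableAt.comp (e x) (hd hX)
  have hc : ∀ {X Y : ∀ x : M, TangentSpace 𝓘(ℝ, E5) x}, SmoothFieldOn X U → SmoothFieldOn Y U →
      ∀ i j, cpd j (fun z => coordFieldC e X Y z i) (e x) =
        pd j (fun z => coordField e X z i) (e x)
          + pd j (fun z => coordField e Y z i) (e x) * Complex.I := by
    intro X Y hX hY i j
    simp only [coordFieldC_apply]
    rw [cpd_add j (hdi hX i).complex_ofReal ((hdi hY i).complex_ofReal.mul_const _),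
      cpd_mul j (hdi hY i).complex_ofReal (differentiableAt_const _), cpd_const, cpd_ofReal j
      (hdi hX i), cpd_ofReal j (hdi hY i), mul_zero, add_zero]
  ext i
  rw [coordC_cvec, map_sub, map_add, component_mlieBracket, component_mlieBracket,
    component_mlieBracket, component_mlieBracket, ← he, lieBracket_apply_eq_sum (hd hX) (hd hX'),
    lieBracket_apply_eq_sum (hd hY) (hd hY'), lieBracket_apply_eq_sum (hd hX) (hd hY'),
    lieBracket_apply_eq_sum (hd hY) (hd hX'), bracketC]
  push_cast
  rw [← Finset.sum_sub_distrib, ← Finset.sum_add_distrib, Finset.sum_mul, ← Finset.sum_add_distrib]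
  refine Finset.sum_congr rfl fun j _ => ?_
  rw [hc hX hY, hc hX' hY', coordFieldC_apply, coordFieldC_apply]
  ring_nf
  rw [Complex.I_sq]
  ring

end

section

/-! ### The Goldberg-Sachs theorem -/

theorem contr₂_conj (T : Matrix (Fin 5) (Fin 5) ℝ) (X Y : CVec) :
    contr₂ T (conjV X) (conjV Y) = starRingEnd ℂ (contr₂ T X Y) := by
  simp [contr₂, conjV]

theorem eq_frameGram {P : Fin 5 → Fin 5 → ℂ} (hsymm : ∀ a b, P a b = P b a) (h00 : P 0 0 = 0)
    (h01 : P 0 1 = 1) (h04 : P 0 4 = 0) (h11 : P 1 1 = 0) (h14 : P 1 4 = 0) (h44 : P 4 4 = 1)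
    (h20 : P 2 0 = 0) (h21 : P 2 1 = 0) (h22 : P 2 2 = 0) (h23 : P 2 3 = 1) (h24 : P 2 4 = 0)
    (h30 : P 3 0 = 0) (h31 : P 3 1 = 0) (h33 : P 3 3 = 0) (h34 : P 3 4 = 0) (a b : Fin 5) :
    P a b = frameGram a b := by
  have h10 := (hsymm 1 0).trans h01
  have h40 := (hsymm 4 0).trans h04
  have h41 := (hsymm 4 1).trans h14
  have h02 := (hsymm 0 2).trans h20
  have h12 := (hsymm 1 2).trans h21
  have h32 := (hsymm 3 2).trans h23
  have h42 := (hsymm 4 2).trans h24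
  have h03 := (hsymm 0 3).trans h30
  have h13 := (hsymm 1 3).trans h31
  have h43 := (hsymm 4 3).trans h34
  clear hsymm
  fin_cases a <;> fin_cases b <;> simp_all [frameGram, dual]

section Coordinates

variable {G : E5 → Matrix (Fin 5) (Fin 5) ℝ} {Ω : Set E5} {y : E5}
  {N : E5 → Submodule ℂ CVec} {Z : Fin 2 → E5 → CVec} {f : Fin 5 → CVec}

/-- This is N⊥⊥ = N: orthogonality to k, m̄ and u leaves only the coefficients along k and m̄. -/
theorem IsOpticalAt.mem_of_orthogonal (h : IsOpticalAt G N Z f y) (hG : IsMetricOn G Ω)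
    (hy : y ∈ Ω) {b : CVec} (hb : ∀ w ∈ perpC (G y) (N y), contr₂ (G y) b w = 0) : b ∈ N y := by
  have h0 : ∀ a, inP a → contr₂ (G y) (f a) b = 0 := fun a ha => by
    rw [contr₂_comm (hG.symm y hy)]
    exact hb _ (h.mem_P ha)
  rw [frame_expansion h.gram b, Fin.sum_univ_five, h0 0 (by decide), h0 3 (by decide),
    h0 4 (by decide)]
  simp only [zero_smul, zero_add, add_zero]
  exact add_mem (Submodule.smul_mem _ _ h.k_mem) (Submodule.smul_mem _ _ h.conj_m_mem)

theorem eq_zero_of_frequently {φ : E5 → ℂ} {p : E5 → Prop} (hφ : ContinuousAt φ y)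
    (hp : ∃ᶠ z in 𝓝 y, p z) (h : ∀ᶠ z in 𝓝 y, p z → φ z = 0) : φ y = 0 := by
  by_contra h0
  obtain ⟨z, hz, hz1, hz2⟩ := (hp.and_eventually (h.and (hφ.eventually_ne h0))).exists
  exact hz2 (hz1 hz)

/-- Supplies the continuity that carries vanishing from the nondegenerate points to all points. -/
theorem continuousAt_contr₂_bracketC (hG : IsMetricOn G Ω) (hy : y ∈ Ω) {F F' V : E5 → CVec}
    (hF : ∀ i, ContDiffAt ℝ ∞ (fun z => F z i) y) (hF' : ∀ i, ContDiffAt ℝ ∞ (fun z => F' z i) y)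
    (hV : DiffFieldAt V y) :
    ContinuousAt (fun z => contr₂ (G z) (bracketC F F' z) (V z)) y := by
  have hc : ∀ {f : E5 → ℂ}, ContDiffAt ℝ ∞ f y → ∀ i, ContinuousAt (cpd i f) y := fun hf i =>
    ((hf.fderiv_right (m := 0) (by simp)).continuousAt).clm_apply continuousAt_const
  have hb : ∀ i, ContinuousAt (fun z => bracketC F F' z i) y := by
    intro i
    simp only [bracketC]
    exact tendsto_finsetSum _ fun j _ => ((hF j).continuousAt.mul (hc (hF' i) j)).sub
      ((hF' j).continuousAt.mul (hc (hF i) j))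
  unfold contr₂
  exact tendsto_finsetSum _ fun p _ =>
    (Complex.continuous_ofReal.continuousAt.comp (hG.smooth y hy p.1 p.2).continuousAt).mul
      ((hb p.1).mul (hV p.2).continuousAt)

end Coordinates

variable {M : Type*} [TopologicalSpace M] [ChartedSpace E5 M]
  {e : OpenPartialHomeomorph M E5}

variable (e) in
/-- The components of the frame `(k, l, m, conj m, u)`. -/
def frameC {x : M} (k l u : TangentSpace 𝓘(ℝ, E5) x) (m : CTangent x) : Fin 5 → CVec :=
  ![coordC e x (1 ⊗ₜ k), coordC e x (1 ⊗ₜ l), coordC e x m, coordC e x (conjC m),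
    coordC e x (1 ⊗ₜ u)]

theorem conjV_coordC_real {x : M} (k : TangentSpace 𝓘(ℝ, E5) x) :
    conjV (coordC e x (1 ⊗ₜ k)) = coordC e x (1 ⊗ₜ k) := by
  rw [← coordC_conjC, one_tmul_eq_cvec, conjC_cvec, neg_zero]

theorem conjV_frameC {x : M} (k l u : TangentSpace 𝓘(ℝ, E5) x) (m : CTangent x) (a : Fin 5) :
    conjV (frameC e k l u m a) = frameC e k l u m (Equiv.swap 2 3 a) := by
  fin_cases a
  · exact conjV_coordC_real k
  · exact conjV_coordC_real l
  · exact (coordC_conjC x m).symm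
  · exact (coordC_conjC x (conjC m)).symm.trans (congrArg _ (conjC_conjC m))
  · exact conjV_coordC_real u

variable [IsManifold 𝓘(ℝ, E5) ∞ M] {g : LorentzianMetric M}

theorem LorentzianMetric.contr₂_real (he : e ∈ atlas E5 M) {y : E5} (hy : y ∈ e.target)
    (k l : TangentSpace 𝓘(ℝ, E5) (e.symm y)) :
    contr₂ (g.coordMatrix e y) (coordC e _ (1 ⊗ₜ k)) (coordC e _ (1 ⊗ₜ l)) =
      g.inner (e.symm y) k l := by
  rw [← g.complexForm_eq_contr₂ he hy, LorentzianMetric.complexForm,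
    LinearMap.BilinForm.baseChange_tmul]
  simp

theorem coordC_mem_iff' (he : e ∈ atlas E5 M) {x : M} (hx : x ∈ e.source)
    {D : ∀ x : M, Submodule ℂ (CTangent x)} {Z : CTangent x} :
    coordC e x Z ∈ coordDistribution e D (e x) ↔ Z ∈ D x := by
  rw [coordDistribution, e.left_inv hx]
  constructor
  · rintro ⟨W, hW, h⟩
    rwa [← coordC_injective he hx h]
  · exact fun h => ⟨Z, h, rfl⟩

/-! ### From the chart expression back to the manifold. -/

namespace AlmostOpticalStructure

variable (S : AlmostOpticalStructure g)

theorem gram_frameC (he : e ∈ atlas E5 M) {y : E5} (hy : y ∈ e.target)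
    {k l u : TangentSpace 𝓘(ℝ, E5) (e.symm y)} {m : CTangent (e.symm y)}
    (hf : S.IsAdaptedFrame (e.symm y) k l u m) (a b : Fin 5) :
    contr₂ (g.coordMatrix e y) (frameC e k l u m a) (frameC e k l u m b) = frameGram a b := by
  have hcj := conjV_frameC (e := e) k l u m
  have hconj : ∀ {a b}, contr₂ (g.coordMatrix e y) (frameC e k l u m a) (frameC e k l u m b) = 0 →
      contr₂ (g.coordMatrix e y) (frameC e k l u m (Equiv.swap 2 3 a))
        (frameC e k l u m (Equiv.swap 2 3 b)) = 0 := fun h => by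
    rw [← hcj, ← hcj, contr₂_conj, h, map_zero]
  have hr : ∀ {v w : TangentSpace 𝓘(ℝ, E5) (e.symm y)} {c : ℝ}, g.inner (e.symm y) v w = c →
      contr₂ (g.coordMatrix e y) (coordC e _ (1 ⊗ₜ v)) (coordC e _ (1 ⊗ₜ w)) = c := fun h => by
    rw [LorentzianMetric.contr₂_real he hy, h]
  have hm : ∀ {v w : CTangent (e.symm y)} {c : ℂ}, g.complexForm (e.symm y) v w = c →
      contr₂ (g.coordMatrix e y) (coordC e _ v) (coordC e _ w) = c := fun h => by
    rw [← g.complexForm_eq_contr₂ he hy, h]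
  exact eq_frameGram
    (P := fun a b => contr₂ (g.coordMatrix e y) (frameC e k l u m a) (frameC e k l u m b))
    (fun _ _ => contr₂_comm ((g.isMetricOn he).symm y hy) _ _)
    ((hr hf.kk).trans Complex.ofReal_zero) ((hr hf.kl).trans Complex.ofReal_one)
    ((hr hf.ku).trans Complex.ofReal_zero) ((hr hf.ll).trans Complex.ofReal_zero)
    ((hr hf.lu).trans Complex.ofReal_zero) ((hr hf.uu).trans Complex.ofReal_one)
    (hm hf.km) (hm hf.lm) (hm hf.mm) (hm hf.m_conj_m) (hm hf.um)
    (hconj (a := 2) (b := 0) (hm hf.km)) (hconj (a := 2) (b := 1) (hm hf.lm))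
    (hconj (a := 2) (b := 2) (hm hf.mm)) (hconj (a := 2) (b := 4) (hm hf.um)) a b

/-- The chart expression of an almost optical structure. -/
theorem isOpticalAt (he : e ∈ atlas E5 M) {y : E5} (hy : y ∈ e.target)
    {k l u : TangentSpace 𝓘(ℝ, E5) (e.symm y)} {m : CTangent (e.symm y)}
    (hf : S.IsAdaptedFrame (e.symm y) k l u m) {U : Set M} (hU : IsOpen U) (hyU : e.symm y ∈ U)
    {X Y : Fin 2 → ∀ x : M, TangentSpace 𝓘(ℝ, E5) x} (hX : ∀ i, SmoothFieldOn (X i) U)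
    (hY : ∀ i, SmoothFieldOn (Y i) U)
    (hN : ∀ x ∈ U, S.N x = Submodule.span ℂ (Set.range fun i => cvec (X i x) (Y i x))) :
    IsOpticalAt (g.coordMatrix e) (coordDistribution e S.N) (fun i => coordFieldC e (X i) (Y i))
      (frameC e k l u m) y where
  diff i a := (contDiffAt_coordFieldC he hy hU hyU (hX i) (hY i) a).differentiableAt (by simp)
  span := by
    filter_upwards [(e.isOpen_inter_preimage_symm hU).mem_nhds ⟨hy, hyU⟩] with z hz
    rw [coordDistribution, hN _ hz.2, Submodule.map_span, ← Set.range_comp]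
    rfl
  null := by
    filter_upwards [e.open_target.mem_nhds hy] with z hz
    rw [← g.coordDistribution_perp he hz]
    exact Submodule.map_mono (S.totallyNull _)
  gram := S.gram_frameC he hy hf
  conj := conjV_frameC k l u m
  k_mem := by
    refine (coordC_mem_iff he hy).mpr ?_
    have h : (1 : ℂ) ⊗ₜ[ℝ] k ∈ (S.K (e.symm y)).baseChange ℂ :=
      Submodule.tmul_mem_baseChange_of_mem 1 hf.k_mem
    rw [← S.complexification_K] at h
    exact h.1
  conj_m_mem := (coordC_mem_iff he hy).mpr hf.conj_m_mem

theorem isSpecialAt (hC : S.WeylAlgebraicallySpecial) (hA : S.CottonYorkDegenerate)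
    (he : e ∈ atlas E5 M) {y : E5} (hy : y ∈ e.target) (hnd : S.WeylNondegenerateAt (e.symm y))
    {k l u : TangentSpace 𝓘(ℝ, E5) (e.symm y)} {m : CTangent (e.symm y)}
    (hf : S.IsAdaptedFrame (e.symm y) k l u m) {Z : Fin 2 → E5 → CVec}
    (h : IsOpticalAt (g.coordMatrix e) (coordDistribution e S.N) Z (frameC e k l u m) y) :
    IsSpecialAt (g.coordMatrix e) (coordDistribution e S.N) Z (frameC e k l u m) y where
  toIsOpticalAt := h
  weyl := by
    filter_upwards [e.open_target.mem_nhds hy] with z hz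
    rw [← g.coordDistribution_perp he hz]
    rintro _ ⟨X, hX, rfl⟩ _ ⟨Y, hY, rfl⟩ _ ⟨V, hV, rfl⟩ W
    obtain ⟨W, rfl⟩ := coordC_surjective he hz W
    rw [← g.weylC_eq_contr₄ hz]
    exact hC e he _ (e.map_target hz) X hX Y hY V hV W
  cotton := by
    rw [← g.coordDistribution_perp he hy]
    rintro _ ⟨X, hX, rfl⟩ _ ⟨Y, hY, rfl⟩ _ ⟨V, hV, rfl⟩
    rw [← g.cottonYorkC_eq_contr₃ hy]
    exact hA e he _ (e.map_target hy) X hX Y hY V hV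
  nondeg := by
    have := (hnd e he (e.map_target hy) k l u m hf).1
    rwa [psi2, psi02, g.weylC_eq_contr₄ hy, g.weylC_eq_contr₄ hy] at this
  nondeg' := by
    have := (hnd e he (e.map_target hy) k l u m hf).2
    rwa [psi2, psi02, g.weylC_eq_contr₄ hy, g.weylC_eq_contr₄ hy] at this

/-- Continuity of the chart carries density near x to points accumulating at the image of x. -/
theorem frequently_nondegenerate (hd : Dense {x : M | S.WeylNondegenerateAt x}) {x : M}
    (hx : x ∈ e.source) : ∃ᶠ z in 𝓝 (e x), S.WeylNondegenerateAt (e.symm z) := by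
  refine (e.continuousAt hx).tendsto.frequently ?_
  have h := mem_closure_iff_frequently.mp (hd x)
  refine (h.and_eventually (e.open_source.mem_nhds hx)).mono fun z hz => ?_
  rw [e.left_inv hz.2]
  exact hz.1

/-- The chart expression of the structure near `x`, with a local frame of `N` and adapted frames at
all points. -/
theorem exists_chart_expression (hC : S.WeylAlgebraicallySpecial) (hA : S.CottonYorkDegenerate)
    (he : e ∈ atlas E5 M) {x : M} (hx : x ∈ e.source) : ∃ Z : Fin 2 → E5 → CVec,
      ∀ᶠ z in 𝓝 (e x), ∃ f, IsOpticalAt (g.coordMatrix e) (coordDistribution e S.N) Z f z ∧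
        (S.WeylNondegenerateAt (e.symm z) →
          IsSpecialAt (g.coordMatrix e) (coordDistribution e S.N) Z f z) := by
  obtain ⟨U, hU, hxU, X, Y, hX, hY, hN⟩ := S.subbundle.2 x
  refine ⟨fun i => coordFieldC e (X i) (Y i), ?_⟩
  filter_upwards [(e.isOpen_inter_preimage_symm hU).mem_nhds
    ⟨e.map_source hx, by rwa [Set.mem_preimage, e.left_inv hx]⟩] with z hz
  obtain ⟨k, l, u, m, hf⟩ := S.exists_isAdaptedFrame (e.symm z)
  have h := S.isOpticalAt he hz.1 hf hU hz.2 hX hY hN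
  exact ⟨_, h, fun hnd => S.isSpecialAt hC hA he hz.1 hnd hf h⟩

variable {S} in
-- In the preferred chart at x, membership of a bracket in N or N⊥ is its orthogonality to the
-- vectors of the other distribution. Each such vector is extended to a section, and the pairing
-- vanishes at x by continuity.
theorem isIntegrable (hC : S.WeylGenericallyAlgebraicallySpecial) (hA : S.CottonYorkDegenerate) :
    S.IsIntegrable := by
  constructor
  · intro U hU X Y X' Y' hX hY hX' hY' hXY hXY' x hx
    obtain ⟨e, hee⟩ : ∃ e, e = chartAt E5 x := ⟨_, rfl⟩
    have he : e ∈ atlas E5 M := hee ▸ chart_mem_atlas E5 x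
    have hxe : x ∈ e.source := hee ▸ mem_chart_source E5 x
    have hG := g.isMetricOn he
    have hex := e.map_source hxe
    have hW : ∀ᶠ z in 𝓝 (e x), z ∈ e.target ∧ e.symm z ∈ U :=
      (e.isOpen_inter_preimage_symm hU).mem_nhds ⟨hex, by rwa [Set.mem_preimage, e.left_inv hxe]⟩
    obtain ⟨Z, hZ⟩ := S.exists_chart_expression hC.1 hA he hxe
    obtain ⟨f, hf, -⟩ := hZ.self_of_nhds
    rw [← coordC_mem_iff' he hxe, hee, coordC_bracket x hU hx hX hY hX' hY', ← hee]
    refine hf.mem_of_orthogonal hG hex fun v hv => ?_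
    obtain ⟨V, hV, rfl, hVP⟩ := hf.exists_section_perp hG hex hv
    have hs : ∀ {z X Y}, (z ∈ e.target ∧ e.symm z ∈ U) → SmoothFieldOn X U → SmoothFieldOn Y U →
        ∀ i, ContDiffAt ℝ ∞ (fun z => coordFieldC e X Y z i) z := fun hz hX hY i =>
      contDiffAt_coordFieldC he hz.1 hU hz.2 hX hY i
    refine eq_zero_of_frequently (continuousAt_contr₂_bracketC hG hex
      (hs hW.self_of_nhds hX hY) (hs hW.self_of_nhds hX' hY') hV)
      (S.frequently_nondegenerate hC.2 hxe) ?_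
    -- The adapted frame is chosen anew at each nearby nondegenerate point; only the spanning fields
    -- `Z` are shared.
    filter_upwards [hZ, hVP, hW.eventually_nhds] with z ⟨f, hf, hfs⟩ hVz hWz hnd
    have hz := hWz.self_of_nhds
    exact (hfs hnd).involutive_N hG hz.1
      (fun i => (hs hz hX hY i).differentiableAt (by simp))
      (fun i => (hs hz hX' hY' i).differentiableAt (by simp))
      (hWz.mono fun w hw => ⟨_, hXY _ hw.2, rfl⟩) (hWz.mono fun w hw => ⟨_, hXY' _ hw.2, rfl⟩) hVz
  · intro U hU X Y X' Y' hX hY hX' hY' hXY hXY' x hx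
    obtain ⟨e, hee⟩ : ∃ e, e = chartAt E5 x := ⟨_, rfl⟩
    have he : e ∈ atlas E5 M := hee ▸ chart_mem_atlas E5 x
    have hxe : x ∈ e.source := hee ▸ mem_chart_source E5 x
    have hG := g.isMetricOn he
    have hex := e.map_source hxe
    have hW : ∀ᶠ z in 𝓝 (e x), z ∈ e.target ∧ e.symm z ∈ U :=
      (e.isOpen_inter_preimage_symm hU).mem_nhds ⟨hex, by rwa [Set.mem_preimage, e.left_inv hxe]⟩
    obtain ⟨Z, hZ⟩ := S.exists_chart_expression hC.1 hA he hxe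
    obtain ⟨f, hf, -⟩ := hZ.self_of_nhds
    rw [← coordC_mem_iff' he hxe, hee, coordC_bracket x hU hx hX hY hX' hY', ← hee,
      g.coordDistribution_perp he hex]
    -- Membership in N⊥ is by definition orthogonality to N, so here the test section comes from N
    -- itself.
    intro v hv
    obtain ⟨V, hV, rfl, hVN⟩ := hf.exists_section hv
    rw [contr₂_comm (hG.symm _ hex)]
    have hs : ∀ {z X Y}, (z ∈ e.target ∧ e.symm z ∈ U) → SmoothFieldOn X U → SmoothFieldOn Y U →
        ∀ i, ContDiffAt ℝ ∞ (fun z => coordFieldC e X Y z i) z := fun hz hX hY i =>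
      contDiffAt_coordFieldC he hz.1 hU hz.2 hX hY i
    refine eq_zero_of_frequently (continuousAt_contr₂_bracketC hG hex
      (hs hW.self_of_nhds hX hY) (hs hW.self_of_nhds hX' hY') hV)
      (S.frequently_nondegenerate hC.2 hxe) ?_
    filter_upwards [hZ, hVN, hW.eventually_nhds] with z ⟨f, hf, hfs⟩ hVz hWz hnd
    have hz := hWz.self_of_nhds
    have hP : ∀ {X Y : ∀ x : M, TangentSpace 𝓘(ℝ, E5) x},
        (∀ x ∈ U, cvec (X x) (Y x) ∈ g.perp S.N x) → ∀ᶠ w in 𝓝 z,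
          coordFieldC e X Y w ∈ perpC (g.coordMatrix e w) (coordDistribution e S.N w) := fun h =>
      hWz.mono fun w hw => by
        rw [← g.coordDistribution_perp he hw.1]
        exact ⟨_, h _ hw.2, rfl⟩
    exact (hfs hnd).involutive_perp hG hz.1
      (fun i => (hs hz hX hY i).differentiableAt (by simp))
      (fun i => (hs hz hX' hY' i).differentiableAt (by simp)) (hP hXY) (hP hXY') hVz

end AlmostOpticalStructure

end

end GoldbergSachs

end

theorem mainTheorem1 {M : Type*} [TopologicalSpace M] [ChartedSpace GoldbergSachs.E5 M]
    [IsManifold 𝓘(ℝ, GoldbergSachs.E5) ∞ M]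
    (g : GoldbergSachs.LorentzianMetric M) (S : GoldbergSachs.AlmostOpticalStructure g)
    (hC : S.WeylGenericallyAlgebraicallySpecial)
    (hA : S.CottonYorkDegenerate) :
    S.IsIntegrable :=
  GoldbergSachs.AlmostOpticalStructure.isIntegrable hC hA
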